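/- For a finite graph $G$ and an integer $k$, Maker and Breaker alternately choose an uncolored vertex of $G$ and give it a color from $\{1,\dots,k\}$ that no neighbor of it has received; Maker moves first. Maker wins if all vertices are eventually colored, and otherwise Breaker wins. The game chromatic number $\chi_g(G)$ is the least $k$ for which Maker has a winning strategy. Let $G_{n,p}$, $p=p(n)$, be the random graph on $n$ labeled vertices in which every edge appears independently with probability $p$, and let $b=1/(1-p)$. A sequence of events holds whp if its probability tends to $1$ as $n\to\infty$. Theorem 1. (a) There is an absolute constant $K>0$ such that for all constants $\eta>0$ and $\varepsilon>0$: if $(\log n)^{K\varepsilon^{-3}}/n\le p\le 1-\eta$ for all sufficiently large $n$, then whp $$\chi_g(G_{n,p})\ge(1-\varepsilon)\,\frac{n}{\log_b(np)}.$$ (b) Let $\eta>0$ and $\alpha>2$ be constants and $K=\max\left\{\frac{2\alpha}{\alpha-1},\frac{\alpha}{\alpha-2}\right\}$. If $(\log n)^{K}/n\le p\le 1-\eta$ for all sufficiently large $n$, then whp $$\chi_g(G_{n,p})\le\alpha\,\frac{n}{\log_b(np)}.$$ -/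

import Mathlib

open Filter Topology

namespace ColoringGame

/-- The two players of the colouring game. -/
inductive Player
  | maker
  | breaker

/-- A partial colouring of the vertices with colours from `Fin k`;
`none` means that the vertex is still uncoloured. -/
abbrev PartialColoring (V : Type*) (k : ℕ) := V → Option (Fin k)

/-- A legal move: `v` is uncoloured and no neighbour of `v` has received the colour `i`. -/
def Legal {V : Type*} {k : ℕ} (G : SimpleGraph V) (c : PartialColoring V k) (v : V) (i : Fin k) :
    Prop :=
  c v = none ∧ ∀ w, G.Adj v w → c w ≠ some i

/-- `MakerWins G P c`: when the position is `c` and player `P` is to move, Maker can force that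
all vertices of `G` are eventually coloured. When some vertex is uncoloured and the player to move
has no legal move, the play is over and Breaker has won. -/
inductive MakerWins {V : Type*} [DecidableEq V] {k : ℕ} (G : SimpleGraph V) :
    Player → PartialColoring V k → Prop
  | complete (P : Player) (c : PartialColoring V k) (h : ∀ v, c v ≠ none) : MakerWins G P c
  | maker (c : PartialColoring V k) (v : V) (i : Fin k) (h : Legal G c v i)
      (hw : MakerWins G Player.breaker (Function.update c v (some i))) :
      MakerWins G Player.maker c
  | breaker (c : PartialColoring V k) (h : ∃ v i, Legal G c v i)
      (hw : ∀ v i, Legal G c v i → MakerWins G Player.maker (Function.update c v (some i))) :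
      MakerWins G Player.breaker c

/-- Maker, who moves first, has a winning strategy in the colouring game on `G` with `k` colours. -/
def MakerHasWinningStrategy {V : Type*} [DecidableEq V] (G : SimpleGraph V) (k : ℕ) : Prop :=
  MakerWins G Player.maker (fun _ => none : PartialColoring V k)

/-- The game chromatic number: the least number of colours for which Maker has a winning strategy
(such numbers exist for finite graphs, see `exists_makerHasWinningStrategy`). -/
noncomputable def gameChromaticNumber {V : Type*} [DecidableEq V] (G : SimpleGraph V) : ℕ :=
  sInf {k : ℕ | MakerHasWinningStrategy G k}

/-- With as many colours as vertices Maker wins, so the minimum above is over a nonempty set. -/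
theorem exists_makerHasWinningStrategy {V : Type*} [Fintype V] [DecidableEq V]
    (G : SimpleGraph V) : ∃ k, MakerHasWinningStrategy G k := by
  refine ⟨Fintype.card V, ?_⟩
  have legal : ∀ (c : PartialColoring V (Fintype.card V)) (v : V), c v = none →
      ∃ i, Legal G c v i := by
    intro c v hv
    by_contra hcon
    have hall : ∀ i, ∃ w, c w = some i := by
      intro i
      by_contra hi
      push Not at hi
      exact hcon ⟨i, hv, fun w _ => hi w⟩
    choose f hf using hall
    have hinj : Function.Injective f := by
      intro i j hij
      have h1 := hf i
      rw [hij, hf j] at h1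
      exact (Option.some.inj h1).symm
    have hsurj : Function.Surjective f :=
      ((Fintype.bijective_iff_injective_and_card f).2 ⟨hinj, by simp⟩).2
    obtain ⟨i, hi⟩ := hsurj v
    have h2 := hf i
    rw [hi, hv] at h2
    cases h2
  have key : ∀ (m : ℕ) (P : Player) (c : PartialColoring V (Fintype.card V)),
      (Finset.univ.filter fun v => c v = none).card = m → MakerWins G P c := by
    intro m
    induction m with
    | zero =>
      intro P c hc
      refine MakerWins.complete P c fun v hv => ?_
      rw [Finset.card_eq_zero] at hc
      have hmem : v ∈ Finset.univ.filter fun v => c v = none := by simp [hv]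
      rw [hc] at hmem
      simp at hmem
    | succ m ih =>
      intro P c hc
      have step : ∀ v i, Legal G c v i →
          (Finset.univ.filter fun w => Function.update c v (some i) w = none).card = m := by
        intro v i h
        have he : (Finset.univ.filter fun w => Function.update c v (some i) w = none)
            = (Finset.univ.filter fun w => c w = none).erase v := by
          ext w
          by_cases hw : w = v
          · subst hw; simp
          · simp [hw]
        rw [he, Finset.card_erase_of_mem (by simp [h.1]), hc]
        rfl
      obtain ⟨v, hv⟩ : (Finset.univ.filter fun v => c v = none).Nonempty := by
        rw [← Finset.card_pos, hc]; exact Nat.succ_pos m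
      obtain ⟨i, hi⟩ := legal c v (by simpa using hv)
      cases P with
      | maker => exact MakerWins.maker c v i hi (ih _ _ (step v i hi))
      | breaker =>
        exact MakerWins.breaker c ⟨v, i, hi⟩ fun w j hj => ih _ _ (step w j hj)
  exact key _ _ _ rfl

end ColoringGame

/-!
Write `x = n p` and `L = log_b x`, so that `(1 - p) ^ L = 1 / x`. Both parts hold for every graph
that satisfies finitely many pseudorandomness conditions, each of which fails in the random graph
with probability at most `1 / x`; here `x → ∞` and `log n` is at most a power of `x`, namely `√x` for
the upper bound and a small power for the lower bound.

*Upper bound.* Maker always colours a vertex with the fewest available colours. With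
`k = α n / L` colours, convexity and a Chernoff bound show that in any partial colouring all but few
of the uncoloured vertices have at least `θ₀` available colours, where `θ₀` is a power of `x` with
exponent greater than `1 / 2` (this is where `2 < α` enters). For a threshold `θ ≤ θ₀` consider the
last turn of Maker at which all uncoloured vertices had at least `θ` available colours. Since then
Maker has coloured only vertices with fewer than `θ` of them, and these are at least about half of
all vertices coloured since. When the threshold drops by `d`, the vertices that Maker has coloured
since the later of the two turns have lost `d` colours, hence have `d` neighbours among the vertices
coloured since the earlier turn. Small vertex sets of a random graph span few edges, so the number
of vertices coloured since the turn shrinks by a constant factor, and after few such steps it is at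
most `4`. As a vertex loses at most one colour per move, no vertex ever runs out of colours
(`avail_pos_of_fewestHistory`, `makerHasWinningStrategy_of_avail_pos`, `exists_threshold_maker`).

*Lower bound.* Breaker answers each move in the colour that Maker has just used, and so keeps all
but few colour classes below `(1 + ε / 8) L`, while the largest independent sets have size about
twice `L`. Once a class `S` has reached a size slightly below `L`, its common non-neighbours contain only
boundedly many disjoint independent sets of size `j₀ = ξ L`, as a first moment bound shows. The
union `R` of a maximal such family is a set of size `O(L)` that the class needs in order to grow by
much more than `j₀`. A random vertex has a proportion `p` of `R` as neighbours, so that Breaker, as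
long as the class has sufficiently many legal vertices, can give its colour to one that removes a
proportion `κ`, of order `p`, of what remains of `R`. After `O(1 / p)` such moves, which is at most
a small multiple of `L`, fewer than `j₀` vertices of `R` remain. Classes with too few legal vertices
for this are exceptional: by a Chernoff bound there are so few of them that they do not matter.
Hence fewer than `(1 - ε) n / L` colours cannot cover all vertices (`exists_breaker_move`,
`sum_card_colorClass_le`, `not_makerHasWinningStrategy`, `exists_threshold_breaker`).

The probabilities are computed in `graphMean`, the finite sum over all graphs that represents the
binomial random graph (`binomialRandom_real_eq_graphMean`).
-/

namespace ColoringGame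

/-! ### The binomial random graph as a finite sum -/

open scoped Classical in
/-- The pairs of distinct vertices, that is, the potential edges of a graph on `V`. -/
noncomputable def vertexPairs (V : Type*) [Fintype V] : Finset (Sym2 V) :=
  Finset.univ.filter fun e => ¬ e.IsDiag

open scoped Classical in
/-- The probability of the graph `G` in the binomial model, as a product over potential edges. -/
noncomputable def graphWeight {V : Type*} [Fintype V] (p : ℝ) (G : SimpleGraph V) : ℝ :=
  ∏ e ∈ vertexPairs V, if e ∈ G.edgeSet then p else 1 - p

open scoped Classical in
/-- The expectation of `f` over the binomial random graph, as a finite sum. -/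
noncomputable def graphMean {V : Type*} [Fintype V] (p : ℝ) (f : SimpleGraph V → ℝ) : ℝ :=
  ∑ G : SimpleGraph V, graphWeight p G * f G

section Mean

variable {V : Type*} [Fintype V] {p : ℝ}

theorem graphWeight_nonneg (hp0 : 0 ≤ p) (hp1 : p ≤ 1) (G : SimpleGraph V) :
    0 ≤ graphWeight p G := by
  unfold graphWeight
  refine Finset.prod_nonneg fun e _ => ?_
  split_ifs <;> linarith

theorem graphMean_mono (hp0 : 0 ≤ p) (hp1 : p ≤ 1) {f g : SimpleGraph V → ℝ}
    (h : ∀ G, f G ≤ g G) : graphMean p f ≤ graphMean p g :=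
  Finset.sum_le_sum fun G _ => mul_le_mul_of_nonneg_left (h G) (graphWeight_nonneg hp0 hp1 G)

theorem graphMean_sum {ι : Type*} (s : Finset ι) (f : ι → SimpleGraph V → ℝ) :
    graphMean p (fun G => ∑ i ∈ s, f i G) = ∑ i ∈ s, graphMean p (f i) := by
  unfold graphMean
  rw [Finset.sum_comm]
  exact Finset.sum_congr rfl fun G _ => Finset.mul_sum _ _ _

theorem graphMean_const_mul (c : ℝ) (f : SimpleGraph V → ℝ) :
    graphMean p (fun G => c * f G) = c * graphMean p f := by
  unfold graphMean
  rw [Finset.mul_sum]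
  exact Finset.sum_congr rfl fun G _ => by ring

open scoped Classical in
theorem sum_graph_prod_ite (a b : Sym2 V → ℝ) :
    ∑ G : SimpleGraph V, ∏ e ∈ vertexPairs V, (if e ∈ G.edgeSet then a e else b e)
      = ∏ e ∈ vertexPairs V, (a e + b e) := by
  rw [Finset.prod_add]
  refine Finset.sum_bij' (fun G _ => (vertexPairs V).filter fun e => e ∈ G.edgeSet)
    (fun t _ => SimpleGraph.fromEdgeSet (t : Set (Sym2 V))) ?_ ?_ ?_ ?_ ?_
  · intro G _
    exact Finset.mem_powerset.2 (Finset.filter_subset _ _)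
  · intro t _
    exact Finset.mem_univ _
  · intro G _
    apply SimpleGraph.edgeSet_injective
    ext e
    have hd : e ∈ G.edgeSet → ¬ e.IsDiag := fun h => G.not_isDiag_of_mem_edgeSet h
    simp only [SimpleGraph.edgeSet_fromEdgeSet, Set.mem_sdiff, Finset.mem_coe, Finset.mem_filter,
      vertexPairs, Finset.mem_univ, true_and, Sym2.mem_diagSet]
    tauto
  · intro t ht
    have ht' := Finset.mem_powerset.1 ht
    ext e
    have hd : e ∈ t → ¬ e.IsDiag := fun h => (Finset.mem_filter.1 (ht' h)).2
    simp only [SimpleGraph.edgeSet_fromEdgeSet, Set.mem_sdiff, Finset.mem_coe, Finset.mem_filter,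
      vertexPairs, Finset.mem_univ, true_and, Sym2.mem_diagSet]
    tauto
  · intro G _
    rw [Finset.prod_ite, ← Finset.filter_not]

open scoped Classical in
/-- Distinct potential edges are independent: the mean of a product of functions of the single
edges in `F` is the product of their means. -/
theorem graphMean_prod_ite (F : Finset (Sym2 V)) (hF : F ⊆ vertexPairs V) (g h : Sym2 V → ℝ) :
    graphMean p (fun G => ∏ e ∈ F, (if e ∈ G.edgeSet then g e else h e))
      = ∏ e ∈ F, (p * g e + (1 - p) * h e) := by
  have h1 : ∀ G : SimpleGraph V,
      graphWeight p G * ∏ e ∈ F, (if e ∈ G.edgeSet then g e else h e)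
        = ∏ e ∈ vertexPairs V, (if e ∈ G.edgeSet then (p * if e ∈ F then g e else 1)
            else ((1 - p) * if e ∈ F then h e else 1)) := by
    intro G
    have h2 : ∏ e ∈ F, (if e ∈ G.edgeSet then g e else h e)
        = ∏ e ∈ vertexPairs V,
          (if e ∈ F then (if e ∈ G.edgeSet then g e else h e) else 1) := by
      rw [← Finset.prod_filter]
      refine Finset.prod_congr ?_ fun _ _ => rfl
      ext e
      simp only [Finset.mem_filter]
      exact ⟨fun h => ⟨hF h, h⟩, fun h => h.2⟩
    rw [h2, graphWeight, ← Finset.prod_mul_distrib]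
    refine Finset.prod_congr rfl fun e _ => ?_
    split_ifs <;> simp
  unfold graphMean
  rw [Finset.sum_congr rfl fun G _ => h1 G, sum_graph_prod_ite]
  rw [← Finset.prod_subset hF]
  · exact Finset.prod_congr rfl fun e he => by simp [he]
  · intro e _ he
    simp [he]

/-- The probability that none of the pairs in `F` is an edge. -/
theorem graphMean_no_edge (F : Finset (Sym2 V)) (hF : F ⊆ vertexPairs V) :
    graphMean p (Set.indicator {G | ∀ e ∈ F, e ∉ G.edgeSet} 1) = (1 - p) ^ F.card := by
  classical
  have := graphMean_prod_ite (p := p) F hF (fun _ => 0) (fun _ => 1)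
  simp only [mul_zero, zero_add, mul_one, Finset.prod_const] at this
  rw [← this]
  congr 1
  ext G
  rw [Set.indicator_apply]
  split_ifs with h
  · exact (Finset.prod_eq_one fun e he => by simp [h e he]).symm
  · simp only [Set.mem_ofPred_eq, not_forall, not_not] at h
    obtain ⟨e, he, hG⟩ := h
    exact (Finset.prod_eq_zero he (by simp [hG])).symm

/-- The probability that all pairs in `F` are edges. -/
theorem graphMean_all_edge (F : Finset (Sym2 V)) (hF : F ⊆ vertexPairs V) :
    graphMean p (Set.indicator {G | ∀ e ∈ F, e ∈ G.edgeSet} 1) = p ^ F.card := by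
  classical
  have := graphMean_prod_ite (p := p) F hF (fun _ => 1) (fun _ => 0)
  simp only [mul_zero, add_zero, mul_one, Finset.prod_const] at this
  rw [← this]
  congr 1
  ext G
  rw [Set.indicator_apply]
  split_ifs with h
  · exact (Finset.prod_eq_one fun e he => by simp [h e he]).symm
  · simp only [Set.mem_ofPred_eq, not_forall] at h
    obtain ⟨e, he, hG⟩ := h
    exact (Finset.prod_eq_zero he (by simp [hG])).symm

/-- Union bound in Markov form: if every graph in the event `A` has one of the nonnegative `f i`
at least `1`, then the probability of `A` is at most the sum of the means of the `f i`. -/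
theorem graphMean_indicator_le_sum (hp0 : 0 ≤ p) (hp1 : p ≤ 1) {ι : Type*} (s : Finset ι)
    (f : ι → SimpleGraph V → ℝ) (A : Set (SimpleGraph V)) (hf : ∀ i ∈ s, ∀ G, 0 ≤ f i G)
    (h : ∀ G ∈ A, ∃ i ∈ s, 1 ≤ f i G) :
    graphMean p (Set.indicator A 1) ≤ ∑ i ∈ s, graphMean p (f i) := by
  classical
  rw [← graphMean_sum]
  refine graphMean_mono hp0 hp1 fun G => ?_
  rw [Set.indicator_apply]
  split_ifs with hG
  · obtain ⟨i, hi, h1⟩ := h G hG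
    exact h1.trans (Finset.single_le_sum (f := fun i => f i G) (fun j hj => hf j hj G) hi)
  · exact Finset.sum_nonneg fun i hi => hf i hi G

/-- Union bound over a finite family whose members all have mean at most `q`. -/
theorem graphMean_indicator_le_card_mul (hp0 : 0 ≤ p) (hp1 : p ≤ 1) {ι : Type*} (s : Finset ι)
    (f : ι → SimpleGraph V → ℝ) (A : Set (SimpleGraph V)) (q : ℝ)
    (hf : ∀ i ∈ s, ∀ G, 0 ≤ f i G) (h : ∀ G ∈ A, ∃ i ∈ s, 1 ≤ f i G)
    (hq : ∀ i ∈ s, graphMean p (f i) ≤ q) :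
    graphMean p (Set.indicator A 1) ≤ s.card * q := by
  refine (graphMean_indicator_le_sum hp0 hp1 s f A hf h).trans ?_
  rw [← nsmul_eq_mul]
  exact Finset.sum_le_card_nsmul _ _ _ hq

theorem graphMean_indicator_union_le (hp0 : 0 ≤ p) (hp1 : p ≤ 1) (A B : Set (SimpleGraph V)) :
    graphMean p (Set.indicator (A ∪ B) 1)
      ≤ graphMean p (Set.indicator A 1) + graphMean p (Set.indicator B 1) := by
  classical
  have := graphMean_indicator_le_sum hp0 hp1 Finset.univ
    (fun b : Bool => Set.indicator (if b then A else B) (1 : SimpleGraph V → ℝ)) (A ∪ B)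
    (fun i _ G => Set.indicator_nonneg (fun _ _ => zero_le_one) G) (fun G hG => by
      rcases hG with h | h
      · exact ⟨true, by simp, by simp [h]⟩
      · exact ⟨false, by simp, by simp [h]⟩)
  simpa using this

theorem graphMean_indicator_mono (hp0 : 0 ≤ p) (hp1 : p ≤ 1) {A B : Set (SimpleGraph V)}
    (h : A ⊆ B) : graphMean p (Set.indicator A 1) ≤ graphMean p (Set.indicator B 1) :=
  graphMean_mono hp0 hp1 fun G =>
    Set.indicator_le_indicator_of_subset h (fun _ => zero_le_one) G

end Mean

/-- The finite-sum mean computes probabilities in Mathlib's binomial random graph. -/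
theorem binomialRandom_real_eq_graphMean {V : Type*} [Fintype V] (p : unitInterval)
    (A : Set (SimpleGraph V)) :
    (SimpleGraph.binomialRandom V p).real A = graphMean (p : ℝ) (Set.indicator A 1) := by
  classical
  have hsing : MeasurableSingletonClass (SimpleGraph V) := by
    refine ⟨fun G => ?_⟩
    have h : ({G} : Set (SimpleGraph V)) = SimpleGraph.edgeSet ⁻¹' {G.edgeSet} := by
      ext H
      simp
    rw [h]
    exact SimpleGraph.measurableEmbedding_edgeSet.measurable (MeasurableSet.singleton _)
  have hw : ∀ G : SimpleGraph V,
      (SimpleGraph.binomialRandom V p).real {G} = graphWeight (p : ℝ) G := by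
    intro G
    rw [MeasureTheory.measureReal_def, SimpleGraph.binomialRandom_singleton, graphWeight,
      Finset.prod_ite, Finset.prod_const, Finset.prod_const, ENNReal.toReal_mul,
      ENNReal.toReal_pow, ENNReal.toReal_pow]
    have hcard : (vertexPairs V).card = (Nat.card V).choose 2 := by
      rw [Nat.card_eq_fintype_card, ← Sym2.card_diagSet_compl, Fintype.card_subtype]
      rfl
    have h1 : ((vertexPairs V).filter fun e => e ∈ G.edgeSet).card = G.edgeSet.ncard := by
      rw [← Set.ncard_coe_finset]
      congr 1
      ext e
      have hd : e ∈ G.edgeSet → ¬ e.IsDiag := fun h => G.not_isDiag_of_mem_edgeSet h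
      simp only [vertexPairs, Finset.coe_filter, Finset.mem_filter, Finset.mem_univ, true_and,
        Set.mem_ofPred_eq]
      tauto
    have h2 : ((vertexPairs V).filter fun e => e ∉ G.edgeSet).card
        = (Nat.card V).choose 2 - G.edgeSet.ncard := by
      rw [← hcard, ← h1, Finset.filter_not, Finset.card_sdiff_of_subset (Finset.filter_subset _ _)]
    rw [h1, h2]
    rfl
  have hA : A = ((Finset.univ.filter fun G => G ∈ A : Finset (SimpleGraph V)) :
      Set (SimpleGraph V)) := by
    ext G
    simp
  conv_lhs => rw [hA]
  rw [← MeasureTheory.sum_measureReal_singleton, Finset.sum_filter, graphMean]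
  refine Finset.sum_congr rfl fun G _ => ?_
  rw [Set.indicator_apply, hw]
  split_ifs <;> simp

/-! ### The lower tail of the number of available colours -/

section Pairs

variable {V : Type*} [DecidableEq V]

/-- The unordered pairs with one end in `S` and the other in `T`. -/
def crossPairs {V : Type*} [DecidableEq V] (S T : Finset V) : Finset (Sym2 V) :=
  (S ×ˢ T).image fun x => s(x.1, x.2)

/-- The unordered pairs of distinct elements of `S`. -/
def innerPairs {V : Type*} [DecidableEq V] (S : Finset V) : Finset (Sym2 V) :=
  S.offDiag.image (Function.uncurry Sym2.mk)

theorem mem_crossPairs {S T : Finset V} {e : Sym2 V} :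
    e ∈ crossPairs S T ↔ ∃ v ∈ S, ∃ w ∈ T, e = s(v, w) := by
  simp only [crossPairs, Finset.mem_image, Finset.mem_product, Prod.exists]
  constructor
  · rintro ⟨a, b, ⟨ha, hb⟩, rfl⟩
    exact ⟨a, ha, b, hb, rfl⟩
  · rintro ⟨a, ha, b, hb, rfl⟩
    exact ⟨a, b, ⟨ha, hb⟩, rfl⟩

theorem mem_innerPairs {S : Finset V} {e : Sym2 V} :
    e ∈ innerPairs S ↔ ∃ v ∈ S, ∃ w ∈ S, v ≠ w ∧ e = s(v, w) := by
  simp only [innerPairs, Finset.mem_image, Finset.mem_offDiag, Prod.exists, Function.uncurry]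
  constructor
  · rintro ⟨a, b, ⟨ha, hb, hab⟩, rfl⟩
    exact ⟨a, ha, b, hb, hab, rfl⟩
  · rintro ⟨a, ha, b, hb, hab, rfl⟩
    exact ⟨a, b, ⟨ha, hb, hab⟩, rfl⟩

theorem crossPairs_subset [Fintype V] {S T : Finset V} (h : Disjoint S T) :
    crossPairs S T ⊆ vertexPairs V := by
  intro e he
  obtain ⟨v, hv, w, hw, rfl⟩ := mem_crossPairs.1 he
  simp only [vertexPairs, Finset.mem_filter, Finset.mem_univ, true_and, Sym2.mk_isDiag_iff]
  rintro rfl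
  exact Finset.disjoint_left.1 h hv hw

theorem innerPairs_subset [Fintype V] (S : Finset V) : innerPairs S ⊆ vertexPairs V := by
  intro e he
  obtain ⟨v, hv, w, hw, hne, rfl⟩ := mem_innerPairs.1 he
  simpa [vertexPairs] using hne

theorem card_crossPairs {S T : Finset V} (h : Disjoint S T) :
    (crossPairs S T).card = S.card * T.card := by
  rw [crossPairs, Finset.card_image_of_injOn, Finset.card_product]
  rintro ⟨a, b⟩ hab ⟨c, d⟩ hcd heq
  simp only [Finset.coe_product, Set.mem_prod, Finset.mem_coe] at hab hcd
  simp only [Sym2.eq_iff] at heq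
  rcases heq with ⟨rfl, rfl⟩ | ⟨rfl, rfl⟩
  · rfl
  · exact absurd hcd.2 (Finset.disjoint_left.1 h hab.1)

theorem card_innerPairs (S : Finset V) : (innerPairs S).card = S.card.choose 2 :=
  Sym2.card_image_offDiag S

end Pairs

section Binomial

/-- `n.choose m ≤ (e n / m) ^ m`. -/
theorem choose_le_exp_mul_div_pow (n m : ℕ) :
    (n.choose m : ℝ) ≤ (Real.exp 1 * n / m) ^ m := by
  rcases Nat.eq_zero_or_pos m with rfl | hm
  · simp
  have hm' : (0 : ℝ) < m := by exact_mod_cast hm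
  have h1 := Nat.choose_le_pow_div (α := ℝ) m n
  have h2 := Real.pow_div_factorial_le_exp (m : ℝ) hm'.le m
  have hf : (0 : ℝ) < m.factorial := by exact_mod_cast m.factorial_pos
  have h3 : (1 : ℝ) / m.factorial ≤ Real.exp 1 ^ m / m ^ m := by
    rw [div_le_div_iff₀ hf (by positivity), ← Real.exp_nat_mul, mul_one, one_mul]
    rwa [div_le_iff₀ hf] at h2
  calc (n.choose m : ℝ) ≤ n ^ m * (1 / m.factorial) := by rw [mul_one_div]; exact h1
    _ ≤ n ^ m * (Real.exp 1 ^ m / m ^ m) := by gcongr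
    _ = (Real.exp 1 * n / m) ^ m := by rw [div_pow, mul_pow]; ring

end Binomial

section Available

variable {V : Type*} [Fintype V]

open scoped Classical in
/-- The number of colours that no neighbour of `v` has received in `c`. -/
noncomputable def avail {V : Type*} {k : ℕ} (G : SimpleGraph V) (c : PartialColoring V k)
    (v : V) : ℕ :=
  (Finset.univ.filter fun i : Fin k => ∀ w, G.Adj v w → c w ≠ some i).card

/-- The vertices of colour `i`. -/
def colorClass {V : Type*} [Fintype V] {k : ℕ} (c : PartialColoring V k) (i : Fin k) :
    Finset V :=
  Finset.univ.filter fun v => c v = some i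

theorem mem_colorClass {k : ℕ} {c : PartialColoring V k} {i : Fin k} {v : V} :
    v ∈ colorClass c i ↔ c v = some i := by
  simp [colorClass]

/-- The pairs joining `x.1` to the colour class `x.2`: the colour `x.2` is available at `x.1`
exactly if none of them is an edge. -/
def starPairs {V : Type*} [Fintype V] [DecidableEq V] {k : ℕ} (c : PartialColoring V k)
    (x : V × Fin k) : Finset (Sym2 V) :=
  crossPairs {x.1} (colorClass c x.2)

variable [DecidableEq V]

theorem card_starPairs {k : ℕ} (c : PartialColoring V k) (x : V × Fin k) (h : c x.1 = none) :
    (starPairs c x).card = (colorClass c x.2).card := by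
  rw [starPairs, card_crossPairs, Finset.card_singleton, one_mul]
  rw [Finset.disjoint_singleton_left, mem_colorClass, h]
  simp

theorem starPairs_subset {k : ℕ} (c : PartialColoring V k) (x : V × Fin k) (h : c x.1 = none) :
    starPairs c x ⊆ vertexPairs V := by
  apply crossPairs_subset
  rw [Finset.disjoint_singleton_left, mem_colorClass, h]
  simp

theorem disjoint_starPairs {k : ℕ} (c : PartialColoring V k) (x y : V × Fin k)
    (hy : c y.1 = none) (hxy : x ≠ y) :
    Disjoint (starPairs c x) (starPairs c y) := by
  rw [Finset.disjoint_left]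
  intro e he he'
  obtain ⟨v, hv, w, hw, rfl⟩ := mem_crossPairs.1 he
  obtain ⟨v', hv', w', hw', heq⟩ := mem_crossPairs.1 he'
  rw [Finset.mem_singleton] at hv hv'
  rw [mem_colorClass] at hw hw'
  subst hv hv'
  rw [Sym2.eq_iff] at heq
  rcases heq with ⟨h1, rfl⟩ | ⟨h1, rfl⟩
  · rw [hw] at hw'
    exact hxy (Prod.ext h1 (Option.some.inj hw'))
  · rw [hy] at hw
    cases hw

theorem exp_neg_avail_eq_prod {k : ℕ} (G : SimpleGraph V) (c : PartialColoring V k) (v : V) :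
    Real.exp (-(avail G c v : ℝ)) = ∏ i : Fin k,
      (-(1 - Real.exp (-1)) * Set.indicator {G | ∀ e ∈ starPairs c (v, i), e ∉ G.edgeSet} 1 G
        + 1) := by
  classical
  have h1 : ∀ i : Fin k,
      (-(1 - Real.exp (-1)) * Set.indicator {G | ∀ e ∈ starPairs c (v, i), e ∉ G.edgeSet} 1 G + 1)
        = if ∀ w, G.Adj v w → c w ≠ some i then Real.exp (-1) else 1 := by
    intro i
    have : (∀ e ∈ starPairs c (v, i), e ∉ G.edgeSet) ↔ ∀ w, G.Adj v w → c w ≠ some i := by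
      constructor
      · intro h w hw hc
        exact h s(v, w) (mem_crossPairs.2 ⟨v, by simp, w, mem_colorClass.2 hc, rfl⟩) hw
      · intro h e he hG
        obtain ⟨v', hv', w, hw, rfl⟩ := mem_crossPairs.1 he
        rw [Finset.mem_singleton] at hv'
        subst hv'
        exact h w hG (mem_colorClass.1 hw)
    rw [Set.indicator_apply]
    simp only [Set.mem_ofPred_eq, this]
    split_ifs <;> simp
  rw [Finset.prod_congr rfl fun i _ => h1 i, Finset.prod_ite, Finset.prod_const, Finset.prod_const,
    one_pow, mul_one, ← Real.exp_nat_mul, avail, mul_neg, mul_one]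
  congr!

/-- The events "colour `i` is available at `v`", for uncoloured `v`, are independent with
probabilities `(1 - p) ^ |C_i|`; this is the joint Laplace transform at `-1`. -/
theorem graphMean_exp_neg_sum_avail {p : ℝ} {k : ℕ} (c : PartialColoring V k) (U : Finset V)
    (hU : ∀ v ∈ U, c v = none) :
    graphMean p (fun G => Real.exp (-∑ v ∈ U, (avail G c v : ℝ)))
      = ∏ x ∈ U ×ˢ (Finset.univ : Finset (Fin k)),
          (-(1 - Real.exp (-1)) * (1 - p) ^ (colorClass c x.2).card + 1) := by
  classical
  set q : ℝ := -(1 - Real.exp (-1))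
  have h1 : ∀ G : SimpleGraph V, Real.exp (-∑ v ∈ U, (avail G c v : ℝ))
      = ∑ t ∈ (U ×ˢ (Finset.univ : Finset (Fin k))).powerset,
        q ^ t.card * Set.indicator {G | ∀ e ∈ t.biUnion (starPairs c), e ∉ G.edgeSet} 1 G := by
    intro G
    rw [← Finset.sum_neg_distrib, Real.exp_sum,
      Finset.prod_congr rfl fun v _ => exp_neg_avail_eq_prod G c v]
    rw [← Finset.prod_product' U Finset.univ (fun v i =>
      (q * Set.indicator {G | ∀ e ∈ starPairs c (v, i), e ∉ G.edgeSet} 1 G + 1)),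
      Finset.prod_add]
    refine Finset.sum_congr rfl fun t _ => ?_
    rw [Finset.prod_const_one, mul_one, Finset.prod_mul_distrib, Finset.prod_const]
    congr 1
    rw [Set.indicator_apply]
    split_ifs with h
    · refine Finset.prod_eq_one fun x hx => ?_
      rw [Set.indicator_of_mem]
      · rfl
      · exact fun e he => h e (Finset.mem_biUnion.2 ⟨x, hx, he⟩)
    · simp only [Set.mem_ofPred_eq, not_forall] at h
      obtain ⟨e, he, hG⟩ := h
      obtain ⟨x, hx, hxe⟩ := Finset.mem_biUnion.1 he
      refine Finset.prod_eq_zero hx ?_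
      rw [Set.indicator_of_notMem]
      exact fun hh => hG (hh e hxe)
  simp_rw [h1]
  rw [graphMean_sum, Finset.prod_add]
  refine Finset.sum_congr rfl fun t ht => ?_
  have hmem : ∀ x ∈ t, c x.1 = none := fun x hx =>
    hU _ (Finset.mem_product.1 (Finset.mem_powerset.1 ht hx)).1
  rw [graphMean_const_mul, graphMean_no_edge, Finset.prod_mul_distrib, Finset.prod_const,
    Finset.prod_const_one, mul_one, Finset.card_biUnion, Finset.prod_pow_eq_pow_sum]
  · congr 2
    exact Finset.sum_congr rfl fun x hx => card_starPairs c x (hmem x hx)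
  · exact fun x _ y hy hxy => disjoint_starPairs c x y (hmem y hy) hxy
  · exact Finset.biUnion_subset.2 fun x hx => starPairs_subset c x (hmem x hx)

/-- Lower tail of the total number of available colours at a set of uncoloured vertices. -/
theorem graphMean_sum_avail_le {p : ℝ} (hp0 : 0 ≤ p) (hp1 : p ≤ 1) {k : ℕ}
    (c : PartialColoring V k) (U : Finset V) (hU : ∀ v ∈ U, c v = none) (M : ℝ)
    (hM : M ≤ U.card * ∑ i : Fin k, (1 - p) ^ (colorClass c i).card) :
    graphMean p (fun G => Real.exp (M / 2 - ∑ v ∈ U, (avail G c v : ℝ))) ≤ Real.exp (-M / 8) := by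
  have h1 : ∀ G : SimpleGraph V, Real.exp (M / 2 - ∑ v ∈ U, (avail G c v : ℝ))
      = Real.exp (M / 2) * Real.exp (-∑ v ∈ U, (avail G c v : ℝ)) := by
    intro G
    rw [← Real.exp_add, sub_eq_add_neg]
  simp_rw [h1]
  rw [graphMean_const_mul, graphMean_exp_neg_sum_avail c U hU]
  have he : (5 : ℝ) / 8 ≤ 1 - Real.exp (-1) := by
    have := Real.exp_one_gt_d9
    rw [Real.exp_neg]
    have : (Real.exp 1)⁻¹ ≤ (2.7182818283 : ℝ)⁻¹ := by
      apply inv_anti₀ (by norm_num) this.le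
    norm_num at this ⊢
    linarith
  have h2 : ∏ x ∈ U ×ˢ (Finset.univ : Finset (Fin k)),
      (-(1 - Real.exp (-1)) * (1 - p) ^ (colorClass c x.2).card + 1)
      ≤ ∏ x ∈ U ×ˢ (Finset.univ : Finset (Fin k)),
        Real.exp (-(5 / 8) * (1 - p) ^ (colorClass c x.2).card) := by
    refine Finset.prod_le_prod (fun x _ => ?_) (fun x _ => ?_)
    · have h3 : (1 - p) ^ (colorClass c x.2).card ≤ 1 := pow_le_one₀ (by linarith) (by linarith)
      have h4 : 0 ≤ (1 - p) ^ (colorClass c x.2).card := pow_nonneg (by linarith) _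
      have h5 := Real.exp_pos (-1)
      nlinarith
    · have h4 : 0 ≤ (1 - p) ^ (colorClass c x.2).card := pow_nonneg (by linarith) _
      have := Real.add_one_le_exp (-(5 / 8) * (1 - p) ^ (colorClass c x.2).card)
      nlinarith
  refine (mul_le_mul_of_nonneg_left h2 (Real.exp_pos _).le).trans ?_
  rw [← Real.exp_sum, ← Real.exp_add, Finset.sum_product]
  simp_rw [← Finset.mul_sum]
  rw [Finset.sum_const, nsmul_eq_mul]
  apply Real.exp_le_exp.2
  nlinarith

end Available

/-! ### Maker's strategy: colour a vertex with the fewest available colours -/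

section Maker

variable {V : Type*} {k : ℕ} {G : SimpleGraph V}

/-- The colouring `c` extends the colouring `c₀`. -/
def Extends {V : Type*} {k : ℕ} (c₀ c : PartialColoring V k) : Prop :=
  ∀ v, c₀ v ≠ none → c v = c₀ v

theorem Extends.refl (c : PartialColoring V k) : Extends c c := fun _ _ => rfl

theorem Extends.trans {c₀ c₁ c₂ : PartialColoring V k} (h : Extends c₀ c₁) (h' : Extends c₁ c₂) :
    Extends c₀ c₂ := by
  intro v hv
  have h1 := h v hv
  rw [h' v (h1 ▸ hv), h1]

theorem extends_update [DecidableEq V] (c : PartialColoring V k) {v : V} (hv : c v = none)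
    (i : Fin k) : Extends c (Function.update c v (some i)) := by
  intro w hw
  rw [Function.update_of_ne]
  rintro rfl
  exact hw hv

theorem avail_anti {c₀ c : PartialColoring V k} (h : Extends c₀ c) (v : V) :
    avail G c v ≤ avail G c₀ v := by
  classical
  refine Finset.card_le_card fun i hi => ?_
  simp only [Finset.mem_filter, Finset.mem_univ, true_and] at hi ⊢
  intro w hw hc
  exact hi w hw (by rw [h w (by rw [hc]; simp), hc])

theorem exists_legal_of_avail_pos {c : PartialColoring V k} {v : V} (hv : c v = none)
    (h : 1 ≤ avail G c v) : ∃ i, Legal G c v i := by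
  classical
  obtain ⟨i, hi⟩ := Finset.card_pos.1 h
  exact ⟨i, hv, by simpa using hi⟩

open scoped Classical in
/-- The number of neighbours of `v` in `S`. -/
noncomputable def degIn {V : Type*} (G : SimpleGraph V) (S : Finset V) (v : V) : ℕ :=
  (S.filter fun w => G.Adj v w).card

theorem degIn_mono {S T : Finset V} (h : S ⊆ T) (v : V) : degIn G S v ≤ degIn G T v := by
  classical
  refine Finset.card_le_card fun w hw => ?_
  rw [Finset.mem_filter] at hw ⊢
  exact ⟨h hw.1, hw.2⟩

theorem degIn_le_card (S : Finset V) (v : V) : degIn G S v ≤ S.card := by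
  classical
  exact Finset.card_le_card fun _ hw => (Finset.mem_filter.1 hw).1

open scoped Classical in
/-- The vertices coloured in `c` but not in `c₀`. -/
noncomputable def newlyColored {V : Type*} [Fintype V] {k : ℕ} (c₀ c : PartialColoring V k) :
    Finset V :=
  Finset.univ.filter fun v => c v ≠ none ∧ c₀ v = none

variable [Fintype V]

theorem mem_newlyColored {c₀ c : PartialColoring V k} {v : V} :
    v ∈ newlyColored c₀ c ↔ c v ≠ none ∧ c₀ v = none := by
  classical
  simp [newlyColored]

/-- A vertex loses at most one colour for each of its neighbours that gets coloured. -/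
theorem avail_le_add_degIn {c₀ c : PartialColoring V k} (h : Extends c₀ c) (v : V) :
    avail G c₀ v ≤ avail G c v + degIn G (newlyColored c₀ c) v := by
  classical
  have h1 : (Finset.univ.filter fun i : Fin k => ∀ w, G.Adj v w → c₀ w ≠ some i).image some
      ⊆ (Finset.univ.filter fun i : Fin k => ∀ w, G.Adj v w → c w ≠ some i).image some
        ∪ ((newlyColored c₀ c).filter fun w => G.Adj v w).image c := by
    intro o ho
    obtain ⟨i, hi, rfl⟩ := Finset.mem_image.1 ho
    simp only [Finset.mem_filter, Finset.mem_univ, true_and] at hi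
    by_cases hc : ∀ w, G.Adj v w → c w ≠ some i
    · exact Finset.mem_union_left _ (Finset.mem_image.2 ⟨i, by simpa using hc, rfl⟩)
    · push Not at hc
      obtain ⟨w, hw, hcw⟩ := hc
      refine Finset.mem_union_right _ (Finset.mem_image.2 ⟨w, ?_, hcw⟩)
      rw [Finset.mem_filter, mem_newlyColored]
      refine ⟨⟨by rw [hcw]; simp, ?_⟩, hw⟩
      by_contra hne
      exact hi w hw (by rw [← h w hne, hcw])
  have h2 := Finset.card_le_card h1
  rw [Finset.card_image_of_injective _ (Option.some_injective _)] at h2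
  have h3 := h2.trans (Finset.card_union_le _ _)
  rw [Finset.card_image_of_injective _ (Option.some_injective _)] at h3
  have h4 := h3.trans (Nat.add_le_add_left Finset.card_image_le _)
  have e : ∀ c : PartialColoring V k, avail G c v
      = (Finset.univ.filter fun i : Fin k => ∀ w, G.Adj v w → c w ≠ some i).card := by
    intro c
    unfold avail
    congr!
  rw [e, e]
  exact h4

open scoped Classical in
/-- The vertices with at least `d` neighbours in `S`, among those of `S`. -/
noncomputable def highDeg {V : Type*} (G : SimpleGraph V) (d : ℕ) (S : Finset V) : Finset V :=
  S.filter fun v => d ≤ degIn G S v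

/-- The record of a play in which Maker always colours a vertex with the fewest available colours.
For each threshold `θ`, `past θ` is the position at Maker's last turn at which all uncoloured
vertices had at least `θ` available colours, and `moves θ` is the set of vertices coloured by
Maker after that turn; each of them had fewer than `θ` available colours when it was coloured.
The offset `b` accounts for whose turn it is. -/
def FewestHistory (G : SimpleGraph V) (b : ℕ) (c : PartialColoring V k) : Prop :=
  ∃ (past : ℕ → PartialColoring V k) (moves : ℕ → Finset V), ∀ θ ≤ k,
    Extends (past θ) c ∧
    (∀ θ' ≤ θ, Extends (past θ) (past θ')) ∧
    (∀ v, past θ v = none → θ ≤ avail G (past θ) v) ∧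
    (∀ u ∈ moves θ, past θ u = none ∧ c u ≠ none ∧ avail G c u < θ) ∧
    (newlyColored (past θ) c).card ≤ 2 * (moves θ).card + b

/-- If `c₀` left `θ` colours at a vertex coloured since and `c` leaves fewer than `θ'`, then the
vertex has at least `θ - θ'` neighbours among the newly coloured vertices. -/
theorem moves_subset_highDeg {c : PartialColoring V k} {past : ℕ → PartialColoring V k}
    {M : Finset V} {θ θ' d : ℕ} (hθ : θ' + d ≤ θ) (h1 : Extends (past θ) c)
    (h2 : Extends (past θ) (past θ')) (h3 : ∀ v, past θ v = none → θ ≤ avail G (past θ) v)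
    (h4 : ∀ u ∈ M, past θ' u = none ∧ c u ≠ none ∧ avail G c u < θ') :
    M ⊆ highDeg G d (newlyColored (past θ) c) := by
  classical
  intro u hu
  obtain ⟨hp, hc, ha⟩ := h4 u hu
  have hn : past θ u = none := by
    by_contra hne
    have := h2 u hne
    rw [hp] at this
    exact hne this.symm
  rw [highDeg, Finset.mem_filter, mem_newlyColored]
  have := h3 u hn
  have := avail_le_add_degIn (G := G) h1 u
  exact ⟨⟨hc, hn⟩, by omega⟩

/-- Iterating "few vertices of high degree": when the threshold drops by `d`, the number of
vertices coloured since shrinks by the factor `3 / 4`, until it is at most `4`. -/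
theorem newlyColored_card_le_of_stages {c : PartialColoring V k}
    {past : ℕ → PartialColoring V k} {moves : ℕ → Finset V}
    (hist : ∀ θ ≤ k, Extends (past θ) c ∧
      (∀ θ' ≤ θ, Extends (past θ) (past θ')) ∧
      (∀ v, past θ v = none → θ ≤ avail G (past θ) v) ∧
      (∀ u ∈ moves θ, past θ u = none ∧ c u ≠ none ∧ avail G c u < θ) ∧
      (newlyColored (past θ) c).card ≤ 2 * (moves θ).card + 2)
    {σ d : ℕ} (hσ : ∀ S : Finset V, S.card ≤ σ → 8 * (highDeg G d S).card ≤ S.card) (h4σ : 4 ≤ σ)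
    (N : ℕ) {θ : ℕ} (hθk : θ ≤ k) (hN : N * d ≤ θ) (hs : (newlyColored (past θ) c).card ≤ σ) :
    ((newlyColored (past (θ - N * d)) c).card : ℝ) ≤
      max 4 ((3 / 4) ^ N * ((newlyColored (past θ) c).card : ℝ)) := by
  induction N with
  | zero => simp
  | succ N ih =>
    have hN' : N * d ≤ θ := le_trans (Nat.mul_le_mul_right d (Nat.le_succ N)) hN
    have ih := ih hN'
    set θ₁ := θ - N * d with hθ₁
    set θ₂ := θ - (N + 1) * d with hθ₂
    have hstep : θ₂ + d ≤ θ₁ := by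
      have : (N + 1) * d = N * d + d := by ring
      omega
    obtain ⟨e1, e2, e3, -, -⟩ := hist θ₁ (by omega)
    obtain ⟨-, -, -, f4, f5⟩ := hist θ₂ (by omega)
    have hsub := moves_subset_highDeg (G := G) hstep e1 (e2 θ₂ (by omega)) e3 f4
    have hle : (newlyColored (past θ₁) c).card ≤ σ := by
      have hσ4 : (4 : ℝ) ≤ σ := by exact_mod_cast h4σ
      have h34 : ((3 : ℝ) / 4) ^ N ≤ 1 := pow_le_one₀ (by norm_num) (by norm_num)
      have hs' : ((newlyColored (past θ) c).card : ℝ) ≤ σ := by exact_mod_cast hs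
      have : ((newlyColored (past θ₁) c).card : ℝ) ≤ σ := by
        refine ih.trans (max_le hσ4 ?_)
        nlinarith [Nat.cast_nonneg (α := ℝ) (newlyColored (past θ) c).card]
      exact_mod_cast this
    have h8 := hσ _ hle
    have hcard := Finset.card_le_card hsub
    have hkey : 4 * (newlyColored (past θ₂) c).card ≤ (newlyColored (past θ₁) c).card + 8 := by
      omega
    have hkey' : 4 * ((newlyColored (past θ₂) c).card : ℝ)
        ≤ (newlyColored (past θ₁) c).card + 8 := by exact_mod_cast hkey
    rcases le_total ((newlyColored (past θ₁) c).card : ℝ) 4 with h4 | h4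
    · exact le_max_of_le_left (by linarith)
    · rcases le_max_iff.1 ih with h | h
      · exact le_max_of_le_left (by linarith)
      · refine le_max_of_le_right ?_
        rw [pow_succ]
        linarith

/-- Conditions under which Maker's strategy never leaves a vertex without available colours. By
`hlow`, Maker has coloured fewer than `2 m` vertices since the threshold `θ₀ - d₁` was last met.
Then `N₁` drops by `d₁` reduce the number of newly coloured vertices from `σ₀` to `σ₁`, and `N₂`
drops by `d₂` reduce it to `4`; the threshold reached then is at least `5`. -/
theorem avail_pos_of_fewestHistory {m σ₀ σ₁ θ₀ d₁ d₂ N₁ N₂ : ℕ}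
    (hlow : ∀ (c : PartialColoring V k) (B : Finset V), B.card = m → (∀ v ∈ B, c v = none) →
      ∃ v ∈ B, θ₀ ≤ avail G c v)
    (h₀ : ∀ S : Finset V, S.card ≤ σ₀ → 8 * (highDeg G d₁ S).card ≤ S.card)
    (h₁ : ∀ S : Finset V, S.card ≤ σ₁ → 8 * (highDeg G d₂ S).card ≤ S.card)
    (hmσ : 4 * m + 4 ≤ σ₀) (hσ₁ : 4 ≤ σ₁)
    (hN₁ : ((3 : ℝ) / 4) ^ N₁ * σ₀ ≤ σ₁) (hN₂ : ((3 : ℝ) / 4) ^ N₂ * σ₁ ≤ 4)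
    (hbudget : d₁ * (N₁ + 1) + d₂ * N₂ + 5 ≤ θ₀) (hk : θ₀ ≤ k)
    {c : PartialColoring V k} {b : ℕ} (hb : b ≤ 2) (hc : FewestHistory G b c) (v : V)
    (hv : c v = none) : 1 ≤ avail G c v := by
  classical
  obtain ⟨past, moves, hist⟩ := hc
  have hist' : ∀ θ ≤ k, Extends (past θ) c ∧
      (∀ θ' ≤ θ, Extends (past θ) (past θ')) ∧
      (∀ v, past θ v = none → θ ≤ avail G (past θ) v) ∧
      (∀ u ∈ moves θ, past θ u = none ∧ c u ≠ none ∧ avail G c u < θ) ∧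
      (newlyColored (past θ) c).card ≤ 2 * (moves θ).card + 2 := by
    intro θ hθ
    obtain ⟨a1, a2, a3, a4, a5⟩ := hist θ hθ
    exact ⟨a1, a2, a3, a4, by omega⟩
  have hb1 : d₁ * (N₁ + 1) = d₁ + N₁ * d₁ := by ring
  have hb2 : d₂ * N₂ = N₂ * d₂ := by ring
  -- Few vertices ever have fewer than `θ₀ - d₁` available colours.
  have hmoves : (moves (θ₀ - d₁)).card < 2 * m := by
    by_contra hcon
    push Not at hcon
    obtain ⟨B, hBM, hB⟩ := Finset.exists_subset_card_eq hcon
    have hBσ := h₀ B (by omega)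
    have hsd : m ≤ (B \ highDeg G d₁ B).card := by
      have := Finset.le_card_sdiff (highDeg G d₁ B) B
      omega
    obtain ⟨B', hB'B, hB'⟩ := Finset.exists_subset_card_eq hsd
    set c' : PartialColoring V k := fun w => if w ∈ B then none else c w with hc'
    have hext : Extends c' c := by
      intro w hw
      by_cases hwB : w ∈ B
      · simp [hc', hwB] at hw
      · simp [hc', hwB]
    obtain ⟨u, hu, hua⟩ := hlow c' B' hB' (fun w hw => by
      have : w ∈ B := (Finset.mem_sdiff.1 (hB'B hw)).1
      simp [hc', this])
    obtain ⟨huB, huH⟩ := Finset.mem_sdiff.1 (hB'B hu)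
    obtain ⟨-, -, -, h4, -⟩ := hist' (θ₀ - d₁) (by omega)
    have h5 := (h4 u (hBM huB)).2.2
    have h6 := avail_le_add_degIn (G := G) hext u
    have h7 : newlyColored c' c ⊆ B := by
      intro w hw
      by_contra hwB
      obtain ⟨hw1, hw2⟩ := mem_newlyColored.1 hw
      simp [hc', hwB] at hw2
      exact hw1 hw2
    have h8 := degIn_mono (G := G) h7 u
    have h9 : degIn G B u < d₁ := by
      by_contra hge
      exact huH (Finset.mem_filter.2 ⟨huB, by omega⟩)
    omega
  have hs0 : (newlyColored (past (θ₀ - d₁)) c).card ≤ σ₀ := by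
    have := (hist' (θ₀ - d₁) (by omega)).2.2.2.2
    omega
  have hstage1 := newlyColored_card_le_of_stages hist' h₀ (by omega) N₁
    (θ := θ₀ - d₁) (by omega) (by omega) hs0
  set θ₁ := θ₀ - d₁ - N₁ * d₁ with hθ₁
  have hs1 : (newlyColored (past θ₁) c).card ≤ σ₁ := by
    have : ((newlyColored (past θ₁) c).card : ℝ) ≤ σ₁ := by
      refine hstage1.trans (max_le (by exact_mod_cast hσ₁) (le_trans ?_ hN₁))
      gcongr
    exact_mod_cast this
  have hstage2 := newlyColored_card_le_of_stages hist' h₁ hσ₁ N₂ (θ := θ₁)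
    (by omega) (by omega) hs1
  set θ₂ := θ₁ - N₂ * d₂ with hθ₂
  have hs2 : (newlyColored (past θ₂) c).card ≤ 4 := by
    have : ((newlyColored (past θ₂) c).card : ℝ) ≤ 4 := by
      refine hstage2.trans (max_le le_rfl (le_trans ?_ hN₂))
      gcongr
    exact_mod_cast this
  obtain ⟨e1, -, e3, -, -⟩ := hist' θ₂ (by omega)
  have hvp : past θ₂ v = none := by
    by_contra hne
    exact hne ((e1 v hne).symm.trans hv)
  have := e3 v hvp
  have := avail_le_add_degIn (G := G) e1 v
  have := degIn_le_card (G := G) (newlyColored (past θ₂) c) v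
  omega

theorem newlyColored_update_subset [DecidableEq V] (c₀ c : PartialColoring V k) (v : V)
    (i : Fin k) :
    newlyColored c₀ (Function.update c v (some i)) ⊆ insert v (newlyColored c₀ c) := by
  intro w hw
  rw [mem_newlyColored] at hw
  by_cases hwv : w = v
  · simp [hwv]
  · rw [Function.update_of_ne hwv] at hw
    exact Finset.mem_insert_of_mem (mem_newlyColored.2 hw)

theorem fewestHistory_breaker_move [DecidableEq V] {c : PartialColoring V k} {v : V} {i : Fin k}
    (hl : Legal G c v i) (h : FewestHistory G 1 c) :
    FewestHistory G 2 (Function.update c v (some i)) := by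
  obtain ⟨past, moves, hist⟩ := h
  have hext := extends_update c hl.1 i
  refine ⟨past, moves, fun θ hθ => ?_⟩
  obtain ⟨a1, a2, a3, a4, a5⟩ := hist θ hθ
  refine ⟨a1.trans hext, a2, a3, fun u hu => ?_, ?_⟩
  · obtain ⟨b1, b2, b3⟩ := a4 u hu
    exact ⟨b1, by rw [hext u b2]; exact b2, (avail_anti hext u).trans_lt b3⟩
  · have := Finset.card_le_card (newlyColored_update_subset (past θ) c v i)
    have := Finset.card_insert_le v (newlyColored (past θ) c)
    omega

theorem fewestHistory_maker_move [DecidableEq V] {c : PartialColoring V k} {v : V} {i : Fin k}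
    (hl : Legal G c v i) (hmin : ∀ w, c w = none → avail G c v ≤ avail G c w)
    (h : FewestHistory G 2 c) : FewestHistory G 1 (Function.update c v (some i)) := by
  obtain ⟨past, moves, hist⟩ := h
  have hext := extends_update c hl.1 i
  -- Thresholds that the chosen vertex meets are met by all vertices: they start afresh.
  refine ⟨fun θ => if θ ≤ avail G c v then c else past θ,
    fun θ => if θ ≤ avail G c v then ∅ else insert v (moves θ), fun θ hθ => ?_⟩
  obtain ⟨a1, a2, a3, a4, a5⟩ := hist θ hθ
  have hcard : ∀ c₀ : PartialColoring V k, (newlyColored c₀ (Function.update c v (some i))).card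
      ≤ (newlyColored c₀ c).card + 1 := fun c₀ =>
    (Finset.card_le_card (newlyColored_update_subset c₀ c v i)).trans (Finset.card_insert_le _ _)
  by_cases hθv : θ ≤ avail G c v
  · simp only [hθv, if_true]
    refine ⟨hext, fun θ' hθ' => ?_, fun w hw => hθv.trans (hmin w hw), by simp, ?_⟩
    · rw [if_pos (hθ'.trans hθv)]
      exact Extends.refl c
    · have h0 : newlyColored c c = ∅ := by
        ext w
        simp [mem_newlyColored]
      have := hcard c
      rw [h0] at this
      simpa using this
  · simp only [hθv, if_false]
    have hpv : past θ v = none := by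
      by_contra hne
      exact hne ((a1 v hne).symm.trans hl.1)
    have hvm : v ∉ moves θ := fun hv => (a4 v hv).2.1 hl.1
    refine ⟨a1.trans hext, fun θ' hθ' => ?_, a3, fun u hu => ?_, ?_⟩
    · split_ifs
      · exact a1
      · exact a2 θ' hθ'
    · rcases Finset.mem_insert.1 hu with rfl | hu
      · exact ⟨hpv, by simp, (avail_anti hext u).trans_lt (not_le.1 hθv)⟩
      · obtain ⟨b1, b2, b3⟩ := a4 u hu
        exact ⟨b1, by rw [hext u b2]; exact b2, (avail_anti hext u).trans_lt b3⟩
    · rw [Finset.card_insert_of_notMem hvm]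
      have := hcard (past θ)
      omega

/-- If the strategy "colour a vertex with the fewest available colours" never leaves a vertex
without available colours, it wins for Maker. -/
theorem makerHasWinningStrategy_of_avail_pos [DecidableEq V]
    (hpos : ∀ (c : PartialColoring V k) (b : ℕ), b ≤ 2 → FewestHistory G b c → ∀ v, c v = none →
      1 ≤ avail G c v) : MakerHasWinningStrategy G k := by
  classical
  have key : ∀ (n : ℕ) (c : PartialColoring V k),
      (Finset.univ.filter fun v => c v = none).card = n →
      (FewestHistory G 2 c → MakerWins G Player.maker c) ∧
      (FewestHistory G 1 c → MakerWins G Player.breaker c) := by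
    intro n
    induction n using Nat.strong_induction_on with
    | _ n ih =>
      intro c hc
      have step : ∀ v i, Legal G c v i →
          (Finset.univ.filter fun w => Function.update c v (some i) w = none).card < n := by
        intro v i h
        rw [← hc]
        refine Finset.card_lt_card ⟨fun w hw => ?_, fun hsub => ?_⟩
        · simp only [Finset.mem_filter, Finset.mem_univ, true_and] at hw ⊢
          by_cases hwv : w = v
          · simp [hwv] at hw
          · rwa [Function.update_of_ne hwv] at hw
        · have := hsub (Finset.mem_filter.2 ⟨Finset.mem_univ v, h.1⟩)
          simp at this
      by_cases hfull : ∀ v, c v ≠ none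
      · exact ⟨fun _ => MakerWins.complete _ _ hfull, fun _ => MakerWins.complete _ _ hfull⟩
      push Not at hfull
      obtain ⟨v₀, hv₀⟩ := hfull
      constructor
      · intro hist
        obtain ⟨v, hv, hmin⟩ := Finset.exists_min_image
          (Finset.univ.filter fun v => c v = none) (avail G c) ⟨v₀, by simpa using hv₀⟩
        simp only [Finset.mem_filter, Finset.mem_univ, true_and] at hv hmin
        obtain ⟨i, hi⟩ := exists_legal_of_avail_pos hv (hpos c 2 le_rfl hist v hv)
        exact MakerWins.maker c v i hi
          ((ih _ (step v i hi) _ rfl).2 (fewestHistory_maker_move hi hmin hist))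
      · intro hist
        obtain ⟨i, hi⟩ := exists_legal_of_avail_pos hv₀ (hpos c 1 (by norm_num) hist v₀ hv₀)
        exact MakerWins.breaker c ⟨v₀, i, hi⟩ fun w j hj =>
          (ih _ (step w j hj) _ rfl).1 (fewestHistory_breaker_move hj hist)
  refine (key _ _ rfl).1 ⟨fun _ _ => none, fun _ => ∅, fun θ hθ => ⟨Extends.refl _,
    fun _ _ => Extends.refl _, fun v _ => ?_, by simp, ?_⟩⟩
  · simpa [avail] using hθ
  · simp [newlyColored]

end Maker

/-! ### Breaker's strategy: spoil every colour class at about half the independence number -/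

section Breaker

variable {V : Type*} [Fintype V] {k : ℕ} {G : SimpleGraph V}

open scoped Classical in
/-- The vertices that may be given the colour `i`. -/
noncomputable def legalSet {V : Type*} [Fintype V] {k : ℕ} (G : SimpleGraph V)
    (c : PartialColoring V k) (i : Fin k) : Finset V :=
  Finset.univ.filter fun v => Legal G c v i

theorem mem_legalSet {c : PartialColoring V k} {i : Fin k} {v : V} :
    v ∈ legalSet G c i ↔ Legal G c v i := by
  simp [legalSet]

open scoped Classical in
/-- The uncoloured vertices without neighbours in `S`. -/
noncomputable def freeNonNeighbors {V : Type*} [Fintype V] {k : ℕ} (G : SimpleGraph V)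
    (c : PartialColoring V k) (S : Finset V) : Finset V :=
  Finset.univ.filter fun u => c u = none ∧ ∀ w ∈ S, ¬ G.Adj u w

/-- The parameters of Breaker's strategy: `s₀` is the size at which a colour class becomes
critical, `s₁` a size it cannot exceed while Breaker spoils it, `j₀` the size of independent sets
that may be neglected, `r` the number of disjoint independent `j₀`-sets among the common
non-neighbours of a critical class, `t` the number of exceptional vertices, `h` the number of moves
Breaker needs in a class, and `κ` the proportion of the dangerous set that each of these moves
removes. -/
structure BreakerParams where
  s₀ : ℕ
  s₁ : ℕ
  j₀ : ℕ
  r : ℕ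
  t : ℕ
  h : ℕ
  κ : ℝ

/-- The final size of a spoiled colour class. -/
def BreakerParams.finalSize (P : BreakerParams) : ℕ := P.s₀ + 2 * P.h + 2 * P.j₀ + 5

/-- The possible states of colour class `i`, with `b = 0` when Breaker has answered the last move
in this class, and `b = 1` when he has not. Either the class is still small; or Breaker is
spoiling it, by reducing a dangerous set `R` that meets all large independent sets of legal
vertices; or the class cannot grow beyond `P.finalSize`; or a subset `S` of the class of moderate
size has exceptionally few uncoloured common non-neighbours. -/
def ClassState (G : SimpleGraph V) (P : BreakerParams) (b : ℕ) (c : PartialColoring V k)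
    (i : Fin k) : Prop :=
  (colorClass c i).card < P.s₀ + b ∨
  (∃ (S R : Finset V) (j : ℕ), S ⊆ colorClass c i ∧ S.card = P.s₀ ∧ R.card ≤ P.r * P.j₀ ∧
    (∀ I : Finset V, (∀ v ∈ I, v ∈ legalSet G c i ∧ v ∉ R) → G.IsIndepSet I → I.card < P.j₀) ∧
    (∀ Q : Finset V, (∀ v ∈ Q, v ∈ legalSet G c i ∧ v ∈ R) →
      (Q.card : ℝ) ≤ (1 - P.κ) ^ j * (P.r * P.j₀)) ∧
    (colorClass c i).card ≤ P.s₀ + 2 * j + 2 + b ∧ j ≤ P.h + 1) ∨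
  (∀ I : Finset V, I ⊆ legalSet G c i → G.IsIndepSet I →
    (colorClass c i).card + I.card ≤ P.finalSize) ∨
  (∃ S : Finset V, S ⊆ colorClass c i ∧ S.card ≤ P.s₁ ∧
    (freeNonNeighbors G c S).card ≤ P.t + P.r * P.j₀)

/-- The pseudorandomness of the graph that Breaker's strategy in a single class needs. By `h_spec`
the dangerous set is gone after `P.h` reductions; by `few_indep` a set of size `P.s₀` never has
`P.r` pairwise disjoint independent `P.j₀`-sets among its common non-neighbours; by `spoil`, among
any `P.t` common non-neighbours of such a set some vertex is adjacent to a proportion `P.κ` of the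
dangerous set `R`. -/
structure BreakerConditions (G : SimpleGraph V) (P : BreakerParams) : Prop where
  j₀_pos : 0 < P.j₀
  size : P.s₀ + 2 * P.h + 6 ≤ P.s₁
  κ_le : P.κ ≤ 1
  h_spec : ∀ j : ℕ, 1 ≤ (1 - P.κ) ^ j * P.r → j ≤ P.h
  few_indep : ∀ S : Finset V, S.card = P.s₀ → ∀ 𝒥 : Finset (Finset V), 𝒥.card = P.r →
    (∀ J ∈ 𝒥, J.card = P.j₀ ∧ Disjoint S J ∧ G.IsIndepSet J ∧ ∀ v ∈ J, ∀ w ∈ S, ¬ G.Adj v w) →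
    ∃ J ∈ 𝒥, ∃ J' ∈ 𝒥, J ≠ J' ∧ ¬ Disjoint J J'
  spoil : ∀ S R T : Finset V, S.card = P.s₀ → P.j₀ ≤ R.card → R.card ≤ P.r * P.j₀ →
    T.card = P.t → Disjoint S R → Disjoint T S → Disjoint T R →
    (∀ v ∈ T, ∀ w ∈ S, ¬ G.Adj v w) → ∃ v ∈ T, P.κ * R.card ≤ degIn G R v

variable {P : BreakerParams}

theorem ClassState.mono {b b' : ℕ} (hb : b ≤ b') {c : PartialColoring V k} {i : Fin k}
    (h : ClassState G P b c i) : ClassState G P b' c i := by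
  rcases h with h | ⟨S, R, j, h1, h2, h3, h4, h5, h6, h7⟩ | h | h
  · exact Or.inl (by omega)
  · exact Or.inr (Or.inl ⟨S, R, j, h1, h2, h3, h4, h5, by omega, h7⟩)
  · exact Or.inr (Or.inr (Or.inl h))
  · exact Or.inr (Or.inr (Or.inr h))

/-- Maximality: all independent `j₀`-sets of legal vertices meet a set of size at most `r j₀`. -/
theorem exists_dangerous_set (hG : BreakerConditions G P) {c : PartialColoring V k} {i : Fin k}
    {S : Finset V} (hS : S ⊆ colorClass c i) (hcard : S.card = P.s₀) :
    ∃ R : Finset V, R.card ≤ P.r * P.j₀ ∧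
      ∀ I : Finset V, (∀ v ∈ I, v ∈ legalSet G c i ∧ v ∉ R) → G.IsIndepSet I →
        I.card < P.j₀ := by
  classical
  let good : Finset (Finset V) → Prop := fun 𝒥 =>
    (∀ J ∈ 𝒥, J.card = P.j₀ ∧ J ⊆ legalSet G c i ∧ G.IsIndepSet J) ∧
      ∀ J ∈ 𝒥, ∀ J' ∈ 𝒥, J ≠ J' → Disjoint J J'
  obtain ⟨𝒥, h𝒥, hmax⟩ := Finset.exists_max_image (Finset.univ.filter good) Finset.card
    ⟨∅, by simp [good]⟩
  simp only [Finset.mem_filter, Finset.mem_univ, true_and] at h𝒥 hmax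
  obtain ⟨hJ, hdisj⟩ := h𝒥
  have hlt : 𝒥.card ≤ P.r := by
    by_contra hcon
    obtain ⟨𝒥', hsub, h𝒥'⟩ := Finset.exists_subset_card_eq (not_le.1 hcon).le
    obtain ⟨J, hJ1, J', hJ2, hne, hnd⟩ := hG.few_indep S hcard 𝒥' h𝒥' (fun J hJ' => by
      obtain ⟨h1, h2, h3⟩ := hJ J (hsub hJ')
      refine ⟨h1, ?_, h3, fun v hv w hw hadj => ?_⟩
      · rw [Finset.disjoint_left]
        intro v hvS hvJ
        have h4 := (mem_legalSet.1 (h2 hvJ)).1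
        have h5 := mem_colorClass.1 (hS hvS)
        rw [h4] at h5
        cases h5
      · exact (mem_legalSet.1 (h2 hv)).2 w hadj (mem_colorClass.1 (hS hw)))
    exact hnd (hdisj J (hsub hJ1) J' (hsub hJ2) hne)
  refine ⟨𝒥.biUnion id, ?_, fun I hI hind => ?_⟩
  · refine Finset.card_biUnion_le.trans ((Finset.sum_le_card_nsmul _ _ P.j₀ fun J h => ?_).trans ?_)
    · exact (hJ J h).1.le
    · rw [smul_eq_mul]
      exact Nat.mul_le_mul_right _ hlt
  · by_contra hge
    obtain ⟨J, hJI, hJc⟩ := Finset.exists_subset_card_eq (not_lt.1 hge)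
    have hdJ : ∀ J' ∈ 𝒥, Disjoint J J' := by
      intro J' hJ'
      rw [Finset.disjoint_left]
      intro v hv hv'
      exact (hI v (hJI hv)).2 (Finset.mem_biUnion.2 ⟨J', hJ', hv'⟩)
    have hnot : J ∉ 𝒥 := by
      intro hmem
      have := hdJ J hmem
      rw [disjoint_self, Finset.bot_eq_empty] at this
      rw [this, Finset.card_empty] at hJc
      exact absurd hJc hG.j₀_pos.ne
    have hgood : good (insert J 𝒥) := by
      constructor
      · intro J' hJ'
        rcases Finset.mem_insert.1 hJ' with rfl | h
        · exact ⟨hJc, fun v hv => (hI v (hJI hv)).1, hind.mono (by exact_mod_cast hJI)⟩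
        · exact hJ J' h
      · intro J₁ h₁ J₂ h₂ hne
        rcases Finset.mem_insert.1 h₁ with e₁ | m₁ <;> rcases Finset.mem_insert.1 h₂ with e₂ | m₂
        · exact absurd (e₁.trans e₂.symm) hne
        · exact e₁ ▸ hdJ _ m₂
        · exact e₂ ▸ (hdJ _ m₁).symm
        · exact hdisj _ m₁ _ m₂ hne
    have := hmax _ hgood
    rw [Finset.card_insert_of_notMem hnot] at this
    omega

theorem card_colored_eq_sum (c : PartialColoring V k) :
    Fintype.card V = (Finset.univ.filter fun v => c v = none).card
      + ∑ i : Fin k, (colorClass c i).card := by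
  classical
  rw [← Finset.card_univ, Finset.card_eq_sum_card_fiberwise (f := c) (t := Finset.univ)
    (fun _ _ => Finset.mem_coe.2 (Finset.mem_univ _)), Fintype.sum_option]
  rfl

variable [DecidableEq V]

theorem legalSet_update_subset {c : PartialColoring V k} {v : V} {i : Fin k}
    (hl : Legal G c v i) (j : Fin k) :
    legalSet G (Function.update c v (some i)) j ⊆ legalSet G c j := by
  intro w hw
  rw [mem_legalSet] at hw ⊢
  have hext := extends_update c hl.1 i
  have hwn : c w = none := by
    by_contra hne
    rw [Legal, hext w hne] at hw
    exact hne hw.1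
  exact ⟨hwn, fun u hu hc => hw.2 u hu (by rw [hext u (by rw [hc]; simp), hc])⟩

theorem colorClass_update {c : PartialColoring V k} {v : V} {i : Fin k} (hv : c v = none) :
    colorClass (Function.update c v (some i)) i = insert v (colorClass c i) ∧
    v ∉ colorClass c i ∧
    ∀ j, j ≠ i → colorClass (Function.update c v (some i)) j = colorClass c j := by
  refine ⟨?_, ?_, fun j hj => ?_⟩
  · ext w
    rw [Finset.mem_insert, mem_colorClass, mem_colorClass]
    by_cases hw : w = v
    · simp [hw]
    · rw [Function.update_of_ne hw]
      simp [hw]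
  · rw [mem_colorClass, hv]
    simp
  · ext w
    rw [mem_colorClass, mem_colorClass]
    by_cases hw : w = v
    · subst hw
      simp [hv, hj.symm]
    · rw [Function.update_of_ne hw]

theorem freeNonNeighbors_update_subset {c : PartialColoring V k} {v : V} {i : Fin k}
    (S : Finset V) :
    freeNonNeighbors G (Function.update c v (some i)) S ⊆ freeNonNeighbors G c S := by
  intro w hw
  simp only [freeNonNeighbors, Finset.mem_filter, Finset.mem_univ, true_and] at hw ⊢
  refine ⟨?_, hw.2⟩
  by_cases hwv : w = v
  · subst hwv
    simp at hw
  · rw [Function.update_of_ne hwv] at hw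
    exact hw.1

/-- A move in another class does not change the state of a class. -/
theorem ClassState.update_of_ne {b : ℕ} {c : PartialColoring V k} {v : V} {i j : Fin k}
    (hl : Legal G c v i) (hj : j ≠ i) (h : ClassState G P b c j) :
    ClassState G P b (Function.update c v (some i)) j := by
  have hsub := legalSet_update_subset hl j
  have hC := (colorClass_update (i := i) hl.1).2.2 j hj
  unfold ClassState
  rw [hC]
  rcases h with h | ⟨S, R, m, h1, h2, h3, h4, h5, h6, h7⟩ | h | ⟨S, h1, h2, h3⟩
  · exact Or.inl h
  · refine Or.inr (Or.inl ⟨S, R, m, h1, h2, h3, fun I hI => h4 I fun v hv => ?_,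
      fun Q hQ => h5 Q fun v hv => ?_, h6, h7⟩)
    · exact ⟨hsub (hI v hv).1, (hI v hv).2⟩
    · exact ⟨hsub (hQ v hv).1, (hQ v hv).2⟩
  · exact Or.inr (Or.inr (Or.inl fun I hI => h I (hI.trans hsub)))
  · exact Or.inr (Or.inr (Or.inr ⟨S, h1, h2,
      (Finset.card_le_card (freeNonNeighbors_update_subset S)).trans h3⟩))

theorem finalSize_bound_update {c : PartialColoring V k} {v : V} {i : Fin k} {F : ℕ}
    (hl : Legal G c v i)
    (h : ∀ I : Finset V, I ⊆ legalSet G c i → G.IsIndepSet I →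
      (colorClass c i).card + I.card ≤ F) :
    ∀ I : Finset V, I ⊆ legalSet G (Function.update c v (some i)) i → G.IsIndepSet I →
      (colorClass (Function.update c v (some i)) i).card + I.card ≤ F := by
  intro I hI hind
  obtain ⟨h1, h2, -⟩ := colorClass_update (i := i) hl.1
  have hvI : v ∉ I := by
    intro hv
    have := (mem_legalSet.1 (hI hv)).1
    simp at this
  have hnadj : ∀ w ∈ I, ¬ G.Adj w v := by
    intro w hw hadj
    exact (mem_legalSet.1 (hI hw)).2 v hadj (by simp)
  have := h (insert v I) (by
    intro w hw
    rcases Finset.mem_insert.1 hw with rfl | hw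
    · exact mem_legalSet.2 hl
    · exact legalSet_update_subset hl i (hI hw)) (by
    rw [Finset.coe_insert, SimpleGraph.isIndepSet_iff, Set.pairwise_insert]
    exact ⟨hind, fun w hw _ => ⟨fun hadj => hnadj w hw hadj.symm, hnadj w hw⟩⟩)
  rw [Finset.card_insert_of_notMem hvI] at this
  rw [h1, Finset.card_insert_of_notMem h2]
  omega

/-- The effect on its own class of a move that Breaker has not answered yet. -/
theorem ClassState.update_self {c : PartialColoring V k} {v : V} {i : Fin k}
    (hl : Legal G c v i) (h : ClassState G P 0 c i) :
    ClassState G P 1 (Function.update c v (some i)) i := by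
  have hsub := legalSet_update_subset hl i
  obtain ⟨hC, hv, -⟩ := colorClass_update (i := i) hl.1
  have hcard : (colorClass (Function.update c v (some i)) i).card = (colorClass c i).card + 1 := by
    rw [hC, Finset.card_insert_of_notMem hv]
  have hCsub : colorClass c i ⊆ colorClass (Function.update c v (some i)) i := by
    rw [hC]
    exact Finset.subset_insert _ _
  rcases h with h | ⟨S, R, m, h1, h2, h3, h4, h5, h6, h7⟩ | h | ⟨S, h1, h2, h3⟩
  · exact Or.inl (by omega)
  · refine Or.inr (Or.inl ⟨S, R, m, h1.trans hCsub, h2, h3, fun I hI => h4 I fun v hv => ?_,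
      fun Q hQ => h5 Q fun v hv => ?_, by omega, h7⟩)
    · exact ⟨hsub (hI v hv).1, (hI v hv).2⟩
    · exact ⟨hsub (hQ v hv).1, (hQ v hv).2⟩
  · exact Or.inr (Or.inr (Or.inl (finalSize_bound_update hl h)))
  · exact Or.inr (Or.inr (Or.inr ⟨S, h1.trans hCsub, h2,
      (Finset.card_le_card (freeNonNeighbors_update_subset S)).trans h3⟩))

/-- Breaker can restore the state of a class in which some move is legal. -/
theorem exists_breaker_move (hG : BreakerConditions G P) {c : PartialColoring V k} {i : Fin k}
    (h : ClassState G P 1 c i) (hne : (legalSet G c i).Nonempty) :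
    ∃ v, Legal G c v i ∧ ClassState G P 0 (Function.update c v (some i)) i := by
  classical
  obtain ⟨v₀, hv₀⟩ := hne
  rw [mem_legalSet] at hv₀
  -- Once the class is finished or exceptional, any move will do.
  have hdone : (∀ I : Finset V, I ⊆ legalSet G c i → G.IsIndepSet I →
      (colorClass c i).card + I.card ≤ P.finalSize) →
      ∃ v, Legal G c v i ∧ ClassState G P 0 (Function.update c v (some i)) i := fun h =>
    ⟨v₀, hv₀, Or.inr (Or.inr (Or.inl (finalSize_bound_update hv₀ h)))⟩
  have hexc : (∃ S : Finset V, S ⊆ colorClass c i ∧ S.card ≤ P.s₁ ∧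
      (freeNonNeighbors G c S).card ≤ P.t + P.r * P.j₀) →
      ∃ v, Legal G c v i ∧ ClassState G P 0 (Function.update c v (some i)) i := by
    rintro ⟨S, h1, h2, h3⟩
    refine ⟨v₀, hv₀, Or.inr (Or.inr (Or.inr ⟨S, h1.trans ?_, h2,
      (Finset.card_le_card (freeNonNeighbors_update_subset S)).trans h3⟩))⟩
    rw [(colorClass_update (i := i) hv₀.1).1]
    exact Finset.subset_insert _ _
  rcases h with h | ⟨S, R, m, h1, h2, h3, h4, h5, h6, h7⟩ | h | h
  · obtain ⟨hC, hv, -⟩ := colorClass_update (i := i) hv₀.1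
    have hcard : (colorClass (Function.update c v₀ (some i)) i).card
        = (colorClass c i).card + 1 := by
      rw [hC, Finset.card_insert_of_notMem hv]
    refine ⟨v₀, hv₀, ?_⟩
    by_cases hlt : (colorClass (Function.update c v₀ (some i)) i).card < P.s₀
    · exact Or.inl (by omega)
    · obtain ⟨S, hS, hSc⟩ := Finset.exists_subset_card_eq (not_lt.1 hlt)
      obtain ⟨R, hR, hI⟩ := exists_dangerous_set hG hS hSc
      refine Or.inr (Or.inl ⟨S, R, 0, hS, hSc, hR, hI, fun Q hQ => ?_, by omega, by omega⟩)
      rw [pow_zero, one_mul]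
      have : Q.card ≤ P.r * P.j₀ :=
        (Finset.card_le_card fun v hv => (hQ v hv).2).trans hR
      exact_mod_cast this
  · set R' := (legalSet G c i) ∩ R with hR'
    have hR'm : ((R'.card : ℕ) : ℝ) ≤ (1 - P.κ) ^ m * (P.r * P.j₀) :=
      h5 R' fun v hv => Finset.mem_inter.1 hv
    by_cases hsmall : R'.card < P.j₀
    · -- The dangerous set is small: no large independent set of legal vertices is left.
      apply hdone
      intro I hI hind
      have e1 : (I ∩ R).card ≤ R'.card :=
        Finset.card_le_card (Finset.inter_subset_inter_right hI)
      have e2 : (I \ R).card < P.j₀ := h4 (I \ R)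
        (fun v hv => ⟨hI (Finset.mem_sdiff.1 hv).1, (Finset.mem_sdiff.1 hv).2⟩)
        (hind.mono (by exact_mod_cast Finset.sdiff_subset))
      have e3 := Finset.card_inter_add_card_sdiff I R
      unfold BreakerParams.finalSize
      omega
    by_cases hfew : (legalSet G c i).card ≤ P.t + P.r * P.j₀
    · by_cases hfew' : (freeNonNeighbors G c (colorClass c i)).card ≤ P.t + P.r * P.j₀
      · exact hexc ⟨colorClass c i, Finset.Subset.refl _, by have := hG.size; omega, hfew'⟩
      · exfalso
        apply hfew'
        refine (Finset.card_le_card fun v hv => ?_).trans hfew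
        simp only [freeNonNeighbors, Finset.mem_filter, Finset.mem_univ, true_and] at hv
        exact mem_legalSet.2 ⟨hv.1, fun w hw hc => hv.2 w (mem_colorClass.2 hc) hw⟩
    -- Otherwise some legal vertex outside `R` has many neighbours in the dangerous set.
    have hm : m ≤ P.h := by
      apply hG.h_spec
      have hj : (0 : ℝ) < P.j₀ := by exact_mod_cast hG.j₀_pos
      have hge : (P.j₀ : ℝ) ≤ R'.card := by exact_mod_cast not_lt.1 hsmall
      have := hge.trans hR'm
      by_contra hcon
      push Not at hcon
      nlinarith
    have hTc : P.t ≤ (legalSet G c i \ R).card := by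
      have := Finset.le_card_sdiff R (legalSet G c i)
      omega
    obtain ⟨T, hT, hTcard⟩ := Finset.exists_subset_card_eq hTc
    have hnone : ∀ v ∈ legalSet G c i, v ∉ S := by
      intro v hv hvS
      have h8 := (mem_legalSet.1 hv).1
      have h9 := mem_colorClass.1 (h1 hvS)
      rw [h8] at h9
      cases h9
    obtain ⟨v, hvT, hdeg⟩ := hG.spoil S R' T h2 (not_lt.1 hsmall)
      ((Finset.card_le_card Finset.inter_subset_right).trans h3) hTcard
      (Finset.disjoint_right.2 fun v hv => hnone v (Finset.mem_inter.1 hv).1)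
      (Finset.disjoint_left.2 fun v hv => hnone v (Finset.mem_sdiff.1 (hT hv)).1)
      (Finset.disjoint_left.2 fun v hv hv' =>
        (Finset.mem_sdiff.1 (hT hv)).2 (Finset.mem_inter.1 hv').2)
      (fun v hv w hw hadj => (mem_legalSet.1 (Finset.mem_sdiff.1 (hT hv)).1).2 w hadj
        (mem_colorClass.1 (h1 hw)))
    have hl : Legal G c v i := mem_legalSet.1 (Finset.mem_sdiff.1 (hT hvT)).1
    have hsub := legalSet_update_subset hl i
    obtain ⟨hC, hv, -⟩ := colorClass_update (i := i) hl.1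
    refine ⟨v, hl, Or.inr (Or.inl ⟨S, R, m + 1, ?_, h2, h3, fun I hI => h4 I fun v hv => ?_,
      fun Q hQ => ?_, ?_, by omega⟩)⟩
    · rw [hC]
      exact h1.trans (Finset.subset_insert _ _)
    · exact ⟨hsub (hI v hv).1, (hI v hv).2⟩
    · have hQ' : Q ⊆ R' \ (R'.filter fun w => G.Adj v w) := by
        intro w hw
        obtain ⟨e1, e2⟩ := hQ w hw
        rw [Finset.mem_sdiff, Finset.mem_filter]
        refine ⟨Finset.mem_inter.2 ⟨hsub e1, e2⟩, fun hadj => ?_⟩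
        exact (mem_legalSet.1 e1).2 v hadj.2.symm (by simp)
      have hle := Finset.card_le_card hQ'
      rw [Finset.card_sdiff_of_subset (Finset.filter_subset _ _)] at hle
      have hd : degIn G R' v ≤ R'.card := degIn_le_card R' v
      have hQr : Q.card + degIn G R' v ≤ R'.card := by
        unfold degIn at hd ⊢
        omega
      have hQr' : (Q.card : ℝ) + degIn G R' v ≤ R'.card := by exact_mod_cast hQr
      have hκ := hG.κ_le
      calc (Q.card : ℝ) ≤ (1 - P.κ) * R'.card := by linarith
        _ ≤ (1 - P.κ) * ((1 - P.κ) ^ m * (P.r * P.j₀)) :=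
            mul_le_mul_of_nonneg_left hR'm (by linarith)
        _ = (1 - P.κ) ^ (m + 1) * (P.r * P.j₀) := by ring
    · rw [hC, Finset.card_insert_of_notMem hv]
      omega
  · exact hdone h
  · exact hexc h

/-- Exceptional classes are rare: given `μ` disjoint sets of size at most `P.s₁`, presented as the
classes of a partial colouring, and a set `U` of `u₀` further vertices, one of the `μ` sets has more
than `P.t + P.r * P.j₀` common non-neighbours in `U`. -/
def FewExceptional (G : SimpleGraph V) (P : BreakerParams) (μ u₀ : ℕ) : Prop :=
  ∀ (c : PartialColoring V μ) (U : Finset V), (∀ u ∈ U, c u = none) → u₀ ≤ U.card →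
    (∀ i, (colorClass c i).card ≤ P.s₁) →
    ∃ i, ∃ T ⊆ U, (∀ u ∈ T, ∀ w, G.Adj u w → c w ≠ some i) ∧ P.t + P.r * P.j₀ < T.card

/-- As long as all classes are in one of the described states, few vertices are coloured. -/
theorem sum_card_colorClass_le (hG : BreakerConditions G P) {μ u₀ α₀ : ℕ}
    (hfew : FewExceptional G P μ u₀)
    (hα : ∀ I : Finset V, G.IsIndepSet I → I.card ≤ α₀)
    {c : PartialColoring V k} (hproper : ∀ i, G.IsIndepSet (colorClass c i))
    (hstate : ∀ i, ClassState G P 1 c i)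
    (hU : u₀ ≤ (Finset.univ.filter fun v => c v = none).card) :
    ∑ i : Fin k, (colorClass c i).card ≤ k * P.finalSize + μ * α₀ := by
  classical
  let bad : Finset (Fin k) := Finset.univ.filter fun i => ∃ S : Finset V,
    S ⊆ colorClass c i ∧ S.card ≤ P.s₁ ∧ (freeNonNeighbors G c S).card ≤ P.t + P.r * P.j₀
  have hbad : bad.card < μ := by
    by_contra hcon
    obtain ⟨B, hB, hBc⟩ := Finset.exists_subset_card_eq (not_lt.1 hcon)
    have hBbad : ∀ i ∈ B, ∃ S : Finset V, S ⊆ colorClass c i ∧ S.card ≤ P.s₁ ∧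
        (freeNonNeighbors G c S).card ≤ P.t + P.r * P.j₀ := fun i hi =>
      (Finset.mem_filter.1 (hB hi)).2
    choose! S hS1 hS2 hS3 using hBbad
    let e : Fin μ ≃ B := (finCongr hBc.symm).trans B.equivFin.symm
    let c' : PartialColoring V μ := fun v =>
      if h : ∃ m : Fin μ, v ∈ S (e m) then some h.choose else none
    have hclass : ∀ m, colorClass c' m = S (e m) := by
      intro m
      ext v
      rw [mem_colorClass]
      constructor
      · intro hv
        by_cases h : ∃ m : Fin μ, v ∈ S (e m)
        · have hm : h.choose = m := by simpa [c', h] using hv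
          have := h.choose_spec
          rwa [hm] at this
        · simp [c', h] at hv
      · intro hv
        have h : ∃ m : Fin μ, v ∈ S (e m) := ⟨m, hv⟩
        have h1 := mem_colorClass.1 (hS1 _ (e h.choose).2 h.choose_spec)
        have h2 := mem_colorClass.1 (hS1 _ (e m).2 hv)
        rw [h1] at h2
        have h3 : h.choose = m := e.injective (Subtype.ext (Option.some.inj h2))
        simp only [c', h, dif_pos]
        rw [h3]
    obtain ⟨m, T, hTU, hT, hTc⟩ := hfew c' (Finset.univ.filter fun v => c v = none) (fun u hu => by
      have hun : c u = none := by simpa using hu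
      have : ¬ ∃ m : Fin μ, u ∈ S (e m) := by
        rintro ⟨m, hm⟩
        have := mem_colorClass.1 (hS1 _ (e m).2 hm)
        rw [hun] at this
        cases this
      simp [c', this]) hU (fun m => by rw [hclass]; exact hS2 _ (e m).2)
    refine absurd (hS3 _ (e m).2) (not_le.2 (hTc.trans_le (Finset.card_le_card fun u hu => ?_)))
    simp only [freeNonNeighbors, Finset.mem_filter, Finset.mem_univ, true_and]
    refine ⟨by simpa using hTU hu, fun w hw hadj => ?_⟩
    rw [← hclass] at hw
    exact hT u hu w hadj (mem_colorClass.1 hw)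
  have hle : ∀ i, (colorClass c i).card ≤ P.finalSize + if i ∈ bad then α₀ else 0 := by
    intro i
    split_ifs with hi
    · exact (hα _ (hproper i)).trans (Nat.le_add_left _ _)
    · unfold BreakerParams.finalSize
      rcases hstate i with h | ⟨S, R, m, -, -, -, -, -, h6, h7⟩ | h | h
      · omega
      · have := hG.j₀_pos
        omega
      · have := h ∅ (Finset.empty_subset _) (by simp)
        simp only [Finset.card_empty, BreakerParams.finalSize] at this
        omega
      · exact absurd (Finset.mem_filter.2 ⟨Finset.mem_univ i, h⟩) hi
  calc ∑ i : Fin k, (colorClass c i).card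
      ≤ ∑ i : Fin k, (P.finalSize + if i ∈ bad then α₀ else 0) := Finset.sum_le_sum fun i _ => hle i
    _ = k * P.finalSize + bad.card * α₀ := by
        rw [Finset.sum_add_distrib, Finset.sum_const, Finset.card_univ, Fintype.card_fin,
          smul_eq_mul, Finset.sum_ite_mem, Finset.univ_inter, Finset.sum_const, smul_eq_mul]
    _ ≤ k * P.finalSize + μ * α₀ := by gcongr

/-- Breaker wins on a sufficiently pseudorandom graph: the colours cannot cover all vertices. -/
theorem not_makerHasWinningStrategy (hG : BreakerConditions G P) (hs₀ : 0 < P.s₀) {μ u₀ α₀ : ℕ}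
    (hfew : FewExceptional G P μ u₀)
    (hα : ∀ I : Finset V, G.IsIndepSet I → I.card ≤ α₀)
    (hcount : k * P.finalSize + μ * α₀ + u₀ + 3 ≤ Fintype.card V) :
    ¬ MakerHasWinningStrategy G k := by
  classical
  set free : PartialColoring V k → ℕ := fun c => (Finset.univ.filter fun v => c v = none).card
    with hfree
  have hfree_update : ∀ (c : PartialColoring V k) v i, c v = none →
      free c ≤ free (Function.update c v (some i)) + 1 := by
    intro c v i hv
    have hsub : (Finset.univ.filter fun w => c w = none)
        ⊆ insert v (Finset.univ.filter fun w => Function.update c v (some i) w = none) := by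
      intro w hw
      by_cases hwv : w = v
      · simp [hwv]
      · refine Finset.mem_insert_of_mem ?_
        simp only [Finset.mem_filter, Finset.mem_univ, true_and] at hw ⊢
        rwa [Function.update_of_ne hwv]
    exact (Finset.card_le_card hsub).trans (Finset.card_insert_le _ _)
  have hproper_update : ∀ (c : PartialColoring V k) v i, Legal G c v i →
      (∀ j, G.IsIndepSet (colorClass c j)) →
      ∀ j, G.IsIndepSet (colorClass (Function.update c v (some i)) j) := by
    intro c v i hl hp j
    obtain ⟨hC, -, hne⟩ := colorClass_update (i := i) hl.1
    by_cases hj : j = i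
    · subst hj
      rw [hC, Finset.coe_insert, SimpleGraph.isIndepSet_iff, Set.pairwise_insert]
      exact ⟨hp j, fun w hw _ => ⟨fun hadj => hl.2 w hadj (mem_colorClass.1 hw),
        fun hadj => hl.2 w hadj.symm (mem_colorClass.1 hw)⟩⟩
    · rw [hne j hj]
      exact hp j
  -- At Maker's turn all moves are answered; at Breaker's turn at most one class needs an answer.
  let inv : Player → PartialColoring V k → Prop := fun Q c =>
    (∀ i, G.IsIndepSet (colorClass c i)) ∧
    match Q with
    | Player.maker => u₀ + 3 ≤ free c ∧ ∀ i, ClassState G P 0 c i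
    | Player.breaker => u₀ + 2 ≤ free c ∧
        ∃ i, ClassState G P 1 c i ∧ ∀ j, j ≠ i → ClassState G P 0 c j
  have main : ∀ (Q : Player) (c : PartialColoring V k), MakerWins G Q c → ¬ inv Q c := by
    intro Q c hw
    induction hw with
    | complete Q c h =>
      rintro ⟨-, hQ⟩
      have h0 : free c = 0 := by
        rw [hfree]
        simp only [Finset.card_eq_zero, Finset.filter_eq_empty_iff]
        exact fun v _ => h v
      cases Q with
      | maker => exact absurd hQ.1 (by omega)
      | breaker => exact absurd hQ.1 (by omega)
    | maker c v i h hw ih =>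
      rintro ⟨hp, hu, hs⟩
      refine ih ⟨hproper_update c v i h hp, ?_, i, (hs i).update_self h, fun j hj =>
        (hs j).update_of_ne h hj⟩
      have := hfree_update c v i h.1
      omega
    | breaker c h hw ih =>
      rintro ⟨hp, hu, i₀, hi₀, hs⟩
      have hs1 : ∀ i, ClassState G P 1 c i := by
        intro i
        by_cases hi : i = i₀
        · exact hi ▸ hi₀
        · exact (hs i hi).mono (by norm_num)
      -- After any legal move the classes are still far from covering all vertices.
      have hbig : ∀ v i, Legal G c v i →
          (∀ j, ClassState G P 0 (Function.update c v (some i)) j) →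
          inv Player.maker (Function.update c v (some i)) := by
        intro v i hl hst
        have hp' := hproper_update c v i hl hp
        refine ⟨hp', ?_, hst⟩
        have h1 := hfree_update c v i hl.1
        have h2 := sum_card_colorClass_le hG hfew hα hp'
          (fun j => (hst j).mono (by norm_num)) (show u₀ ≤ free _ by omega)
        have h3 := card_colored_eq_sum (Function.update c v (some i))
        change _ = free _ + _ at h3
        omega
      by_cases hne : (legalSet G c i₀).Nonempty
      · obtain ⟨v, hl, hst⟩ := exists_breaker_move hG hi₀ hne
        refine ih v i₀ hl (hbig v i₀ hl fun j => ?_)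
        by_cases hj : j = i₀
        · exact hj ▸ hst
        · exact (hs j hj).update_of_ne hl hj
      · -- The class of Maker's last move is closed; Breaker moves in any other class.
        obtain ⟨w, i, hw⟩ := h
        rw [Finset.not_nonempty_iff_eq_empty] at hne
        have hi₀' : ClassState G P 0 c i₀ := by
          have hclosed : (colorClass c i₀).card ≤ P.finalSize → ClassState G P 0 c i₀ := fun h =>
            Or.inr (Or.inr (Or.inl fun I hI _ => by
              rw [hne, Finset.subset_empty] at hI
              simpa [hI] using h))
          unfold BreakerParams.finalSize at hclosed
          have := hG.j₀_pos
          rcases hi₀ with h | ⟨S, R, m, -, -, -, -, -, h6, h7⟩ | h | h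
          · exact hclosed (by omega)
          · exact hclosed (by omega)
          · exact Or.inr (Or.inr (Or.inl h))
          · exact Or.inr (Or.inr (Or.inr h))
        have hii : i ≠ i₀ := by
          rintro rfl
          have := mem_legalSet.2 hw
          rw [hne] at this
          simp at this
        obtain ⟨v, hl, hst⟩ := exists_breaker_move hG (hs1 i) ⟨w, mem_legalSet.2 hw⟩
        refine ih v i hl (hbig v i hl fun j => ?_)
        by_cases hj : j = i
        · exact hj ▸ hst
        · by_cases hj' : j = i₀
          · exact hj' ▸ hi₀'.update_of_ne hl (hj' ▸ hj)
          · exact (hs j hj').update_of_ne hl hj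
  intro hwin
  have h0 : ∀ i, colorClass (fun _ => none : PartialColoring V k) i = ∅ := by
    intro i
    ext v
    simp [mem_colorClass]
  refine main _ _ hwin ⟨fun i => by rw [h0]; simp, ?_, fun i => Or.inl ?_⟩
  · rw [hfree]
    simp only [Finset.filter_true, Finset.card_univ]
    omega
  · rw [h0]
    simpa using hs₀

end Breaker

/-! ### Union bounds -/

theorem self_le_choose {n s : ℕ} (hs : 1 ≤ s) (hn : s < n) : n ≤ n.choose s := by
  induction n with
  | zero => omega
  | succ n ih =>
    obtain ⟨s, rfl⟩ : ∃ s', s = s' + 1 := ⟨s - 1, by omega⟩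
    rw [Nat.choose_succ_succ']
    rcases Nat.lt_or_ge (s + 1) n with h | h
    · have := ih h
      have : 0 < n.choose s := Nat.choose_pos (by omega)
      omega
    · have hsn : s + 1 = n := by omega
      subst hsn
      simp

/-- If more than an eighth of the vertices of `S` have degree at least `16 q` in `S`, then `S`
spans at least `q |S|` edges. -/
theorem card_edges_ge_of_highDeg {V : Type*} [DecidableEq V] {G : SimpleGraph V} {q : ℕ}
    {S : Finset V}
    (h : S.card < 8 * (highDeg G (16 * q) S).card) :
    ∃ F ⊆ innerPairs S, F.card = q * S.card ∧ ∀ e ∈ F, e ∈ G.edgeSet := by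
  classical
  set E := (innerPairs S).filter fun e => e ∈ G.edgeSet with hE
  set D := (S ×ˢ S).filter fun x => G.Adj x.1 x.2 with hD
  have h1 : D.card = ∑ v ∈ S, degIn G S v := by
    rw [hD, Finset.card_filter, Finset.sum_product]
    refine Finset.sum_congr rfl fun v _ => ?_
    rw [degIn, Finset.card_filter]
  have h2 : (highDeg G (16 * q) S).card * (16 * q) ≤ ∑ v ∈ S, degIn G S v := by
    calc (highDeg G (16 * q) S).card * (16 * q)
        ≤ ∑ v ∈ highDeg G (16 * q) S, degIn G S v := by
          rw [← smul_eq_mul]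
          exact Finset.card_nsmul_le_sum _ _ _ fun v hv => (Finset.mem_filter.1 hv).2
      _ ≤ _ := Finset.sum_le_sum_of_subset (Finset.filter_subset _ _)
  have h3 : D.card ≤ 2 * E.card := by
    refine Finset.card_le_mul_card_image_of_maps_to (f := fun x : V × V => s(x.1, x.2)) ?_ 2 ?_
    · intro x hx
      simp only [hD, Finset.mem_filter, Finset.mem_product] at hx
      rw [hE, Finset.mem_filter]
      exact ⟨mem_innerPairs.2 ⟨x.1, hx.1.1, x.2, hx.1.2, hx.2.ne, rfl⟩, hx.2⟩
    · intro e _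
      induction e using Sym2.ind with
      | _ a b =>
        refine (Finset.card_le_card (t := {(a, b), (b, a)}) fun x hx => ?_).trans
          Finset.card_le_two
        have := Sym2.eq_iff.1 (Finset.mem_filter.1 hx).2
        simp only [Finset.mem_insert, Finset.mem_singleton, Prod.ext_iff]
        exact this
  have h4 : q * S.card ≤ E.card := by nlinarith
  obtain ⟨F, hF, hFc⟩ := Finset.exists_subset_card_eq h4
  exact ⟨F, hF.trans (Finset.filter_subset _ _), hFc, fun e he => (Finset.mem_filter.1 (hF he)).2⟩

section UnionBounds

variable {V : Type*} [Fintype V] [DecidableEq V] {p : ℝ}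

theorem indicator_one_nonneg {α : Type*} (A : Set α) (x : α) :
    (0 : ℝ) ≤ Set.indicator A 1 x :=
  Set.indicator_nonneg (fun _ _ => zero_le_one) x

theorem one_le_indicator {α : Type*} {A : Set α} {x : α} (h : x ∈ A) :
    (1 : ℝ) ≤ Set.indicator A 1 x := by
  rw [Set.indicator_of_mem h]
  rfl

theorem card_colorings_mul_subsets (k : ℕ) (Q : PartialColoring V k × Finset V → Prop)
    [DecidablePred Q] :
    (((Finset.univ : Finset (PartialColoring V k × Finset V)).filter Q).card : ℝ)
      ≤ (2 * (k + 1)) ^ Fintype.card V := by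
  have h : ((Finset.univ : Finset (PartialColoring V k × Finset V)).filter Q).card
      ≤ (2 * (k + 1)) ^ Fintype.card V := by
    refine (Finset.card_filter_le _ _).trans (le_of_eq ?_)
    rw [Finset.card_univ, Fintype.card_prod, Fintype.card_finset, mul_pow, mul_comm,
      Fintype.card_fun, Fintype.card_option, Fintype.card_fin]
  exact_mod_cast h

/-- With high probability, for every partial colouring, among any `m` uncoloured vertices one has
at least `θ` available colours. -/
theorem graphMean_avail_low_le (hp0 : 0 ≤ p) (hp1 : p ≤ 1) (k m θ : ℕ) (β : ℝ)
    (hβ : ∀ c : PartialColoring V k, β ≤ ∑ i : Fin k, (1 - p) ^ (colorClass c i).card)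
    (hθ : (θ : ℝ) ≤ β / 2) :
    graphMean p (Set.indicator {G : SimpleGraph V | ¬ ∀ (c : PartialColoring V k) (B : Finset V),
        B.card = m → (∀ v ∈ B, c v = none) → ∃ v ∈ B, θ ≤ avail G c v} 1)
      ≤ (2 * (k + 1)) ^ Fintype.card V * Real.exp (-(m * β) / 8) := by
  classical
  refine (graphMean_indicator_le_card_mul hp0 hp1
    ((Finset.univ : Finset (PartialColoring V k × Finset V)).filter fun x =>
      x.2.card = m ∧ ∀ v ∈ x.2, x.1 v = none)
    (fun x G => Real.exp (m * β / 2 - ∑ v ∈ x.2, (avail G x.1 v : ℝ))) _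
    (Real.exp (-(m * β) / 8)) (fun _ _ _ => (Real.exp_pos _).le) ?_ ?_).trans ?_
  · intro G hG
    simp only [Set.mem_ofPred_eq, not_forall] at hG
    obtain ⟨c, B, hB, hc, hlow⟩ := hG
    push Not at hlow
    refine ⟨(c, B), by simpa using ⟨hB, hc⟩, ?_⟩
    rw [Real.one_le_exp_iff, sub_nonneg]
    calc ∑ v ∈ B, (avail G c v : ℝ) ≤ ∑ v ∈ B, β / 2 := Finset.sum_le_sum fun v hv =>
          (Nat.cast_le.2 (hlow v hv).le).trans hθ
      _ = m * β / 2 := by rw [Finset.sum_const, hB, nsmul_eq_mul]; ring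
  · intro x hx
    obtain ⟨h1, h2⟩ := (Finset.mem_filter.1 hx).2
    refine graphMean_sum_avail_le hp0 hp1 x.1 x.2 h2 _ ?_
    rw [h1]
    exact mul_le_mul_of_nonneg_left (hβ x.1) (Nat.cast_nonneg _)
  · exact mul_le_mul_of_nonneg_right (card_colorings_mul_subsets k _) (Real.exp_pos _).le

/-- Exceptional classes are rare with high probability. -/
theorem graphMean_fewExceptional_le (hp0 : 0 ≤ p) (hp1 : p ≤ 1) (P : BreakerParams) (μ u₀ : ℕ)
    (M : ℝ) (hM : M ≤ u₀ * (μ * (1 - p) ^ P.s₁))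
    (hM' : (μ : ℝ) * (P.t + P.r * P.j₀ : ℕ) ≤ M / 2) :
    graphMean p (Set.indicator {G : SimpleGraph V | ¬ FewExceptional G P μ u₀} 1)
      ≤ (2 * (μ + 1)) ^ Fintype.card V * Real.exp (-M / 8) := by
  classical
  refine (graphMean_indicator_le_card_mul hp0 hp1
    ((Finset.univ : Finset (PartialColoring V μ × Finset V)).filter fun x =>
      x.2.card = u₀ ∧ (∀ v ∈ x.2, x.1 v = none) ∧ ∀ i, (colorClass x.1 i).card ≤ P.s₁)
    (fun x G => Real.exp (M / 2 - ∑ v ∈ x.2, (avail G x.1 v : ℝ))) _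
    (Real.exp (-M / 8)) (fun _ _ _ => (Real.exp_pos _).le) ?_ ?_).trans ?_
  · intro G hG
    simp only [Set.mem_ofPred_eq, FewExceptional, not_forall] at hG
    obtain ⟨c, U', hc', hU', hs, hlow⟩ := hG
    obtain ⟨U, hUU, hU⟩ := Finset.exists_subset_card_eq hU'
    have hc : ∀ u ∈ U, c u = none := fun u hu => hc' u (hUU hu)
    refine ⟨(c, U), by simpa using ⟨hU, hc, hs⟩, ?_⟩
    rw [Real.one_le_exp_iff, sub_nonneg]
    have h1 : ∑ v ∈ U, avail G c v
        = ∑ i : Fin μ, (U.filter fun v => ∀ w, G.Adj v w → c w ≠ some i).card := by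
      unfold avail
      simp only [Finset.card_eq_sum_ones, Finset.sum_filter]
      rw [Finset.sum_comm]
      congr!
    have h2 : ∀ i : Fin μ, (U.filter fun v => ∀ w, G.Adj v w → c w ≠ some i).card
        ≤ P.t + P.r * P.j₀ := by
      intro i
      by_contra hcon
      exact hlow ⟨i, _, (Finset.filter_subset _ _).trans hUU,
        fun u hu => (Finset.mem_filter.1 hu).2, not_le.1 hcon⟩
    have h3 : ∑ v ∈ U, avail G c v ≤ μ * (P.t + P.r * P.j₀) := by
      rw [h1]
      refine (Finset.sum_le_card_nsmul _ _ _ fun i _ => h2 i).trans ?_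
      simp
    refine le_trans ?_ hM'
    exact_mod_cast h3
  · intro x hx
    obtain ⟨h1, h2, h3⟩ := (Finset.mem_filter.1 hx).2
    refine graphMean_sum_avail_le hp0 hp1 x.1 x.2 h2 _ (hM.trans ?_)
    rw [h1]
    refine mul_le_mul_of_nonneg_left ?_ (Nat.cast_nonneg _)
    calc (μ : ℝ) * (1 - p) ^ P.s₁ = ∑ i : Fin μ, (1 - p) ^ P.s₁ := by simp
      _ ≤ _ := Finset.sum_le_sum fun i _ =>
        pow_le_pow_of_le_one (by linarith) (by linarith) (h3 i)
  · exact mul_le_mul_of_nonneg_right (card_colorings_mul_subsets μ _) (Real.exp_pos _).le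

/-- The probability of an independent set of size `s`. -/
theorem graphMean_exists_indep_le (hp0 : 0 ≤ p) (hp1 : p ≤ 1) (s : ℕ) :
    graphMean p (Set.indicator
        {G : SimpleGraph V | ¬ ∀ I : Finset V, G.IsIndepSet I → I.card < s} 1)
      ≤ (Fintype.card V).choose s * (1 - p) ^ s.choose 2 := by
  refine (graphMean_indicator_le_card_mul hp0 hp1 (Finset.powersetCard s (Finset.univ : Finset V))
    (fun I => Set.indicator {G | ∀ e ∈ innerPairs I, e ∉ G.edgeSet} 1) _
    ((1 - p) ^ s.choose 2) (fun _ _ _ => indicator_one_nonneg _ _) ?_ ?_).trans ?_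
  · intro G hG
    simp only [Set.mem_ofPred_eq, not_forall] at hG
    obtain ⟨I', hI', hc⟩ := hG
    obtain ⟨I, hII, hI⟩ := Finset.exists_subset_card_eq (not_lt.1 hc)
    refine ⟨I, by simpa using hI, one_le_indicator ?_⟩
    intro e he
    obtain ⟨v, hv, w, hw, hne, rfl⟩ := mem_innerPairs.1 he
    exact hI' (hII hv) (hII hw) hne
  · intro I hI
    rw [graphMean_no_edge _ (innerPairs_subset I), card_innerPairs,
      (Finset.mem_powersetCard.1 hI).2]
  · rw [Finset.card_powersetCard, Finset.card_univ]

/-- First moment bound for `r` disjoint independent `j₀`-sets among the common non-neighbours of a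
set of size `s₀`. -/
theorem graphMean_few_indep_le (hp0 : 0 ≤ p) (hp1 : p ≤ 1) (s₀ j₀ r : ℕ) :
    graphMean p (Set.indicator {G : SimpleGraph V | ¬ ∀ S : Finset V, S.card = s₀ →
        ∀ 𝒥 : Finset (Finset V), 𝒥.card = r →
        (∀ J ∈ 𝒥, J.card = j₀ ∧ Disjoint S J ∧ G.IsIndepSet J ∧ ∀ v ∈ J, ∀ w ∈ S, ¬ G.Adj v w) →
        ∃ J ∈ 𝒥, ∃ J' ∈ 𝒥, J ≠ J' ∧ ¬ Disjoint J J'} 1)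
      ≤ (Fintype.card V).choose s₀ * ((Fintype.card V).choose j₀ : ℝ) ^ r
        * (1 - p) ^ (r * (s₀ * j₀ + j₀.choose 2)) := by
  classical
  let pairs : Finset V × Finset (Finset V) → Finset (Sym2 V) := fun x =>
    x.2.biUnion fun J => crossPairs x.1 J ∪ innerPairs J
  refine (graphMean_indicator_le_card_mul hp0 hp1
    ((Finset.powersetCard s₀ (Finset.univ : Finset V) ×ˢ
      Finset.powersetCard r (Finset.powersetCard j₀ (Finset.univ : Finset V))).filter fun x =>
        (∀ J ∈ x.2, Disjoint x.1 J) ∧ ∀ J ∈ x.2, ∀ J' ∈ x.2, J ≠ J' → Disjoint J J')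
    (fun x => Set.indicator {G | ∀ e ∈ pairs x, e ∉ G.edgeSet} 1) _
    ((1 - p) ^ (r * (s₀ * j₀ + j₀.choose 2))) (fun _ _ _ => indicator_one_nonneg _ _)
    ?_ ?_).trans ?_
  · intro G hG
    simp only [Set.mem_ofPred_eq, not_forall] at hG
    obtain ⟨S, hS, 𝒥, h𝒥, hJ, hno⟩ := hG
    push Not at hno
    refine ⟨(S, 𝒥), ?_, one_le_indicator ?_⟩
    · simp only [Finset.mem_filter, Finset.mem_product, Finset.mem_powersetCard,
        Finset.subset_univ, true_and]
      exact ⟨⟨hS, fun J h => Finset.mem_powersetCard.2 ⟨Finset.subset_univ _, (hJ J h).1⟩, h𝒥⟩,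
        fun J h => (hJ J h).2.1, hno⟩
    · intro e he
      obtain ⟨J, hJm, he⟩ := Finset.mem_biUnion.1 he
      obtain ⟨-, -, h3, h4⟩ := hJ J hJm
      rcases Finset.mem_union.1 he with he | he
      · obtain ⟨v, hv, w, hw, rfl⟩ := mem_crossPairs.1 he
        exact fun hadj => h4 w hw v hv (SimpleGraph.Adj.symm hadj)
      · obtain ⟨v, hv, w, hw, hne, rfl⟩ := mem_innerPairs.1 he
        exact h3 hv hw hne
  · intro x hx
    obtain ⟨hx1, hSJ, hJJ⟩ := Finset.mem_filter.1 hx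
    obtain ⟨hS, h𝒥⟩ := Finset.mem_product.1 hx1
    obtain ⟨-, hS⟩ := Finset.mem_powersetCard.1 hS
    obtain ⟨h𝒥s, h𝒥⟩ := Finset.mem_powersetCard.1 h𝒥
    rw [graphMean_no_edge]
    · apply le_of_eq
      congr 1
      rw [Finset.card_biUnion, Finset.sum_congr rfl (g := fun _ => s₀ * j₀ + j₀.choose 2),
        Finset.sum_const, h𝒥, smul_eq_mul]
      · intro J hJ
        have hJc := (Finset.mem_powersetCard.1 (h𝒥s hJ)).2
        rw [Finset.card_union_of_disjoint, card_crossPairs (hSJ J hJ), card_innerPairs, hS, hJc]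
        rw [Finset.disjoint_left]
        intro e he he'
        obtain ⟨v, hv, w, hw, rfl⟩ := mem_crossPairs.1 he
        obtain ⟨v', hv', w', hw', -, heq⟩ := mem_innerPairs.1 he'
        have hvJ : v ∈ J := by
          rcases Sym2.eq_iff.1 heq with ⟨rfl, -⟩ | ⟨rfl, -⟩ <;> assumption
        exact Finset.disjoint_left.1 (hSJ J hJ) hv hvJ
      · intro J hJ J' hJ' hne
        rw [Function.onFun, Finset.disjoint_left]
        -- Every such pair has an end in `J`, and all its ends lie in `S ∪ J`.
        have hends : ∀ J ∈ x.2, ∀ e ∈ crossPairs x.1 J ∪ innerPairs J,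
            (∃ w ∈ e, w ∈ J) ∧ ∀ w ∈ e, w ∈ x.1 ∨ w ∈ J := by
          intro J _ e he
          rcases Finset.mem_union.1 he with he | he
          · obtain ⟨v, hv, w, hw, rfl⟩ := mem_crossPairs.1 he
            refine ⟨⟨w, by simp, hw⟩, fun u hu => ?_⟩
            rcases Sym2.mem_iff.1 hu with rfl | rfl
            · exact Or.inl hv
            · exact Or.inr hw
          · obtain ⟨v, hv, w, hw, -, rfl⟩ := mem_innerPairs.1 he
            refine ⟨⟨w, by simp, hw⟩, fun u hu => ?_⟩
            rcases Sym2.mem_iff.1 hu with rfl | rfl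
            · exact Or.inr hv
            · exact Or.inr hw
        intro e he he'
        obtain ⟨⟨w, hwe, hwJ⟩, -⟩ := hends J hJ e he
        rcases (hends J' hJ' e he').2 w hwe with h | h
        · exact Finset.disjoint_left.1 (hSJ J hJ) h hwJ
        · exact Finset.disjoint_left.1 (hJJ J hJ J' hJ' hne) hwJ h
    · refine Finset.biUnion_subset.2 fun J hJ => Finset.union_subset ?_ (innerPairs_subset J)
      exact crossPairs_subset (hSJ J hJ)
  · refine mul_le_mul_of_nonneg_right ?_ (pow_nonneg (by linarith) _)
    have h1 := Finset.card_filter_le (Finset.powersetCard s₀ (Finset.univ : Finset V) ×ˢ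
      Finset.powersetCard r (Finset.powersetCard j₀ (Finset.univ : Finset V)))
      (fun x => (∀ J ∈ x.2, Disjoint x.1 J) ∧ ∀ J ∈ x.2, ∀ J' ∈ x.2, J ≠ J' → Disjoint J J')
    rw [Finset.card_product, Finset.card_powersetCard, Finset.card_powersetCard,
      Finset.card_powersetCard, Finset.card_univ] at h1
    have h2 := h1.trans (Nat.mul_le_mul_left _ (Nat.choose_le_pow _ r))
    exact_mod_cast h2

/-- The sets of at most `m` vertices. -/
theorem card_small_sets_le (hV : 0 < Fintype.card V) (m : ℕ) :
    ((Finset.univ : Finset (Finset V)).filter fun R => R.card ≤ m).card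
      ≤ (m + 1) * Fintype.card V ^ m := by
  have h : ((Finset.univ : Finset (Finset V)).filter fun R => R.card ≤ m)
      ⊆ (Finset.range (m + 1)).biUnion fun i => Finset.powersetCard i Finset.univ := by
    intro R hR
    simp only [Finset.mem_filter, Finset.mem_univ, true_and] at hR
    simp only [Finset.mem_biUnion, Finset.mem_range, Finset.mem_powersetCard, Finset.subset_univ,
      true_and]
    exact ⟨R.card, by omega, rfl⟩
  refine (Finset.card_le_card h).trans (Finset.card_biUnion_le.trans ?_)
  refine (Finset.sum_le_card_nsmul _ _ (Fintype.card V ^ m) fun i hi => ?_).trans (by simp)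
  rw [Finset.card_powersetCard, Finset.card_univ]
  exact (Nat.choose_le_pow _ _).trans
    (Nat.pow_le_pow_right hV (by have := Finset.mem_range.1 hi; omega))

/-- With high probability, Breaker finds a vertex that spoils a dangerous set. Here `ρ = e^{-l}` is
the parameter of an exponential moment of the number of edges between `T` and `R`. -/
theorem graphMean_spoil_le (hp0 : 0 ≤ p) (hp1 : p ≤ 1) (hV : 0 < Fintype.card V) (s₀ j₀ m t : ℕ)
    (κ l q : ℝ) (hl : 0 ≤ l) (hq : (1 - p + p * Real.exp (-l)) * Real.exp (l * κ) ≤ q)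
    (hq0 : 0 ≤ q) (hq1 : q ≤ 1) :
    graphMean p (Set.indicator {G : SimpleGraph V | ¬ ∀ S R T : Finset V, S.card = s₀ →
        j₀ ≤ R.card → R.card ≤ m → T.card = t → Disjoint S R → Disjoint T S → Disjoint T R →
        (∀ v ∈ T, ∀ w ∈ S, ¬ G.Adj v w) → ∃ v ∈ T, κ * R.card ≤ degIn G R v} 1)
      ≤ (Fintype.card V).choose s₀ * ((m + 1) * (Fintype.card V : ℝ) ^ m)
        * (Fintype.card V).choose t * ((1 - p) ^ (t * s₀) * q ^ (t * j₀)) := by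
  classical
  let f : Finset V × Finset V × Finset V → SimpleGraph V → ℝ := fun x G =>
    Real.exp (l * κ) ^ (x.2.2.card * x.2.1.card) *
      ∏ e ∈ crossPairs x.2.2 x.1 ∪ crossPairs x.2.2 x.2.1,
        if e ∈ G.edgeSet then (if e ∈ crossPairs x.2.2 x.1 then 0 else Real.exp (-l)) else 1
  have hf0 : ∀ x G, 0 ≤ f x G := by
    intro x G
    refine mul_nonneg (pow_nonneg (Real.exp_pos _).le _) (Finset.prod_nonneg fun e _ => ?_)
    split_ifs <;> first | exact le_rfl | exact (Real.exp_pos _).le | exact zero_le_one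
  have hdisj : ∀ S R T : Finset V, Disjoint S R → Disjoint T S → Disjoint T R →
      Disjoint (crossPairs T S) (crossPairs T R) := by
    intro S R T hSR hTS hTR
    rw [Finset.disjoint_left]
    intro e he he'
    obtain ⟨v, hv, w, hw, rfl⟩ := mem_crossPairs.1 he
    obtain ⟨v', hv', w', hw', heq⟩ := mem_crossPairs.1 he'
    rcases Sym2.eq_iff.1 heq with ⟨rfl, rfl⟩ | ⟨rfl, rfl⟩
    · exact Finset.disjoint_left.1 hSR hw hw'
    · exact Finset.disjoint_left.1 hTS hv' hw
  refine (graphMean_indicator_le_card_mul hp0 hp1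
    ((Finset.powersetCard s₀ (Finset.univ : Finset V) ×ˢ
      ((Finset.univ : Finset (Finset V)).filter fun R => R.card ≤ m) ×ˢ
      Finset.powersetCard t (Finset.univ : Finset V)).filter fun x =>
        j₀ ≤ x.2.1.card ∧ Disjoint x.1 x.2.1 ∧ Disjoint x.2.2 x.1 ∧ Disjoint x.2.2 x.2.1)
    f _ ((1 - p) ^ (t * s₀) * q ^ (t * j₀)) (fun x _ G => hf0 x G) ?_ ?_).trans ?_
  · intro G hG
    simp only [Set.mem_ofPred_eq, not_forall] at hG
    obtain ⟨S, R, T, hS, hR, hRm, hT, hSR, hTS, hTR, hno, hfail⟩ := hG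
    push Not at hfail
    refine ⟨(S, R, T), ?_, ?_⟩
    · simp only [Finset.mem_filter, Finset.mem_product, Finset.mem_powersetCard,
        Finset.subset_univ, true_and, Finset.mem_univ]
      exact ⟨⟨hS, hRm, hT⟩, hR, hSR, hTS, hTR⟩
    · have hprod : ∏ e ∈ crossPairs T S ∪ crossPairs T R,
          (if e ∈ G.edgeSet then (if e ∈ crossPairs T S then 0 else Real.exp (-l)) else 1)
          = Real.exp (-l) ^ ∑ v ∈ T, degIn G R v := by
        rw [Finset.prod_union (hdisj S R T hSR hTS hTR)]
        have h1 : ∏ e ∈ crossPairs T S,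
            (if e ∈ G.edgeSet then (if e ∈ crossPairs T S then 0 else Real.exp (-l)) else 1)
            = 1 := by
          refine Finset.prod_eq_one fun e he => ?_
          obtain ⟨v, hv, w, hw, rfl⟩ := mem_crossPairs.1 he
          exact if_neg (hno v hv w hw)
        have h2 : ∀ e ∈ crossPairs T R,
            (if e ∈ G.edgeSet then (if e ∈ crossPairs T S then 0 else Real.exp (-l)) else 1)
            = if e ∈ G.edgeSet then Real.exp (-l) else 1 := by
          intro e he
          rw [if_neg (Finset.disjoint_right.1 (hdisj S R T hSR hTS hTR) he)]
        have hinj : Set.InjOn (fun x : V × V => s(x.1, x.2)) (T ×ˢ R : Finset (V × V)) := by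
          rintro ⟨a, b⟩ hab ⟨a', b'⟩ hab' heq
          simp only [Finset.coe_product, Set.mem_prod, Finset.mem_coe] at hab hab'
          rcases Sym2.eq_iff.1 heq with ⟨rfl, rfl⟩ | ⟨rfl, rfl⟩
          · rfl
          · exact absurd hab'.2 (Finset.disjoint_left.1 hTR hab.1)
        rw [h1, one_mul, Finset.prod_congr rfl h2, crossPairs, Finset.prod_image hinj,
          Finset.prod_product, ← Finset.prod_pow_eq_pow_sum]
        refine Finset.prod_congr rfl fun v _ => ?_
        rw [Finset.prod_ite, Finset.prod_const, Finset.prod_const_one, mul_one, degIn]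
        congr!
      change 1 ≤ Real.exp (l * κ) ^ (T.card * R.card) * _
      rw [hprod, ← Real.exp_nat_mul, ← Real.exp_nat_mul, ← Real.exp_add, Real.one_le_exp_iff]
      have hsum : ((∑ v ∈ T, degIn G R v : ℕ) : ℝ) ≤ T.card * (κ * R.card) := by
        rw [Nat.cast_sum, ← nsmul_eq_mul]
        exact Finset.sum_le_card_nsmul _ _ _ fun v hv => (hfail v hv).le
      have := mul_le_mul_of_nonneg_left hsum hl
      push_cast at this ⊢
      nlinarith
  · rintro ⟨S, R, T⟩ hx
    simp only [Finset.mem_filter, Finset.mem_product, Finset.mem_powersetCard,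
      Finset.subset_univ, true_and, Finset.mem_univ] at hx
    obtain ⟨⟨hS, hRm, hT⟩, hR, hSR, hTS, hTR⟩ := hx
    have hd := hdisj S R T hSR hTS hTR
    rw [graphMean_const_mul, graphMean_prod_ite (p := p) _
      (Finset.union_subset (crossPairs_subset hTS) (crossPairs_subset hTR))
      (fun e => if e ∈ crossPairs T S then 0 else Real.exp (-l)) (fun _ => 1),
      Finset.prod_union hd]
    have h1 : ∏ e ∈ crossPairs T S,
        (p * (if e ∈ crossPairs T S then 0 else Real.exp (-l)) + (1 - p) * 1)
        = (1 - p) ^ (t * s₀) := by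
      rw [Finset.prod_congr rfl (g := fun _ => 1 - p) fun e he => by simp [he], Finset.prod_const,
        card_crossPairs hTS, hT, hS]
    have h2 : ∏ e ∈ crossPairs T R,
        (p * (if e ∈ crossPairs T S then 0 else Real.exp (-l)) + (1 - p) * 1)
        = (1 - p + p * Real.exp (-l)) ^ (t * R.card) := by
      rw [Finset.prod_congr rfl (g := fun _ => 1 - p + p * Real.exp (-l)) fun e he => by
        rw [if_neg (Finset.disjoint_right.1 hd he)]; ring, Finset.prod_const,
        card_crossPairs hTR, hT]
    rw [h1, h2, hT]
    calc Real.exp (l * κ) ^ (t * R.card) *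
          ((1 - p) ^ (t * s₀) * (1 - p + p * Real.exp (-l)) ^ (t * R.card))
        = (1 - p) ^ (t * s₀) *
          ((1 - p + p * Real.exp (-l)) * Real.exp (l * κ)) ^ (t * R.card) := by
          rw [mul_pow]; ring
      _ ≤ (1 - p) ^ (t * s₀) * q ^ (t * R.card) := by
          refine mul_le_mul_of_nonneg_left (pow_le_pow_left₀ ?_ hq _) (pow_nonneg (by linarith) _)
          have := mul_nonneg hp0 (Real.exp_pos (-l)).le
          exact mul_nonneg (by linarith) (Real.exp_pos _).le
      _ ≤ (1 - p) ^ (t * s₀) * q ^ (t * j₀) := by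
          refine mul_le_mul_of_nonneg_left ?_ (pow_nonneg (by linarith) _)
          exact pow_le_pow_of_le_one hq0 hq1 (Nat.mul_le_mul_left _ hR)
  · refine mul_le_mul_of_nonneg_right ?_
      (mul_nonneg (pow_nonneg (by linarith) _) (pow_nonneg hq0 _))
    have h1 := Finset.card_filter_le (Finset.powersetCard s₀ (Finset.univ : Finset V) ×ˢ
      ((Finset.univ : Finset (Finset V)).filter fun R => R.card ≤ m) ×ˢ
      Finset.powersetCard t (Finset.univ : Finset V)) (fun x =>
        j₀ ≤ x.2.1.card ∧ Disjoint x.1 x.2.1 ∧ Disjoint x.2.2 x.1 ∧ Disjoint x.2.2 x.2.1)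
    rw [Finset.card_product, Finset.card_product, Finset.card_powersetCard,
      Finset.card_powersetCard, Finset.card_univ, ← mul_assoc] at h1
    have h2 := h1.trans (Nat.mul_le_mul_right _ (Nat.mul_le_mul_left _ (card_small_sets_le hV m)))
    exact_mod_cast h2

/-- Small sets contain few vertices of high inner degree, with high probability. -/
theorem graphMean_highDeg_le (hp0 : 0 ≤ p) (hp1 : p ≤ 1) (σ q : ℕ) (hq : 0 < q)
    (hσ : σ < Fintype.card V)
    (hbound : ∀ s : ℕ, 1 ≤ s → s ≤ σ → (Real.exp 1 * s * p / (2 * q)) ^ q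
      ≤ (s / (Real.exp 1 * Fintype.card V)) ^ 4) :
    graphMean p (Set.indicator {G : SimpleGraph V | ¬ ∀ S : Finset V, S.card ≤ σ →
        8 * (highDeg G (16 * q) S).card ≤ S.card} 1)
      ≤ 1 / (Fintype.card V : ℝ) ^ 2 := by
  classical
  set n := Fintype.card V with hn
  have hn0 : (0 : ℝ) < n := by exact_mod_cast (Nat.zero_le σ).trans_lt hσ
  have he : (0 : ℝ) < Real.exp 1 := Real.exp_pos 1
  refine (graphMean_indicator_le_sum hp0 hp1
    ((Finset.Icc 1 σ).sigma fun s => (Finset.powersetCard s (Finset.univ : Finset V)).sigma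
      fun S => Finset.powersetCard (q * s) (innerPairs S))
    (fun x => Set.indicator {G | ∀ e ∈ x.2.2, e ∈ G.edgeSet} 1) _
    (fun _ _ _ => indicator_one_nonneg _ _) ?_).trans ?_
  · intro G hG
    simp only [Set.mem_ofPred_eq, not_forall, not_le] at hG
    obtain ⟨S, hS, hhigh⟩ := hG
    obtain ⟨F, hF, hFc, hFG⟩ := card_edges_ge_of_highDeg hhigh
    refine ⟨⟨S.card, S, F⟩, ?_, one_le_indicator hFG⟩
    simp only [Finset.mem_sigma, Finset.mem_Icc, Finset.mem_powersetCard]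
    refine ⟨⟨?_, hS⟩, ⟨Finset.subset_univ _, trivial⟩, hF, hFc⟩
    by_contra h0
    have : S = ∅ := by
      rw [← Finset.card_eq_zero]
      omega
    subst this
    simp [highDeg] at hhigh
  · rw [Finset.sum_sigma]
    have hterm : ∀ s ∈ Finset.Icc 1 σ,
        ∑ x ∈ (Finset.powersetCard s (Finset.univ : Finset V)).sigma
          (fun S => Finset.powersetCard (q * s) (innerPairs S)),
          graphMean p (Set.indicator {G | ∀ e ∈ x.2, e ∈ G.edgeSet} 1) ≤ 1 / (n : ℝ) ^ 3 := by
      intro s hs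
      obtain ⟨hs1, hsσ⟩ := Finset.mem_Icc.1 hs
      have hs0 : (0 : ℝ) < s := by exact_mod_cast hs1
      have hq0 : (0 : ℝ) < q := by exact_mod_cast hq
      rw [Finset.sum_sigma]
      have hS : ∀ S ∈ Finset.powersetCard s (Finset.univ : Finset V),
          ∑ F ∈ Finset.powersetCard (q * s) (innerPairs S),
            graphMean p (Set.indicator {G : SimpleGraph V | ∀ e ∈ F, e ∈ G.edgeSet} 1)
          ≤ ((Real.exp 1 * s * p / (2 * q)) ^ q) ^ s := by
        intro S hS
        have hSc := (Finset.mem_powersetCard.1 hS).2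
        have h1 : ∀ F ∈ Finset.powersetCard (q * s) (innerPairs S),
            graphMean p (Set.indicator {G : SimpleGraph V | ∀ e ∈ F, e ∈ G.edgeSet} 1)
              = p ^ (q * s) := by
          intro F hF
          obtain ⟨hF1, hF2⟩ := Finset.mem_powersetCard.1 hF
          rw [graphMean_all_edge F (hF1.trans (innerPairs_subset S)), hF2]
        rw [Finset.sum_congr rfl h1, Finset.sum_const, Finset.card_powersetCard, card_innerPairs,
          hSc, nsmul_eq_mul, ← pow_mul]
        have h2 := choose_le_exp_mul_div_pow (s.choose 2) (q * s)
        have h3 : ((s.choose 2 : ℕ) : ℝ) ≤ s * s / 2 := by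
          rw [Nat.cast_choose_two]
          nlinarith
        calc ((s.choose 2).choose (q * s) : ℝ) * p ^ (q * s)
            ≤ (Real.exp 1 * (s.choose 2 : ℕ) / (q * s : ℕ)) ^ (q * s) * p ^ (q * s) := by gcongr
          _ = (Real.exp 1 * (s.choose 2 : ℕ) / (q * s : ℕ) * p) ^ (q * s) := by rw [mul_pow]
          _ ≤ (Real.exp 1 * s * p / (2 * q)) ^ (q * s) := by
              refine pow_le_pow_left₀ (by positivity) ?_ _
              calc Real.exp 1 * (s.choose 2 : ℕ) / (q * s : ℕ) * p
                  ≤ Real.exp 1 * (s * s / 2) / (q * s : ℕ) * p := by gcongr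
                _ = Real.exp 1 * s * p / (2 * q) := by
                    push_cast
                    field_simp
      refine (Finset.sum_le_card_nsmul _ _ _ hS).trans ?_
      rw [Finset.card_powersetCard, Finset.card_univ, ← hn, nsmul_eq_mul]
      have hch : (n : ℝ) ≤ n.choose s := by
        exact_mod_cast self_le_choose hs1 (by omega)
      have hch2 := choose_le_exp_mul_div_pow n s
      set y := (Real.exp 1 * n / s) ^ s with hy
      have hy0 : 0 < y := by positivity
      have hny : (n : ℝ) ≤ y := hch.trans hch2
      have hb := pow_le_pow_left₀ (by positivity) (hbound s hs1 hsσ) s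
      have hb2 : (((s : ℝ) / (Real.exp 1 * n)) ^ 4) ^ s = 1 / y ^ 4 := by
        rw [hy, ← pow_mul, ← pow_mul, mul_comm 4 s, one_div, ← inv_pow, inv_div]
      rw [hb2] at hb
      calc (n.choose s : ℝ) * ((Real.exp 1 * s * p / (2 * q)) ^ q) ^ s
          ≤ y * (1 / y ^ 4) := by gcongr
        _ = 1 / y ^ 3 := by field_simp
        _ ≤ 1 / (n : ℝ) ^ 3 := by gcongr
    refine (Finset.sum_le_card_nsmul _ _ _ hterm).trans ?_
    rw [Nat.card_Icc, nsmul_eq_mul]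
    have hσn : ((σ + 1 - 1 : ℕ) : ℝ) ≤ n := by
      rw [Nat.add_sub_cancel]
      exact_mod_cast hσ.le
    calc ((σ + 1 - 1 : ℕ) : ℝ) * (1 / (n : ℝ) ^ 3) ≤ n * (1 / (n : ℝ) ^ 3) := by gcongr
      _ = 1 / (n : ℝ) ^ 2 := by field_simp

end UnionBounds

/-! ### Maker's strategy on the random graph -/

theorem one_sub_pow_eq_exp {p : ℝ} (hp1 : p < 1) (s : ℕ) :
    (1 - p) ^ s = Real.exp (-(-Real.log (1 - p) * s)) := by
  rw [neg_mul, neg_neg, mul_comm, Real.exp_nat_mul, Real.exp_log (by linarith)]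

theorem le_neg_log_one_sub {p : ℝ} (hp1 : p < 1) : p ≤ -Real.log (1 - p) := by
  have := Real.log_le_sub_one_of_pos (show 0 < 1 - p by linarith)
  linarith

theorem neg_log_one_sub_le {p η : ℝ} (hη : 0 < η) (hp0 : 0 ≤ p) (hp : p ≤ 1 - η) :
    -Real.log (1 - p) ≤ p / η := by
  have h1 : 0 < 1 - p := by linarith
  have := Real.log_le_sub_one_of_pos (inv_pos.2 h1)
  rw [Real.log_inv] at this
  refine this.trans ?_
  have h2 : (1 - p)⁻¹ - 1 = p / (1 - p) := by
    field_simp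
    ring
  rw [h2]
  exact div_le_div_of_nonneg_left hp0 hη (by linarith)

/-- By convexity, the expected number of available colours is least for equal colour classes. -/
theorem le_sum_pow_card_colorClass {V : Type*} [Fintype V] {p : ℝ} (hp0 : 0 ≤ p) (hp1 : p < 1)
    {k : ℕ} (hk : 0 < k) (c : PartialColoring V k) :
    k * Real.exp (-(-Real.log (1 - p) * Fintype.card V / k))
      ≤ ∑ i : Fin k, (1 - p) ^ (colorClass c i).card := by
  set a := -Real.log (1 - p) with ha
  have ha0 : 0 ≤ a := hp0.trans (le_neg_log_one_sub hp1)
  have hk' : (0 : ℝ) < k := by exact_mod_cast hk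
  set y := -(a * Fintype.card V / k) with hy
  -- The tangent line of the exponential at the mean.
  have htan : ∀ i : Fin k, Real.exp y * (1 + (-(a * (colorClass c i).card) - y))
      ≤ (1 - p) ^ (colorClass c i).card := by
    intro i
    rw [one_sub_pow_eq_exp hp1, ← ha]
    have h := Real.add_one_le_exp (-(a * (colorClass c i).card) - y)
    calc Real.exp y * (1 + (-(a * (colorClass c i).card) - y))
        ≤ Real.exp y * Real.exp (-(a * (colorClass c i).card) - y) :=
          mul_le_mul_of_nonneg_left (by linarith) (Real.exp_pos _).le
      _ = _ := by rw [← Real.exp_add]; congr 1; ring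
  refine le_trans ?_ (Finset.sum_le_sum fun i _ => htan i)
  rw [← Finset.mul_sum]
  have hsum : (∑ i : Fin k, (colorClass c i).card : ℝ) ≤ Fintype.card V := by
    have h := card_colored_eq_sum c
    have h' : ∑ i : Fin k, (colorClass c i).card ≤ Fintype.card V := by omega
    exact_mod_cast h'
  have hval : (k : ℝ) ≤ ∑ i : Fin k, (1 + (-(a * (colorClass c i).card) - y)) := by
    rw [Finset.sum_add_distrib, Finset.sum_sub_distrib, Finset.sum_neg_distrib, ← Finset.mul_sum]
    simp only [Finset.sum_const, Finset.card_univ, Fintype.card_fin, nsmul_eq_mul, mul_one]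
    have hyk : (k : ℝ) * y = -(a * Fintype.card V) := by
      rw [hy]
      field_simp
    have := mul_le_mul_of_nonneg_left hsum ha0
    linarith
  rw [mul_comm]
  exact mul_le_mul_of_nonneg_left hval (Real.exp_pos _).le

theorem three_quarters_pow_le (N : ℕ) : (3 / 4 : ℝ) ^ N ≤ Real.exp (-(N / 4)) := by
  have h : (3 / 4 : ℝ) ≤ Real.exp (-(1 / 4)) := by
    have := Real.add_one_le_exp (-(1 / 4 : ℝ))
    linarith
  calc (3 / 4 : ℝ) ^ N ≤ Real.exp (-(1 / 4)) ^ N := pow_le_pow_left₀ (by norm_num) h N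
    _ = _ := by rw [← Real.exp_nat_mul]; congr 1; ring

theorem logb_one_div_one_sub (p x : ℝ) :
    Real.logb (1 / (1 - p)) x = Real.log x / -Real.log (1 - p) := by
  rw [Real.logb, one_div, Real.log_inv]

theorem eventually_const_mul_log_le_rpow (C : ℝ) {s : ℝ} (hs : 0 < s) :
    ∀ᶠ x : ℝ in atTop, C * Real.log x ≤ x ^ s := by
  have h := (isLittleO_log_rpow_atTop hs).bound (show (0 : ℝ) < 1 / (|C| + 1) by positivity)
  filter_upwards [h, eventually_ge_atTop 1] with x hx hx1
  have hl : 0 ≤ Real.log x := Real.log_nonneg hx1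
  have hxs : 0 ≤ x ^ s := Real.rpow_nonneg (by linarith) s
  rw [Real.norm_of_nonneg hl, Real.norm_of_nonneg hxs, one_div, inv_mul_eq_div,
    le_div_iff₀ (by positivity)] at hx
  nlinarith [le_abs_self C]

/-- On a graph where the three pseudorandomness events hold, Maker wins. -/
theorem makerHasWinningStrategy_of_pseudorandom {V : Type*} [Fintype V] [DecidableEq V]
    {G : SimpleGraph V} {k m σ₀ σ₁ θ₀ q₁ N₁ N₂ : ℕ}
    (hlow : ∀ (c : PartialColoring V k) (B : Finset V), B.card = m → (∀ v ∈ B, c v = none) →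
      ∃ v ∈ B, θ₀ ≤ avail G c v)
    (h₀ : ∀ S : Finset V, S.card ≤ σ₀ → 8 * (highDeg G (16 * q₁) S).card ≤ S.card)
    (h₁ : ∀ S : Finset V, S.card ≤ σ₁ → 8 * (highDeg G (16 * 8) S).card ≤ S.card)
    (hmσ : 4 * m + 4 ≤ σ₀)
    (hN₁ : ((3 : ℝ) / 4) ^ N₁ * σ₀ ≤ max 4 (σ₁ : ℝ))
    (hN₂ : ((3 : ℝ) / 4) ^ N₂ * max 4 (σ₁ : ℝ) ≤ 4)
    (hbudget : 16 * q₁ * (N₁ + 1) + 16 * 8 * N₂ + 5 ≤ θ₀) (hk : θ₀ ≤ k) :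
    MakerHasWinningStrategy G k := by
  -- Sets of at most four vertices contain no vertices of degree `128`.
  have h₁' : ∀ S : Finset V, S.card ≤ max 4 σ₁ → 8 * (highDeg G (16 * 8) S).card ≤ S.card := by
    intro S hS
    rcases le_max_iff.1 hS with h | h
    · have : highDeg G (16 * 8) S = ∅ := by
        rw [highDeg, Finset.filter_eq_empty_iff]
        intro v _ hv
        have := degIn_le_card (G := G) S v
        omega
      simp [this]
    · exact h₁ S h
  refine makerHasWinningStrategy_of_avail_pos fun c b hb hc v hv => ?_
  exact avail_pos_of_fewestHistory hlow h₀ h₁' hmσ (le_max_left _ _) (by push_cast; exact hN₁)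
    (by push_cast; exact hN₂) hbudget hk hb hc v hv

/-- The number of colours in terms of `x = n p`, and the expected number of available colours at an
uncoloured vertex: if `x ^ (1 - 1 / α) = u`, it is of order `u / log x`. -/
theorem color_count_bounds {α η p x ℓ a n u β : ℝ} {k : ℕ} (hα : 2 < α) (hη : 0 < η)
    (hp0 : 0 < p) (hx : x = n * p) (hn : 0 < n) (hℓ : ℓ = Real.log x) (hℓ1 : 1 ≤ ℓ)
    (hℓη : 8 * α / η ≤ ℓ) (hap : p ≤ a) (haη : a ≤ p / η) (hxℓ : 4 * ℓ ≤ x / ℓ)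
    (hk : k = ⌊α * (n / (ℓ / a))⌋₊) (hu : u = x ^ (1 - 1 / α)) (hβ : 3 * ℓ * β ≤ u)
    (hβ0 : 0 ≤ β) :
    0 < k ∧ 2 * ((k : ℝ) + 1) ≤ x ∧ β ≤ k * Real.exp (-(a * n / k)) := by
  have hx0 : 0 < x := by rw [hx]; positivity
  have hℓ0 : 0 < ℓ := by linarith
  have ha0 : 0 < a := by linarith
  set Y : ℝ := α * (n / (ℓ / a)) with hY
  have hYeq : Y = α * n * a / ℓ := by
    rw [hY]
    field_simp
  have hYlow : 2 * (x / ℓ) ≤ Y := by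
    rw [hYeq, ← mul_div_assoc]
    refine div_le_div_of_nonneg_right ?_ hℓ0.le
    have h1 : n * p ≤ n * a := mul_le_mul_of_nonneg_left hap hn.le
    have h2 : 2 * (n * a) ≤ α * (n * a) := mul_le_mul_of_nonneg_right hα.le (by positivity)
    linarith
  have hYup : Y ≤ x / 8 := by
    have h1 : a * η ≤ p := by rwa [le_div_iff₀ hη] at haη
    have h2 : 8 * α ≤ ℓ * η := by rwa [div_le_iff₀ hη] at hℓη
    rw [hYeq, div_le_div_iff₀ hℓ0 (by norm_num), hx]
    have h3 : 8 * α * (n * a) ≤ ℓ * η * (n * a) := mul_le_mul_of_nonneg_right h2 (by positivity)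
    have h4 : ℓ * n * (a * η) ≤ ℓ * n * p := mul_le_mul_of_nonneg_left h1 (by positivity)
    linarith
  have hY0 : 0 ≤ Y := by linarith [div_pos hx0 hℓ0]
  have hkY : (k : ℝ) ≤ Y := by rw [hk]; exact Nat.floor_le hY0
  have hkY' : Y ≤ k + 1 := by rw [hk]; exact (Nat.lt_floor_add_one Y).le
  have hkx : x / ℓ ≤ k := by linarith
  have hkpos : (0 : ℝ) < k := by linarith
  refine ⟨by exact_mod_cast hkpos, by linarith, ?_⟩
  have h1 : a * n / k ≤ ℓ * (1 / α) + 1 := by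
    have h2 : a * n = Y * (ℓ * (1 / α)) := by
      rw [hYeq]
      field_simp
    have hα1 : 1 / α ≤ 1 := by
      rw [div_le_one (by linarith)]
      linarith
    have hc : ℓ * (1 / α) ≤ ℓ := mul_le_of_le_one_right hℓ0.le hα1
    have hc0 : 0 ≤ ℓ * (1 / α) := by positivity
    rw [div_le_iff₀ hkpos, h2]
    have h3 : Y * (ℓ * (1 / α)) ≤ (k + 1) * (ℓ * (1 / α)) := mul_le_mul_of_nonneg_right hkY' hc0
    linarith
  have h6 : Real.exp (-(ℓ * (1 / α) + 1)) = u / x / Real.exp 1 := by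
    rw [hu, Real.rpow_sub hx0, Real.rpow_one, neg_add, Real.exp_add, Real.exp_neg 1,
      Real.rpow_def_of_pos hx0, ← hℓ, Real.exp_neg]
    field_simp
  calc β ≤ (x / ℓ) * (u / x / Real.exp 1) := by
        have he : Real.exp 1 ≤ 3 := by linarith [Real.exp_one_lt_d9]
        have h7 : x / ℓ * (u / x / Real.exp 1) = u / (ℓ * Real.exp 1) := by field_simp
        rw [h7, le_div_iff₀ (by positivity)]
        have : β * (ℓ * Real.exp 1) ≤ β * (ℓ * 3) := by gcongr
        linarith
    _ ≤ k * Real.exp (-(a * n / k)) := by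
        rw [← h6]
        exact mul_le_mul hkx (Real.exp_le_exp.2 (by linarith)) (Real.exp_pos _).le hkpos.le

/-- A high degree threshold beats the union bound over all vertex sets. -/
theorem highDeg_bound_of_log_le {n p s : ℝ} {q : ℕ} (hn : 0 < n) (hp : 0 ≤ p) (hs : 1 ≤ s)
    (hq : 0 < q) (hps : p * s ≤ q / 10) (hlog : 4 + 4 * Real.log n ≤ q) :
    (Real.exp 1 * s * p / (2 * q)) ^ q ≤ (s / (Real.exp 1 * n)) ^ 4 := by
  have hq0 : (0 : ℝ) < q := by exact_mod_cast hq
  have he1 := Real.exp_one_lt_d9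
  have he0 := Real.exp_pos 1
  have hbase : Real.exp 1 * s * p / (2 * q) ≤ Real.exp (-1) := by
    rw [div_le_iff₀ (by positivity), Real.exp_neg, inv_mul_eq_div, le_div_iff₀ he0]
    have h1 : Real.exp 1 * Real.exp 1 ≤ 3 * 3 := by gcongr <;> linarith
    have h2 : Real.exp 1 * Real.exp 1 * (p * s) ≤ 3 * 3 * (q / 10) := by gcongr
    linarith
  calc (Real.exp 1 * s * p / (2 * q)) ^ q ≤ Real.exp (-1) ^ q :=
        pow_le_pow_left₀ (by positivity) hbase _
    _ = Real.exp (-q) := by rw [← Real.exp_nat_mul]; congr 1; ring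
    _ ≤ Real.exp (-(4 + 4 * Real.log n)) := Real.exp_le_exp.2 (by linarith)
    _ = (1 / (Real.exp 1 * n)) ^ 4 := by
        have : -(4 + 4 * Real.log n) = (4 : ℕ) * (-(1 + Real.log n)) := by push_cast; ring
        rw [this, Real.exp_nat_mul, Real.exp_neg, Real.exp_add, Real.exp_log hn, one_div]
    _ ≤ (s / (Real.exp 1 * n)) ^ 4 := by gcongr

/-- Sets of at most `n / x ^ 3` vertices are so sparse that a constant threshold suffices. -/
theorem highDeg_bound_of_le_div_cube {n p x s : ℝ} (hn : 0 < n) (hx : x = n * p) (hx1 : 1 ≤ x)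
    (hs : 0 ≤ s) (hsn : s ≤ n / x ^ 3) :
    (Real.exp 1 * s * p / (2 * (8 : ℕ))) ^ 8 ≤ (s / (Real.exp 1 * n)) ^ 4 := by
  have he1 := Real.exp_one_lt_d9
  have he0 := Real.exp_pos 1
  have hx0 : 0 < x := by linarith
  have hsq : (Real.exp 1 * s * p / (2 * (8 : ℕ))) ^ 2 ≤ s / (Real.exp 1 * n) := by
    have hp : p = x / n := by rw [hx]; field_simp
    have h1 : (Real.exp 1 * s * (x / n) / (2 * (8 : ℕ))) ^ 2
        = s / (Real.exp 1 * n) * (Real.exp 1 ^ 3 / 256 * (s * x ^ 2 / n)) := by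
      push_cast
      field_simp
      ring
    rw [hp, h1]
    refine mul_le_of_le_one_right (by positivity) ?_
    have h2 : s * x ^ 2 / n ≤ 1 := by
      rw [div_le_one hn]
      rw [le_div_iff₀ (by positivity)] at hsn
      have h4 : x ^ 2 ≤ x ^ 3 := pow_le_pow_right₀ hx1 (by norm_num)
      have h5 : s * x ^ 2 ≤ s * x ^ 3 := mul_le_mul_of_nonneg_left h4 hs
      linarith
    have h5 : Real.exp 1 ^ 3 / 256 ≤ 1 := by
      have : Real.exp 1 ^ 3 ≤ 3 ^ 3 := pow_le_pow_left₀ he0.le (by linarith) 3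
      linarith
    exact mul_le_one₀ h5 (by positivity) h2
  have h8 := pow_le_pow_left₀ (by positivity) hsq 4
  rwa [← pow_mul] at h8

/-- Stages that reduce `σ₀ ≤ n` to `max 4 ⌊n / x ^ 3⌋`, and this to `4`. -/
theorem stages_suffice {n x ℓ : ℝ} {σ₀ σ₁ N₁ N₂ : ℕ} (hn : 4 ≤ n) (hx2 : 2 ≤ x)
    (hℓ : ℓ = Real.log x) (hσ₀ : (σ₀ : ℝ) ≤ n) (hσ₁ : σ₁ = ⌊n / x ^ 3⌋₊) (hN₁ : 16 * ℓ ≤ N₁)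
    (hN₂ : 4 * Real.log n ≤ N₂) :
    ((3 : ℝ) / 4) ^ N₁ * σ₀ ≤ max 4 (σ₁ : ℝ) ∧ ((3 : ℝ) / 4) ^ N₂ * max 4 (σ₁ : ℝ) ≤ 4 := by
  have hx0 : 0 < x := by linarith
  have hn0 : 0 < n := by linarith
  constructor
  · have hlow : n / (2 * x ^ 3) ≤ max 4 (σ₁ : ℝ) := by
      have h1 : n / x ^ 3 ≤ σ₁ + 1 := by rw [hσ₁]; exact (Nat.lt_floor_add_one _).le
      have h2 : n / (2 * x ^ 3) = n / x ^ 3 / 2 := by field_simp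
      rw [h2]
      rcases le_total (σ₁ : ℝ) 4 with h | h
      · exact le_max_of_le_left (by linarith)
      · exact le_max_of_le_right (by linarith)
    have h1 : ((3 : ℝ) / 4) ^ N₁ ≤ 1 / x ^ 4 := by
      refine (three_quarters_pow_le N₁).trans ?_
      calc Real.exp (-(N₁ / 4)) ≤ Real.exp (-(4 * ℓ)) := Real.exp_le_exp.2 (by linarith)
        _ = 1 / x ^ 4 := by
          have h : Real.exp ((4 : ℕ) * ℓ) = x ^ 4 := by rw [Real.exp_nat_mul, hℓ, Real.exp_log hx0]
          rw [Real.exp_neg, one_div, ← h]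
          norm_num
    calc ((3 : ℝ) / 4) ^ N₁ * σ₀ ≤ 1 / x ^ 4 * n := by gcongr
      _ ≤ n / (2 * x ^ 3) := by
        rw [one_div_mul_eq_div]
        refine div_le_div_of_nonneg_left hn0.le (by positivity) ?_
        have h3 : x ^ 4 = x * x ^ 3 := by ring
        rw [h3]
        gcongr
      _ ≤ _ := hlow
  · have h1 : ((3 : ℝ) / 4) ^ N₂ ≤ 1 / n := by
      refine (three_quarters_pow_le N₂).trans ?_
      calc Real.exp (-(N₂ / 4)) ≤ Real.exp (-Real.log n) := Real.exp_le_exp.2 (by linarith)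
        _ = 1 / n := by rw [Real.exp_neg, Real.exp_log hn0, one_div]
    have h2 : max 4 (σ₁ : ℝ) ≤ n := by
      refine max_le hn ?_
      have h3 : (σ₁ : ℝ) ≤ n / x ^ 3 := by rw [hσ₁]; exact Nat.floor_le (by positivity)
      exact h3.trans (div_le_self hn0.le (one_le_pow₀ (by linarith)))
    calc ((3 : ℝ) / 4) ^ N₂ * max 4 (σ₁ : ℝ) ≤ 1 / n * n := by gcongr
      _ ≤ 4 := by rw [one_div_mul_cancel hn0.ne']; norm_num

/-- The threshold `β / 2` for the number of available colours outlasts all stages. -/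
theorem stages_budget {w z ℓ β lg : ℝ} {q₁ N₁ N₂ : ℕ} (hℓ1 : 1 ≤ ℓ) (hz : 100000 * ℓ ≤ z)
    (hw1 : 1 ≤ w) (hlg : lg ≤ w) (hlg0 : 0 ≤ lg) (hβ : β = w * z ^ 4) (hq₁ : q₁ = ⌈w * z ^ 2⌉₊)
    (hN₁ : N₁ = ⌈16 * ℓ⌉₊) (hN₂ : N₂ = ⌈4 * lg⌉₊) :
    16 * q₁ * (N₁ + 1) + 16 * 8 * N₂ + 5 ≤ ⌊β / 2⌋₊ := by
  have hz1 : 1 ≤ z := by linarith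
  have hz2 : z ≤ z ^ 2 := le_self_pow₀ hz1 (by norm_num)
  have hwz1 : 1 ≤ w * z ^ 2 := one_le_mul_of_one_le_of_one_le hw1 (by linarith)
  have hwz0 : 0 ≤ w * z ^ 2 := by linarith
  apply Nat.le_floor
  push_cast
  have h1 : (q₁ : ℝ) ≤ 2 * (w * z ^ 2) := by
    have : (q₁ : ℝ) < w * z ^ 2 + 1 := by rw [hq₁]; exact Nat.ceil_lt_add_one hwz0
    linarith
  have h2 : (N₁ : ℝ) + 1 ≤ 18 * ℓ := by
    have : (N₁ : ℝ) < 16 * ℓ + 1 := by rw [hN₁]; exact Nat.ceil_lt_add_one (by positivity)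
    linarith
  have h3 : (q₁ : ℝ) * (N₁ + 1) ≤ (2 * (w * z ^ 2)) * (18 * ℓ) := by gcongr
  have h4 : (N₂ : ℝ) ≤ 5 * w := by
    have : (N₂ : ℝ) < 4 * lg + 1 := by rw [hN₂]; exact Nat.ceil_lt_add_one (by positivity)
    linarith
  have h5 : (w * z ^ 2) * (ℓ * 100000) ≤ (w * z ^ 2) * z ^ 2 :=
    mul_le_mul_of_nonneg_left (by linarith) hwz0
  have h7 : (w * z ^ 2) * 100000 ≤ (w * z ^ 2) * z ^ 2 :=
    mul_le_mul_of_nonneg_left (by linarith) hwz0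
  have h8 : (w * z ^ 2) * z ^ 2 = β := by rw [hβ]; ring
  have h9 : w ≤ w * z ^ 2 := le_mul_of_one_le_right (by linarith) (by linarith)
  rw [h8] at h5 h7
  linarith

/-- In the binomial random graph with `x = n p` large and `log n ≤ √x`, Maker wins with
`⌊α n / log_b x⌋` colours, except with probability at most `3 / x`. -/
theorem exists_threshold_maker {α η : ℝ} (hα : 2 < α) (hη : 0 < η) :
    ∃ X₀ : ℝ, ∀ (n : ℕ) (p : ℝ), 0 < p → p ≤ 1 - η → X₀ ≤ n * p →
      Real.log n ≤ (n * p) ^ (1 / 2 : ℝ) →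
      graphMean p (Set.indicator {G : SimpleGraph (Fin n) |
        ¬ MakerHasWinningStrategy G ⌊α * (n / Real.logb (1 / (1 - p)) (n * p))⌋₊} 1)
        ≤ 3 / (n * p) := by
  set δ : ℝ := (1 / 2 - 1 / α) / 8 with hδ
  have hα1 : 1 / α < 1 / 2 := one_div_lt_one_div_of_lt (by norm_num) hα
  have hα0 : 0 < 1 / α := by positivity
  have hδ0 : 0 < δ := by rw [hδ]; linarith
  obtain ⟨X₀, hX₀⟩ := eventually_atTop.1
    ((Real.tendsto_log_atTop.eventually_ge_atTop (1 + 8 * α / η)).and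
      ((eventually_const_mul_log_le_rpow 100000 hδ0).and (eventually_ge_atTop 1)))
  refine ⟨X₀, fun n p hp0 hpη hx hlogn => ?_⟩
  obtain ⟨hℓA, hz, hx1⟩ := hX₀ _ hx
  have hp1 : p < 1 := by linarith
  rw [logb_one_div_one_sub]
  obtain ⟨x, hxdef⟩ : ∃ x : ℝ, x = n * p := ⟨_, rfl⟩
  rw [← hxdef] at hx hlogn hℓA hz hx1 ⊢
  obtain ⟨ℓ, hℓ⟩ : ∃ ℓ, ℓ = Real.log x := ⟨_, rfl⟩
  obtain ⟨w, hw⟩ : ∃ w, w = x ^ (1 / 2 : ℝ) := ⟨_, rfl⟩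
  obtain ⟨z, hzdef⟩ : ∃ z, z = x ^ δ := ⟨_, rfl⟩
  obtain ⟨a, ha⟩ : ∃ a, a = -Real.log (1 - p) := ⟨_, rfl⟩
  rw [← ha]
  rw [← hw] at hlogn
  rw [← hzdef] at hz
  rw [← hℓ] at hℓA hz ⊢
  have hx0 : 0 < x := by linarith
  have hαη : 0 ≤ 8 * α / η := by positivity
  have hℓ1 : 1 ≤ ℓ := by linarith
  have hw0 : 0 < w := by rw [hw]; exact Real.rpow_pos_of_pos hx0 _
  have hzw : z ≤ w := by
    rw [hw, hzdef]
    exact Real.rpow_le_rpow_of_exponent_le hx1 (by rw [hδ]; linarith)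
  have hxw : x = w * w := by
    rw [hw, ← Real.rpow_add hx0]
    norm_num
  have hz0 : 0 < z := by linarith
  have hw1 : 1 ≤ w := by linarith
  have hwx : w ≤ x := by rw [hxw]; exact le_mul_of_one_le_left hw0.le hw1
  have hn0 : (0 : ℝ) < n := by
    rcases Nat.eq_zero_or_pos n with rfl | h
    · rw [hxdef] at hx0
      simp at hx0
    · exact_mod_cast h
  have hxn : x ≤ n := by
    rw [hxdef]
    exact mul_le_of_le_one_right hn0.le hp1.le
  have hnx : (100000 : ℝ) ≤ n := by linarith
  have hap : p ≤ a := by rw [ha]; exact le_neg_log_one_sub hp1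
  have hapη : a ≤ p / η := by rw [ha]; exact neg_log_one_sub_le hη hp0.le hpη
  have hz4 : z ≤ z ^ 4 := le_self_pow₀ (by linarith) (by norm_num)
  have hz2 : z ≤ z ^ 2 := le_self_pow₀ (by linarith) (by norm_num)
  obtain ⟨β, hβ⟩ : ∃ β, β = w * z ^ 4 := ⟨_, rfl⟩
  have hzβ : z ≤ β := by
    rw [hβ]
    exact hz4.trans (le_mul_of_one_le_left (by positivity) hw1)
  have hβ0 : 0 < β := by linarith
  obtain ⟨k, hk⟩ : ∃ k, k = ⌊α * (n / (ℓ / a))⌋₊ := ⟨_, rfl⟩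
  rw [← hk]
  obtain ⟨hkpos, hkx, hmean⟩ := color_count_bounds (u := w * z ^ 8) (β := β) hα hη hp0 hxdef hn0
    hℓ hℓ1 (by linarith) hap hapη
    (by
      rw [le_div_iff₀ (by linarith), hxw]
      have : 4 * ℓ * ℓ ≤ z * z := mul_le_mul (by linarith) (by linarith) (by linarith) hz0.le
      exact this.trans (mul_le_mul hzw hzw hz0.le hw0.le)) hk
    (by
      rw [hw, hzdef, ← Real.rpow_natCast, ← Real.rpow_mul hx0.le, ← Real.rpow_add hx0]
      congr 1
      rw [hδ]
      push_cast
      ring)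
    (by
      have h1 : 3 * ℓ * (w * z ^ 4) ≤ z ^ 4 * (w * z ^ 4) :=
        mul_le_mul_of_nonneg_right (by linarith) (by positivity)
      rw [hβ]
      refine h1.trans (le_of_eq ?_)
      ring) hβ0.le
  have hβk : β ≤ k := by
    refine hmean.trans (mul_le_of_le_one_right (Nat.cast_nonneg k) ?_)
    rw [Real.exp_le_one_iff, neg_nonpos]
    have : 0 ≤ a := by linarith
    positivity
  obtain ⟨m, hm⟩ : ∃ m, m = ⌈16 * n * ℓ / β⌉₊ := ⟨_, rfl⟩
  obtain ⟨q₁, hq₁⟩ : ∃ q₁, q₁ = ⌈w * z ^ 2⌉₊ := ⟨_, rfl⟩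
  obtain ⟨σ₁, hσ₁⟩ : ∃ σ₁, σ₁ = ⌊(n : ℝ) / x ^ 3⌋₊ := ⟨_, rfl⟩
  have hm1 : 16 * n * ℓ / β ≤ m := by rw [hm]; exact Nat.le_ceil _
  have hm2 : (m : ℝ) ≤ 16 * n * ℓ / β + 1 := by
    rw [hm]
    exact (Nat.ceil_lt_add_one (by positivity)).le
  have hq1 : w * z ^ 2 ≤ q₁ := by rw [hq₁]; exact Nat.le_ceil _
  have hwz : w * 100000 ≤ w * z ^ 2 := mul_le_mul_of_nonneg_left (by linarith) hw0.le
  have hqpos : 0 < q₁ := by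
    have : (0 : ℝ) < q₁ := by linarith
    exact_mod_cast this
  have hlogn0 : 0 ≤ Real.log n := Real.log_nonneg (by linarith)
  have hσ₀n : ((4 * m + 4 : ℕ) : ℝ) < n := by
    have h1 : 16 * (n : ℝ) * ℓ / β ≤ n / 1000 := by
      rw [div_le_div_iff₀ hβ0 (by norm_num)]
      have : n * (16 * ℓ * 1000) ≤ n * β := mul_le_mul_of_nonneg_left (by linarith) hn0.le
      linarith
    push_cast
    linarith
  have hσ₁x : (σ₁ : ℝ) ≤ n / x ^ 3 := by rw [hσ₁]; exact Nat.floor_le (by positivity)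
  have hσ₁n : (σ₁ : ℝ) < n :=
    hσ₁x.trans_lt (div_lt_self hn0 (one_lt_pow₀ (by linarith) (by norm_num)))
  obtain ⟨hst1, hst2⟩ := stages_suffice (n := n) (N₁ := ⌈16 * ℓ⌉₊) (N₂ := ⌈4 * Real.log n⌉₊)
    (by linarith) (by linarith) hℓ hσ₀n.le hσ₁ (Nat.le_ceil _) (Nat.le_ceil _)
  have hbudget := stages_budget hℓ1 hz hw1 hlogn hlogn0 hβ hq₁ rfl rfl
  have hθβ : ((⌊β / 2⌋₊ : ℕ) : ℝ) ≤ β / 2 := Nat.floor_le (by positivity)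
  have hθk : ⌊β / 2⌋₊ ≤ k := by
    have : ((⌊β / 2⌋₊ : ℕ) : ℝ) ≤ k := by linarith
    exact_mod_cast this
  -- `p σ₀` is of smaller order than the degree threshold.
  have hpσ : ∀ s : ℕ, s ≤ 4 * m + 4 → p * s ≤ q₁ / 10 := by
    intro s hs
    have hs' : (s : ℝ) ≤ 4 * m + 4 := by exact_mod_cast hs
    have h1 : p * (16 * n * ℓ / β) ≤ w := by
      have h2 : p * (16 * n * ℓ / β) = (w * w) * (16 * ℓ) / β := by
        rw [← hxw, hxdef]
        ring
      have h3 : (w * w) * (16 * ℓ) ≤ (w * w) * z ^ 4 :=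
        mul_le_mul_of_nonneg_left (by linarith) (by positivity)
      rw [h2, div_le_iff₀ hβ0, hβ]
      linarith
    have h5 : p * s ≤ p * (4 * (16 * n * ℓ / β + 1) + 4) :=
      mul_le_mul_of_nonneg_left (by linarith) hp0.le
    linarith
  have hbad1 := graphMean_avail_low_le (V := Fin n) hp0.le hp1.le k m ⌊β / 2⌋₊ β
    (fun c => hmean.trans (by
      have := le_sum_pow_card_colorClass hp0.le hp1 hkpos c
      rwa [Fintype.card_fin, ← ha] at this)) hθβ
  have hbad2 := graphMean_highDeg_le (V := Fin n) hp0.le hp1.le (4 * m + 4) q₁ hqpos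
    (by rw [Fintype.card_fin]; exact_mod_cast hσ₀n) (fun s hs1 hsσ => by
      rw [Fintype.card_fin]
      exact highDeg_bound_of_log_le hn0 hp0.le (by exact_mod_cast hs1) hqpos (hpσ s hsσ)
        (by linarith))
  have hbad3 := graphMean_highDeg_le (V := Fin n) hp0.le hp1.le σ₁ 8 (by norm_num)
    (by rw [Fintype.card_fin]; exact_mod_cast hσ₁n) (fun s hs1 hsσ => by
      rw [Fintype.card_fin]
      exact highDeg_bound_of_le_div_cube hn0 hxdef hx1 (Nat.cast_nonneg s)
        (le_trans (by exact_mod_cast hsσ) hσ₁x))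
  rw [Fintype.card_fin] at hbad1 hbad2 hbad3
  have hfinal1 : (2 * ((k : ℝ) + 1)) ^ n * Real.exp (-(m * β) / 8) ≤ 1 / x := by
    have h1 : (2 * ((k : ℝ) + 1)) ^ n ≤ Real.exp (n * ℓ) := by
      rw [Real.exp_nat_mul, hℓ, Real.exp_log hx0]
      exact pow_le_pow_left₀ (by positivity) hkx n
    have h2 : 16 * n * ℓ ≤ m * β := by rwa [div_le_iff₀ hβ0] at hm1
    have h3 : ℓ ≤ n * ℓ := le_mul_of_one_le_left (by linarith) (by linarith)
    calc (2 * ((k : ℝ) + 1)) ^ n * Real.exp (-(m * β) / 8)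
        ≤ Real.exp (n * ℓ) * Real.exp (-(m * β) / 8) := by gcongr
      _ = Real.exp (n * ℓ + -(m * β) / 8) := by rw [Real.exp_add]
      _ ≤ Real.exp (-ℓ) := Real.exp_le_exp.2 (by linarith)
      _ = 1 / x := by rw [Real.exp_neg, hℓ, Real.exp_log hx0, one_div]
  have hfinal2 : 1 / (n : ℝ) ^ 2 ≤ 1 / x :=
    one_div_le_one_div_of_le hx0 (hxn.trans (le_self_pow₀ (by linarith) (by norm_num)))
  refine (graphMean_indicator_mono hp0.le hp1.le (B := _ ∪ (_ ∪ _)) ?_).trans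
    ((graphMean_indicator_union_le hp0.le hp1.le _ _).trans (add_le_add hbad1
      ((graphMean_indicator_union_le hp0.le hp1.le _ _).trans (add_le_add hbad2 hbad3))))
    |>.trans ?_
  · intro G hG
    by_contra hcon
    simp only [Set.mem_union, Set.mem_ofPred_eq, not_or, not_not] at hcon hG
    exact hG (makerHasWinningStrategy_of_pseudorandom hcon.1 hcon.2.1 hcon.2.2 le_rfl hst1 hst2
      hbudget hθk)
  · have : 3 / x = 1 / x + (1 / x + 1 / x) := by ring
    rw [this]
    gcongr

/-! ### Breaker's strategy on the random graph -/

/-- The exponential moment used to show that Breaker finds spoiling vertices. -/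
theorem spoil_moment_le {p η l : ℝ} (hη : 0 < η) (hp0 : 0 ≤ p) (hpη : p ≤ 1 - η)
    (hl : l = Real.log (2 / √η)) (hl0 : 0 < l) :
    (1 - p + p * Real.exp (-l)) * Real.exp (l * (p / (4 * l)))
      ≤ Real.exp (-(-Real.log (1 - p)) / 4) := by
  have hp1 : 0 < 1 - p := by linarith
  have hs0 : 0 < √η := Real.sqrt_pos.2 hη
  have hel : Real.exp (-l) = √η / 2 := by
    rw [hl, Real.exp_neg, Real.exp_log (by positivity), inv_div]
  set u := √(1 - p) with hu
  have hu0 : 0 < u := Real.sqrt_pos.2 hp1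
  have huu : u * u = 1 - p := Real.mul_self_sqrt hp1.le
  have hηu : √η ≤ u := Real.sqrt_le_sqrt (by linarith)
  have hu1 : u ≤ 1 := Real.sqrt_le_one.2 (by linarith)
  have h1 : 1 - p + p * Real.exp (-l) ≤ u := by
    have hp : p = (1 - u) * (1 + u) := by linarith
    have h2 : p * (√η / 2) ≤ (1 - u) * u := by
      rw [hp, mul_assoc]
      refine mul_le_mul_of_nonneg_left ?_ (by linarith)
      have : (1 + u) * (√η / 2) ≤ 2 * (u / 2) :=
        mul_le_mul (by linarith) (by linarith) (by positivity) (by norm_num)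
      linarith
    rw [hel, ← huu]
    linarith
  have h3 : u = Real.exp (Real.log (1 - p) / 2) := by
    rw [hu, Real.sqrt_eq_rpow, Real.rpow_def_of_pos hp1]
    congr 1
    ring
  have h4 : l * (p / (4 * l)) = p / 4 := by field_simp
  have h5 := le_neg_log_one_sub (p := p) (by linarith)
  calc (1 - p + p * Real.exp (-l)) * Real.exp (l * (p / (4 * l)))
      ≤ Real.exp (Real.log (1 - p) / 2) * Real.exp (p / 4) := by
        rw [h4]
        exact mul_le_mul_of_nonneg_right (h1.trans h3.le) (Real.exp_pos _).le
    _ = Real.exp (Real.log (1 - p) / 2 + p / 4) := by rw [Real.exp_add]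
    _ ≤ Real.exp (-(-Real.log (1 - p)) / 4) := Real.exp_le_exp.2 (by linarith)

/-- After `log r / κ` reductions by the factor `1 - κ` nothing is left of `r`. -/
theorem le_ceil_log_div_of_one_le {κ : ℝ} {r j : ℕ} (hκ0 : 0 < κ) (hκ1 : κ ≤ 1)
    (hj : 1 ≤ (1 - κ) ^ j * r) : j ≤ ⌈Real.log r / κ⌉₊ := by
  have hr : (0 : ℝ) < r := by
    rcases Nat.eq_zero_or_pos r with rfl | h
    · norm_num at hj
    · exact_mod_cast h
  have h1 : (1 - κ) ^ j ≤ Real.exp (-(j * κ)) := by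
    calc (1 - κ) ^ j ≤ Real.exp (-κ) ^ j := by
          refine pow_le_pow_left₀ (by linarith) ?_ j
          have := Real.add_one_le_exp (-κ)
          linarith
      _ = _ := by rw [← Real.exp_nat_mul]; congr 1; ring
  have h2 : 1 ≤ Real.exp (-(j * κ) + Real.log r) := by
    rw [Real.exp_add, Real.exp_log hr]
    exact hj.trans (mul_le_mul_of_nonneg_right h1 hr.le)
  rw [Real.one_le_exp_iff] at h2
  have h3 : (j : ℝ) ≤ Real.log r / κ := by
    rw [le_div_iff₀ hκ0]
    linarith
  exact_mod_cast h3.trans (Nat.le_ceil _)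

/-- Sets of size `j ≥ e n / exp y` are counted by `exp (j y)`. -/
theorem choose_le_exp_mul {n j : ℕ} {y : ℝ} (hj : 0 < j)
    (h : Real.exp 1 * n ≤ Real.exp y * j) : (n.choose j : ℝ) ≤ Real.exp (j * y) := by
  have hj' : (0 : ℝ) < j := by exact_mod_cast hj
  refine (choose_le_exp_mul_div_pow n j).trans ?_
  rw [Real.exp_nat_mul]
  exact pow_le_pow_left₀ (by positivity) ((div_le_iff₀ hj').2 h) j

/-- The first moment bound of `graphMean_few_indep_le` is small: with `s₀ + j₀ / 2` exceeding `L` by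
a constant factor, each of the `r` sets contributes `exp (-ξ ℓ j₀ / 4)`, and `r ≥ 8 / ξ ^ 2` of them
outweigh the choice of the critical class. -/
theorem few_indep_numerics {p a ξ L ℓ : ℝ} {n s₀ j₀ r : ℕ} (hp1 : p < 1)
    (ha : a = -Real.log (1 - p)) (ha0 : 0 < a) (hξ : 0 < ξ) (hℓ : 0 ≤ ℓ) (hL : a * L = ℓ)
    (hL1 : 1 ≤ L) (hs₀ : (1 - ξ / 12) * L ≤ s₀) (hs₀' : (s₀ : ℝ) ≤ L) (hj₀ : ξ * L ≤ j₀)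
    (hr : 8 / ξ ^ 2 ≤ r) (haξ : a ≤ ξ * ℓ / 3) (hc₁ : (n.choose s₀ : ℝ) ≤ Real.exp (s₀ * ℓ))
    (hc₂ : (n.choose j₀ : ℝ) ≤ Real.exp (j₀ * ℓ)) :
    (n.choose s₀ : ℝ) * (n.choose j₀ : ℝ) ^ r * (1 - p) ^ (r * (s₀ * j₀ + j₀.choose 2))
      ≤ Real.exp (-ℓ) := by
  rw [one_sub_pow_eq_exp hp1, ← ha]
  have h1 : (n.choose j₀ : ℝ) ^ r ≤ Real.exp (r * (j₀ * ℓ)) := by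
    rw [Real.exp_nat_mul]
    exact pow_le_pow_left₀ (Nat.cast_nonneg _) hc₂ r
  calc (n.choose s₀ : ℝ) * (n.choose j₀ : ℝ) ^ r
        * Real.exp (-(a * (r * (s₀ * j₀ + j₀.choose 2) : ℕ)))
      ≤ Real.exp (s₀ * ℓ) * Real.exp (r * (j₀ * ℓ))
        * Real.exp (-(a * (r * (s₀ * j₀ + j₀.choose 2) : ℕ))) := by gcongr
    _ = Real.exp (s₀ * ℓ + r * (j₀ * ℓ) - a * (r * (s₀ * j₀ + j₀.choose 2) : ℕ)) := by
        rw [← Real.exp_add, ← Real.exp_add, sub_eq_add_neg]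
    _ ≤ Real.exp (-ℓ) := by
        refine Real.exp_le_exp.2 ?_
        push_cast [Nat.cast_choose_two]
        have e1 : (1 - ξ / 12) * ℓ ≤ a * s₀ := by
          have := mul_le_mul_of_nonneg_left hs₀ ha0.le
          rw [← hL]
          linarith
        have e2 : ξ * ℓ ≤ a * j₀ := by
          have := mul_le_mul_of_nonneg_left hj₀ ha0.le
          rw [← hL]
          linarith
        have e3 : ξ * ℓ / 4 ≤ a * s₀ + a * (j₀ - 1) / 2 - ℓ := by linarith
        have e4 : 8 * L ≤ ξ * (r * j₀) := by
          have h8 : 8 / ξ ^ 2 * (ξ * L) ≤ r * j₀ :=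
            mul_le_mul hr hj₀ (by positivity) (Nat.cast_nonneg _)
          have h9 : ξ * (8 / ξ ^ 2 * (ξ * L)) = 8 * L := by field_simp
          rw [← h9]
          exact mul_le_mul_of_nonneg_left h8 hξ.le
        have e5 : (r * j₀ : ℝ) * (ξ * ℓ / 4)
            ≤ (r * j₀) * (a * s₀ + a * (j₀ - 1) / 2 - ℓ) :=
          mul_le_mul_of_nonneg_left e3 (by positivity)
        have e6 : 8 * L * (ℓ / 4) ≤ ξ * (r * j₀) * (ℓ / 4) :=
          mul_le_mul_of_nonneg_right e4 (by linarith)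
        have e7 : (s₀ : ℝ) * ℓ ≤ L * ℓ := mul_le_mul_of_nonneg_right hs₀' hℓ
        have e8 : 1 * ℓ ≤ L * ℓ := mul_le_mul_of_nonneg_right hL1 hℓ
        linarith

/-- The bound of `graphMean_spoil_le` is small: the choice of `t` vertices costs less than what the
missing edges to the critical class and the exponential moment of the degrees into `R` gain. -/
theorem spoil_numerics {p a ξ τ ℓ : ℝ} {n s₀ j₀ m t : ℕ} (hp1 : p < 1)
    (ha : a = -Real.log (1 - p)) (hτ : 0 ≤ τ) (hn : 0 < n)
    (hℓ : 0 ≤ ℓ) (hlg : 1 ≤ Real.log n)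
    (hs₀ : (1 - ξ / 12) * ℓ ≤ a * s₀) (hj₀ : ξ * ℓ ≤ a * j₀) (hξℓ : 12 ≤ ξ * ℓ)
    (hc : (n.choose t : ℝ) ≤ Real.exp (t * (1 + (1 - τ) * ℓ)))
    (hsm : (s₀ + 2 * m) * Real.log n ≤ t / 2) (htℓ : 2 * ℓ ≤ t) :
    (n.choose s₀ : ℝ) * ((m + 1) * (n : ℝ) ^ m) * n.choose t
        * ((1 - p) ^ (t * s₀) * Real.exp (-a / 4) ^ (t * j₀)) ≤ Real.exp (-ℓ) := by
  have hn' : (0 : ℝ) < n := by exact_mod_cast hn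
  have hpow : ∀ i : ℕ, (n : ℝ) ^ i = Real.exp (i * Real.log n) := by
    intro i
    rw [Real.exp_nat_mul, Real.exp_log hn']
  have h1 : (n.choose s₀ : ℝ) ≤ Real.exp (s₀ * Real.log n) := by
    rw [← hpow]
    exact_mod_cast Nat.choose_le_pow n s₀
  have h2 : ((m : ℝ) + 1) * (n : ℝ) ^ m ≤ Real.exp (2 * (m * Real.log n)) := by
    rw [hpow, two_mul, Real.exp_add]
    refine mul_le_mul_of_nonneg_right ?_ (Real.exp_pos _).le
    refine (Real.add_one_le_exp (m : ℝ)).trans (Real.exp_le_exp.2 ?_)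
    exact le_mul_of_one_le_right (Nat.cast_nonneg m) hlg
  have h3 : (1 - p) ^ (t * s₀) * Real.exp (-a / 4) ^ (t * j₀)
      = Real.exp (-(a * (t * s₀ : ℕ)) + (t * j₀ : ℕ) * (-a / 4)) := by
    rw [one_sub_pow_eq_exp hp1, ← ha, ← Real.exp_nat_mul, Real.exp_add]
  rw [h3]
  calc (n.choose s₀ : ℝ) * ((m + 1) * (n : ℝ) ^ m) * n.choose t
        * Real.exp (-(a * (t * s₀ : ℕ)) + (t * j₀ : ℕ) * (-a / 4))
      ≤ Real.exp (s₀ * Real.log n) * Real.exp (2 * (m * Real.log n))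
        * Real.exp (t * (1 + (1 - τ) * ℓ))
        * Real.exp (-(a * (t * s₀ : ℕ)) + (t * j₀ : ℕ) * (-a / 4)) := by gcongr
    _ = Real.exp (s₀ * Real.log n + 2 * (m * Real.log n) + t * (1 + (1 - τ) * ℓ)
        + (-(a * (t * s₀ : ℕ)) + (t * j₀ : ℕ) * (-a / 4))) := by
        rw [← Real.exp_add, ← Real.exp_add, ← Real.exp_add]
    _ ≤ Real.exp (-ℓ) := by
        refine Real.exp_le_exp.2 ?_
        push_cast
        have ht : (0 : ℝ) ≤ t := Nat.cast_nonneg t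
        have e1 : t * ((1 - ξ / 12) * ℓ) ≤ t * (a * s₀) := mul_le_mul_of_nonneg_left hs₀ ht
        have e2 : t * (ξ * ℓ) ≤ t * (a * j₀) := mul_le_mul_of_nonneg_left hj₀ ht
        have e3 : (t : ℝ) * 12 ≤ t * (ξ * ℓ) := mul_le_mul_of_nonneg_left hξℓ ht
        have e4 : 0 ≤ t * (τ * ℓ) := by positivity
        linarith

/-- Independent sets have size at most of order `log n / p`. -/
theorem indep_numerics {p a ℓ : ℝ} {n α₀ : ℕ} (hp0 : 0 < p) (hp1 : p < 1)
    (ha : a = -Real.log (1 - p)) (hn : 0 < n) (hℓ : ℓ ≤ Real.log n)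
    (hα₀ : 4 * Real.log n / p ≤ α₀) :
    (n.choose (α₀ + 1) : ℝ) * (1 - p) ^ (α₀ + 1).choose 2 ≤ Real.exp (-ℓ) := by
  have hn' : (0 : ℝ) < n := by exact_mod_cast hn
  have h1 : (n.choose (α₀ + 1) : ℝ) ≤ Real.exp ((α₀ + 1 : ℕ) * Real.log n) := by
    rw [Real.exp_nat_mul, Real.exp_log hn']
    exact_mod_cast Nat.choose_le_pow n (α₀ + 1)
  rw [one_sub_pow_eq_exp hp1, ← ha]
  refine (mul_le_mul_of_nonneg_right h1 (Real.exp_pos _).le).trans ?_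
  rw [← Real.exp_add]
  refine Real.exp_le_exp.2 ?_
  push_cast [Nat.cast_choose_two]
  have hap : p ≤ a := by rw [ha]; exact le_neg_log_one_sub hp1
  have h2 : 4 * Real.log n ≤ a * α₀ := by
    rw [div_le_iff₀ hp0] at hα₀
    have : (α₀ : ℝ) * p ≤ α₀ * a := mul_le_mul_of_nonneg_left hap (Nat.cast_nonneg _)
    linarith
  have hα : (0 : ℝ) ≤ α₀ := Nat.cast_nonneg _
  have h3 : ((α₀ : ℝ) + 1) * (4 * Real.log n) ≤ (α₀ + 1) * (a * α₀) :=
    mul_le_mul_of_nonneg_left h2 (by positivity)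
  have h4 : 0 ≤ (α₀ : ℝ) * Real.log n := by positivity
  linarith

/-- The bound of `graphMean_fewExceptional_le` is small: `μ` exceptional classes are unlikely enough
for a union bound over all families of `μ` disjoint sets. -/
theorem exceptional_numerics {n : ℕ} {p x y ℓ ε μ M : ℝ} (hp0 : 0 < p) (hn : 0 < n)
    (hx : x = n * p) (hy0 : 0 < y) (hε : 0 < ε) (hlg : 1 ≤ Real.log n) (hℓ : ℓ ≤ Real.log n)
    (hμ0 : 0 ≤ μ) (hμ : 64 / ε * (x * Real.log n / y ^ 8) ≤ μ) (hμn : 2 * (μ + 1) ≤ n)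
    (hM : M = μ * (ε / 4 * (y ^ 8 / p))) :
    (2 * (μ + 1)) ^ n * Real.exp (-M / 8) ≤ Real.exp (-ℓ) := by
  have hn' : (0 : ℝ) < n := by exact_mod_cast hn
  have hn1 : (1 : ℝ) ≤ n := by exact_mod_cast hn
  have h1 : (2 * (μ + 1)) ^ n ≤ Real.exp (n * Real.log n) := by
    rw [Real.exp_nat_mul, Real.exp_log hn']
    exact pow_le_pow_left₀ (by positivity) hμn n
  have h2 : 16 * (n * Real.log n) ≤ M := by
    have h3 := mul_le_mul_of_nonneg_right hμ (show 0 ≤ ε / 4 * (y ^ 8 / p) by positivity)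
    rw [← hM] at h3
    refine le_trans (le_of_eq ?_) h3
    rw [hx]
    field_simp
    norm_num
  have h4 : 1 * Real.log n ≤ n * Real.log n := mul_le_mul_of_nonneg_right hn1 (by linarith)
  calc (2 * (μ + 1)) ^ n * Real.exp (-M / 8)
      ≤ Real.exp (n * Real.log n) * Real.exp (-M / 8) :=
        mul_le_mul_of_nonneg_right h1 (Real.exp_pos _).le
    _ = Real.exp (n * Real.log n + -M / 8) := by rw [Real.exp_add]
    _ ≤ Real.exp (-ℓ) := Real.exp_le_exp.2 (by linarith)

/-- Spoiled classes of size `(1 + ε / 8) L` and few exceptional ones do not cover the graph. -/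
theorem count_numerics {n p x y lg ε L k F μ α₀ u₀ : ℝ} (hp0 : 0 < p) (hn : 0 < n) (hx : x = n * p)
    (hε : 0 < ε) (hε1 : ε < 1) (hL : 0 < L) (hk0 : 0 ≤ k) (hk : k ≤ (1 - ε) * (n / L))
    (hF : F ≤ (1 + ε / 8) * L) (hμ : μ ≤ 64 / ε * (x * lg / y ^ 8) + 1) (hα0 : 0 ≤ α₀)
    (hα : α₀ ≤ 5 * lg / p) (hu : u₀ ≤ ε / 4 * n + 1) (hlg1 : 1 ≤ lg) (hlg : lg ≤ y)
    (hy : 10000 / ε ^ 2 ≤ y) (hyx : y ^ 2 ≤ x) (hn4 : 16 / ε ≤ n) :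
    k * F + μ * α₀ + u₀ + 3 ≤ n := by
  have hy1 : 1 ≤ y := hlg1.trans hlg
  have hy0 : 0 < y := by linarith
  have hx0 : 0 < x := by rw [hx]; positivity
  have hε2 : 10000 ≤ y * ε ^ 2 := by rwa [div_le_iff₀ (by positivity)] at hy
  have hεε : ε ^ 2 ≤ ε := by
    rw [pow_two]
    exact mul_le_of_le_one_left hε.le hε1.le
  have hyε : 10000 ≤ y * ε := hε2.trans (mul_le_mul_of_nonneg_left hεε hy0.le)
  have h1 : k * F ≤ (1 - 7 * ε / 8) * n := by
    have h2 : k * F ≤ (1 - ε) * (n / L) * ((1 + ε / 8) * L) :=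
      (mul_le_mul_of_nonneg_left hF hk0).trans
        (mul_le_mul_of_nonneg_right hk (by positivity))
    have h3 : (1 - ε) * (n / L) * ((1 + ε / 8) * L) = (1 - ε) * (1 + ε / 8) * n := by field_simp
    have h4 : (1 - ε) * (1 + ε / 8) * n ≤ (1 - 7 * ε / 8) * n := by
      refine mul_le_mul_of_nonneg_right ?_ hn.le
      have : 0 ≤ ε ^ 2 := sq_nonneg ε
      linarith
    linarith
  have h5 : μ * α₀ ≤ ε / 4 * n := by
    have h6 : μ * α₀ ≤ (64 / ε * (x * lg / y ^ 8) + 1) * (5 * lg / p) :=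
      (mul_le_mul_of_nonneg_right hμ hα0).trans
        (mul_le_mul_of_nonneg_left hα (by positivity))
    have h7 : (64 / ε * (x * lg / y ^ 8) + 1) * (5 * lg / p)
        = n * (320 / ε * (lg ^ 2 / y ^ 8)) + n * (5 * lg / x) := by
      rw [hx]
      field_simp
      ring
    have h8 : 320 / ε * (lg ^ 2 / y ^ 8) ≤ ε / 8 := by
      have h9 : lg ^ 2 / y ^ 8 ≤ 1 / y := by
        rw [div_le_div_iff₀ (by positivity) hy0, one_mul]
        calc lg ^ 2 * y ≤ y ^ 2 * y := by gcongr
          _ = y ^ 3 := by ring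
          _ ≤ y ^ 8 := pow_le_pow_right₀ hy1 (by norm_num)
      calc 320 / ε * (lg ^ 2 / y ^ 8) ≤ 320 / ε * (1 / y) := by gcongr
        _ ≤ ε / 8 := by
          rw [div_mul_div_comm, div_le_div_iff₀ (by positivity) (by norm_num)]
          have : ε * (ε * y) = y * ε ^ 2 := by ring
          rw [this]
          linarith
    have h10 : 5 * lg / x ≤ ε / 8 := by
      rw [div_le_div_iff₀ hx0 (by norm_num)]
      have h11 : y * 10000 ≤ y * (y * ε) := mul_le_mul_of_nonneg_left hyε hy0.le
      have h12 : ε * y ^ 2 ≤ ε * x := mul_le_mul_of_nonneg_left hyx hε.le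
      linarith
    have h13 := mul_le_mul_of_nonneg_left h8 hn.le
    have h14 := mul_le_mul_of_nonneg_left h10 hn.le
    linarith
  have h15 : 16 ≤ n * ε := by rwa [div_le_iff₀ hε] at hn4
  linarith

set_option maxHeartbeats 2000000 in
/-- In the binomial random graph with `x = n p` large and `log n` at most a small power of `x`,
Breaker wins whenever there are fewer than `(1 - ε) n / log_b x` colours, except with probability at
most `4 / x`. -/
theorem exists_threshold_breaker {ε η : ℝ} (hε : 0 < ε) (hε1 : ε < 1) (hη : 0 < η) :
    ∃ X₀ : ℝ, ∀ (n : ℕ) (p : ℝ), 0 < p → p ≤ 1 - η → X₀ ≤ n * p →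
      Real.log n ≤ (n * p) ^ (ε / 3072) →
      graphMean p (Set.indicator {G : SimpleGraph (Fin n) |
        ∃ k : ℕ, (k : ℝ) < (1 - ε) * (n / Real.logb (1 / (1 - p)) (n * p)) ∧
          MakerHasWinningStrategy G k} 1)
        ≤ 4 / (n * p) := by
  obtain ⟨ξ, hξ⟩ : ∃ ξ, ξ = ε / 16 := ⟨_, rfl⟩
  obtain ⟨r, hr⟩ : ∃ r, r = ⌈8 / ξ ^ 2⌉₊ := ⟨_, rfl⟩
  obtain ⟨l, hl⟩ : ∃ l, l = Real.log (2 / √η) := ⟨_, rfl⟩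
  obtain ⟨H, hH⟩ : ∃ H, H = 8 * l * Real.log r + 10 := ⟨_, rfl⟩
  obtain ⟨D, hD⟩ : ∃ D : ℝ, D = 2 + 8 * r + 10000 / ε ^ 2 := ⟨_, rfl⟩
  have hε3072 : 0 < ε / 3072 := by positivity
  obtain ⟨X₀, hX₀⟩ := eventually_atTop.1
    ((Real.tendsto_log_atTop.eventually_ge_atTop (24 * H / (ξ * η) + 1)).and
      ((eventually_const_mul_log_le_rpow D hε3072).and (eventually_ge_atTop (16 / ε))))
  refine ⟨X₀, fun n p hp0 hpη hX hlogn => ?_⟩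
  obtain ⟨hℓH, hDy, hxε⟩ := hX₀ _ hX
  have hp1 : p < 1 := by linarith
  rw [logb_one_div_one_sub]
  obtain ⟨x, hx⟩ : ∃ x : ℝ, x = n * p := ⟨_, rfl⟩
  rw [← hx] at hlogn hℓH hDy hxε ⊢
  obtain ⟨ℓ, hℓ⟩ : ∃ ℓ, ℓ = Real.log x := ⟨_, rfl⟩
  -- A small power of `x`, with `y ^ 8 = x ^ (ξ / 24)`: a vertex outside a set of size
  -- `(1 - ξ / 24) L` has no neighbours in it with probability `y ^ 8 / x`.
  obtain ⟨y, hy⟩ : ∃ y, y = x ^ (ε / 3072) := ⟨_, rfl⟩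
  obtain ⟨a, ha⟩ : ∃ a, a = -Real.log (1 - p) := ⟨_, rfl⟩
  obtain ⟨L, hL⟩ : ∃ L, L = ℓ / a := ⟨_, rfl⟩
  rw [← hy] at hlogn hDy
  rw [← hℓ] at hℓH hDy ⊢
  rw [← ha, ← hL]
  -- Elementary bounds.
  have hξ0 : 0 < ξ := by rw [hξ]; positivity
  have hξ1 : ξ ≤ 1 := by linarith
  have hη1 : η < 1 := by linarith
  have hsη : √η ≤ 1 := Real.sqrt_le_one.2 hη1.le
  have hsη0 : 0 < √η := Real.sqrt_pos.2 hη
  have hl2 : Real.log 2 ≤ l := by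
    rw [hl]
    refine Real.log_le_log (by norm_num) ?_
    rw [le_div_iff₀ hsη0]
    linarith
  have hl0 : 0 < l := by linarith [Real.log_two_gt_d9]
  have hr8 : 8 / ξ ^ 2 ≤ r := by rw [hr]; exact Nat.le_ceil _
  have hr1 : (1 : ℝ) ≤ r := by
    refine le_trans ?_ hr8
    rw [le_div_iff₀ (by positivity), one_mul]
    have : ξ ^ 2 ≤ 1 := pow_le_one₀ hξ0.le hξ1
    linarith
  have hlr : 0 ≤ Real.log r := Real.log_nonneg hr1
  have hH10 : 10 ≤ H := by
    rw [hH]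
    have : 0 ≤ 8 * l * Real.log r := by positivity
    linarith
  have hξη0 : 0 < ξ * η := by positivity
  have hHℓ : 24 * H ≤ ξ * η * ℓ := by
    have h1 : 24 * H / (ξ * η) ≤ ℓ := by linarith
    rw [div_le_iff₀ hξη0] at h1
    linarith
  have hℓ1 : 1 ≤ ℓ := by
    have : 0 ≤ 24 * H / (ξ * η) := by positivity
    linarith
  have hD0 : 10000 ≤ D := by
    rw [hD]
    have h1 : 10000 ≤ 10000 / ε ^ 2 := by
      rw [le_div_iff₀ (by positivity)]
      have : ε ^ 2 ≤ 1 := pow_le_one₀ hε.le hε1.le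
      linarith
    linarith
  have hDy' : D ≤ y := (le_mul_of_one_le_right (by linarith) hℓ1).trans hDy
  have hyε : 10000 / ε ^ 2 ≤ y := by
    refine le_trans ?_ hDy'
    rw [hD]
    linarith
  have hrℓy : (2 + 8 * r) * ℓ ≤ y := by
    refine le_trans (mul_le_mul_of_nonneg_right ?_ (by linarith)) hDy
    have : 0 ≤ 10000 / ε ^ 2 := by positivity
    linarith
  have hy1 : 1 ≤ y := by linarith
  have hy0 : 0 < y := by linarith
  have hx0 : 0 < x := lt_of_lt_of_le (by positivity) hxε
  have hx1 : 1 ≤ x := by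
    refine le_trans ?_ hxε
    rw [le_div_iff₀ hε]
    linarith
  have hyx : y ^ 2 ≤ x := by
    rw [hy, ← Real.rpow_natCast, ← Real.rpow_mul hx0.le]
    calc x ^ (ε / 3072 * (2 : ℕ)) ≤ x ^ (1 : ℝ) :=
          Real.rpow_le_rpow_of_exponent_le hx1 (by push_cast; linarith)
      _ = x := Real.rpow_one x
  have hypow : ∀ i : ℕ, y ^ i = Real.exp (i * (ε / 3072) * ℓ) := by
    intro i
    rw [hy, ← Real.rpow_natCast, ← Real.rpow_mul hx0.le, Real.rpow_def_of_pos hx0, ← hℓ]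
    congr 1
    ring
  have hn0 : 0 < n := by
    rcases Nat.eq_zero_or_pos n with rfl | h
    · rw [hx] at hx0
      simp at hx0
    · exact h
  have hn0' : (0 : ℝ) < n := by exact_mod_cast hn0
  have hxn : x ≤ n := by
    rw [hx]
    exact mul_le_of_le_one_right hn0'.le hp1.le
  have hℓn : ℓ ≤ Real.log n := by rw [hℓ]; exact Real.log_le_log hx0 hxn
  have hlg1 : 1 ≤ Real.log n := hℓ1.trans hℓn
  have hexpℓ : Real.exp ℓ = x := by rw [hℓ, Real.exp_log hx0]
  have hap : p ≤ a := by rw [ha]; exact le_neg_log_one_sub hp1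
  have haη : a ≤ p / η := by rw [ha]; exact neg_log_one_sub_le hη hp0.le hpη
  have ha0 : 0 < a := by linarith
  have haL : a * L = ℓ := by rw [hL]; field_simp
  have hL0 : 0 < L := by rw [hL]; positivity
  have hLp : L ≤ ℓ / p := by rw [hL]; exact div_le_div_of_nonneg_left (by linarith) hp0 hap
  have hLη : η * ℓ / p ≤ L := by
    rw [hL, div_le_div_iff₀ hp0 ha0]
    rw [le_div_iff₀ hη] at haη
    have := mul_le_mul_of_nonneg_left haη (show 0 ≤ ℓ by linarith)
    linarith
  have hHL : H / p ≤ ξ * L / 24 := by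
    have h1 : ξ * (η * ℓ / p) ≤ ξ * L := mul_le_mul_of_nonneg_left hLη hξ0.le
    have h2 : ξ * (η * ℓ / p) = ξ * η * ℓ / p := by ring
    have h3 : 24 * H / p ≤ ξ * η * ℓ / p := div_le_div_of_nonneg_right hHℓ hp0.le
    have h4 : 24 * H / p = 24 * (H / p) := by ring
    linarith
  have hHp : H ≤ H / p := by
    rw [le_div_iff₀ hp0]
    exact mul_le_of_le_one_right (by linarith) hp1.le
  have hL1 : 1 ≤ L := by
    have : ξ * L ≤ L := mul_le_of_le_one_left hL0.le hξ1
    linarith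
  -- The parameters of the strategy. The common non-neighbours of a set of size `s₁` number about
  -- `y ^ 8 / p`, much more than the `t` that Breaker needs.
  obtain ⟨s₀, hs₀⟩ : ∃ s₀, s₀ = ⌈(1 - ξ / 12) * L⌉₊ := ⟨_, rfl⟩
  obtain ⟨s₁, hs₁⟩ : ∃ s₁, s₁ = ⌊(1 - ξ / 24) * L⌋₊ := ⟨_, rfl⟩
  obtain ⟨j₀, hj₀⟩ : ∃ j₀, j₀ = ⌈ξ * L⌉₊ := ⟨_, rfl⟩
  obtain ⟨t, ht⟩ : ∃ t, t = ⌈y ^ 4 / p⌉₊ := ⟨_, rfl⟩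
  obtain ⟨κ, hκ⟩ : ∃ κ, κ = p / (4 * l) := ⟨_, rfl⟩
  obtain ⟨h, hh⟩ : ∃ h, h = ⌈Real.log r / κ⌉₊ := ⟨_, rfl⟩
  obtain ⟨μ, hμ⟩ : ∃ μ, μ = ⌈64 / ε * (x * Real.log n / y ^ 8)⌉₊ := ⟨_, rfl⟩
  obtain ⟨α₀, hα₀⟩ : ∃ α₀, α₀ = ⌈4 * Real.log n / p⌉₊ := ⟨_, rfl⟩
  obtain ⟨u₀, hu₀⟩ : ∃ u₀, u₀ = ⌈ε / 4 * n⌉₊ := ⟨_, rfl⟩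
  have hξL : 0 ≤ (1 - ξ / 12) * L := mul_nonneg (by linarith) hL0.le
  have hξL' : 0 ≤ (1 - ξ / 24) * L := mul_nonneg (by linarith) hL0.le
  have hs₀low : (1 - ξ / 12) * L ≤ s₀ := by rw [hs₀]; exact Nat.le_ceil _
  have hs₀up : (s₀ : ℝ) ≤ (1 - ξ / 12) * L + 1 := by
    rw [hs₀]; exact (Nat.ceil_lt_add_one hξL).le
  have hs₁low : (1 - ξ / 24) * L ≤ s₁ + 1 := by rw [hs₁]; exact (Nat.lt_floor_add_one _).le
  have hs₁up : (s₁ : ℝ) ≤ (1 - ξ / 24) * L := by rw [hs₁]; exact Nat.floor_le hξL'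
  have hj₀low : ξ * L ≤ j₀ := by rw [hj₀]; exact Nat.le_ceil _
  have hj₀up : (j₀ : ℝ) ≤ ξ * L + 1 := by
    rw [hj₀]; exact (Nat.ceil_lt_add_one (by positivity)).le
  have htlow : y ^ 4 / p ≤ t := by rw [ht]; exact Nat.le_ceil _
  have htup : (t : ℝ) ≤ y ^ 4 / p + 1 := by
    rw [ht]; exact (Nat.ceil_lt_add_one (by positivity)).le
  have hμlow : 64 / ε * (x * Real.log n / y ^ 8) ≤ μ := by rw [hμ]; exact Nat.le_ceil _
  have hμup : (μ : ℝ) ≤ 64 / ε * (x * Real.log n / y ^ 8) + 1 := by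
    rw [hμ]; exact (Nat.ceil_lt_add_one (by positivity)).le
  have hα₀low : 4 * Real.log n / p ≤ α₀ := by rw [hα₀]; exact Nat.le_ceil _
  have hα₀up : (α₀ : ℝ) ≤ 5 * Real.log n / p := by
    have h1 : (α₀ : ℝ) ≤ 4 * Real.log n / p + 1 := by
      rw [hα₀]; exact (Nat.ceil_lt_add_one (by positivity)).le
    have h2 : 1 ≤ Real.log n / p := by
      rw [le_div_iff₀ hp0]
      linarith
    have h3 : 5 * Real.log n / p = 4 * Real.log n / p + Real.log n / p := by ring
    linarith
  have hu₀low : ε / 4 * n ≤ u₀ := by rw [hu₀]; exact Nat.le_ceil _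
  have hu₀up : (u₀ : ℝ) ≤ ε / 4 * n + 1 := by
    rw [hu₀]; exact (Nat.ceil_lt_add_one (by positivity)).le
  have hκ0 : 0 < κ := by rw [hκ]; positivity
  have hκ1 : κ ≤ 1 := by
    rw [hκ, div_le_one (by positivity)]
    linarith [Real.log_two_gt_d9]
  have hhup : 2 * (h : ℝ) + 8 ≤ ξ * L / 24 := by
    have h1 : (h : ℝ) ≤ Real.log r / κ + 1 := by
      rw [hh]; exact (Nat.ceil_lt_add_one (by positivity)).le
    have h2 : 2 * (Real.log r / κ) = 8 * l * Real.log r / p := by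
      rw [hκ]
      field_simp
      ring
    have h3 : 8 * l * Real.log r / p + 10 ≤ H / p := by
      rw [hH, add_div]
      have : (10 : ℝ) ≤ 10 / p := by
        rw [le_div_iff₀ hp0]
        linarith
      linarith
    linarith
  have hs₀L : (s₀ : ℝ) ≤ L := by linarith
  have hrj₀ : (r : ℝ) * j₀ ≤ r * (2 * L) := by
    refine mul_le_mul_of_nonneg_left ?_ (by linarith)
    have : ξ * L ≤ L := mul_le_of_le_one_left hL0.le hξ1
    linarith
  have hy4 : y ≤ y ^ 4 := le_self_pow₀ hy1 (by norm_num)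
  have hy4p : y ^ 4 ≤ y ^ 4 / p := by
    rw [le_div_iff₀ hp0]
    exact mul_le_of_le_one_right (by positivity) hp1.le
  let P : BreakerParams := ⟨s₀, s₁, j₀, r, t, h, κ⟩
  have hj₀pos : 0 < j₀ := by
    have : (0 : ℝ) < j₀ := lt_of_lt_of_le (by positivity) hj₀low
    exact_mod_cast this
  have hs₀pos : 0 < s₀ := by
    have : (0 : ℝ) < s₀ := by
      have : ξ * L ≤ L := mul_le_of_le_one_left hL0.le hξ1
      linarith
    exact_mod_cast this
  have has₀ : (1 - ξ / 12) * ℓ ≤ a * s₀ := by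
    have := mul_le_mul_of_nonneg_left hs₀low ha0.le
    rw [← haL]
    linarith
  have haj₀ : ξ * ℓ ≤ a * j₀ := by
    have := mul_le_mul_of_nonneg_left hj₀low ha0.le
    rw [← haL]
    linarith
  -- Sets of size of order `L` are counted by powers of `x`.
  have hchoose : ∀ j : ℕ, ξ * L ≤ j → (n.choose j : ℝ) ≤ Real.exp (j * ℓ) := by
    intro j hj
    have hj0 : (0 : ℝ) < j := lt_of_lt_of_le (by positivity) hj
    refine choose_le_exp_mul (by exact_mod_cast hj0) ?_
    rw [hexpℓ, hx]
    have h1 : 3 / p ≤ j := by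
      have : 3 / p ≤ H / p := div_le_div_of_nonneg_right (by linarith) hp0.le
      have : 0 ≤ ξ * L := by positivity
      linarith
    rw [div_le_iff₀ hp0] at h1
    have h2 : Real.exp 1 * n ≤ (j * p) * n :=
      mul_le_mul_of_nonneg_right (by linarith [Real.exp_one_lt_d9]) hn0'.le
    linarith
  have hexpx : Real.exp (-ℓ) = 1 / x := by rw [Real.exp_neg, hexpℓ, one_div]
  -- The four exceptional events.
  have hbad1 := graphMean_exists_indep_le (V := Fin n) hp0.le hp1.le (α₀ + 1)
  have hbad2 := graphMean_few_indep_le (V := Fin n) hp0.le hp1.le s₀ j₀ r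
  have hbad3 := graphMean_spoil_le (V := Fin n) hp0.le hp1.le (by rwa [Fintype.card_fin]) s₀ j₀
    (r * j₀) t κ l (Real.exp (-a / 4)) hl0.le
    (by rw [hκ, ha]; exact spoil_moment_le hη hp0.le hpη hl hl0) (Real.exp_pos _).le
    (by rw [Real.exp_le_one_iff]; linarith)
  have hbad4 := graphMean_fewExceptional_le (V := Fin n) hp0.le hp1.le P μ u₀
    (μ * (ε / 4 * (y ^ 8 / p)))
    (by
      have h1 : y ^ 8 / x ≤ (1 - p) ^ s₁ := by
        rw [one_sub_pow_eq_exp hp1, ← ha, hypow, ← hexpℓ, ← Real.exp_sub]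
        refine Real.exp_le_exp.2 ?_
        have h2 := mul_le_mul_of_nonneg_left hs₁up ha0.le
        have h3 : a * ((1 - ξ / 24) * L) = (1 - ξ / 24) * ℓ := by rw [← haL]; ring
        rw [h3, hξ] at h2
        push_cast
        linarith
      have h4 : (μ : ℝ) * (ε / 4 * (y ^ 8 / p)) = ε / 4 * n * (μ * (y ^ 8 / x)) := by
        rw [hx]
        field_simp
      rw [h4]
      change _ ≤ (u₀ : ℝ) * (μ * (1 - p) ^ s₁)
      gcongr)
    (by
      change (μ : ℝ) * ((t + r * j₀ : ℕ) : ℝ) ≤ _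
      push_cast
      rw [mul_div_assoc]
      refine mul_le_mul_of_nonneg_left ?_ (Nat.cast_nonneg μ)
      have h1 : (r : ℝ) * (2 * L) ≤ y ^ 4 / p := by
        have h2 : (r : ℝ) * (2 * L) ≤ r * (2 * (ℓ / p)) := by gcongr
        have h3 : (r : ℝ) * (2 * (ℓ / p)) = (2 * r * ℓ) / p := by ring
        have h4 : 2 * r * ℓ ≤ y ^ 4 := by
          have : 0 ≤ (r : ℝ) * ℓ := by positivity
          linarith
        have h5 : (2 * r * ℓ) / p ≤ y ^ 4 / p := div_le_div_of_nonneg_right h4 hp0.le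
        linarith
      have h6 : 3 * (y ^ 4 / p) ≤ ε / 4 * (y ^ 8 / p) / 2 := by
        have h7 : 24 ≤ ε * y ^ 4 := by
          rw [div_le_iff₀ (by positivity)] at hyε
          have h8 : ε * y ≤ ε * y ^ 4 := mul_le_mul_of_nonneg_left hy4 hε.le
          have h9 : ε * (ε * y) ≤ 1 * (ε * y) :=
            mul_le_mul_of_nonneg_right hε1.le (by positivity)
          have h10 : y * ε ^ 2 = ε * (ε * y) := by ring
          linarith
        have h11 : ε / 4 * (y ^ 8 / p) / 2 = ε * y ^ 4 / 8 * (y ^ 4 / p) := by ring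
        rw [h11]
        exact mul_le_mul_of_nonneg_right (by linarith) (by positivity)
      linarith)
  rw [Fintype.card_fin] at hbad1 hbad2 hbad3 hbad4
  have hf1 := hbad1.trans (indep_numerics hp0 hp1 ha hn0 hℓn hα₀low)
  have hξℓ : 12 ≤ ξ * ℓ := by
    have h1 : ξ * η * ℓ ≤ ξ * ℓ := by
      refine mul_le_mul_of_nonneg_right ?_ (by linarith)
      exact mul_le_of_le_one_right hξ0.le hη1.le
    linarith
  have hf2 := hbad2.trans (few_indep_numerics hp1 ha ha0 hξ0 (by linarith) haL hL1 hs₀low hs₀L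
    hj₀low hr8 (by
      have h1 : 3 * a ≤ 3 / η := by
        have : p / η ≤ 1 / η := div_le_div_of_nonneg_right hp1.le hη.le
        have h3 : 3 / η = 3 * (1 / η) := by ring
        linarith
      have h2 : 3 / η ≤ ξ * ℓ := by
        rw [div_le_iff₀ hη]
        linarith
      linarith)
    (hchoose s₀ (by
      have : ξ * L ≤ 1 / 16 * L := mul_le_mul_of_nonneg_right (by linarith) hL0.le
      linarith)) (hchoose j₀ hj₀low))
  have hf3 := hbad3.trans (le_trans (by push_cast; exact le_rfl) (spoil_numerics
    (τ := ε / 768) (m := r * j₀) hp1 ha (by positivity) hn0 (by linarith) hlg1 has₀ haj₀ hξℓ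
    (by
      have ht0 : (0 : ℝ) < t := lt_of_lt_of_le (by positivity) htlow
      refine choose_le_exp_mul (by exact_mod_cast ht0) ?_
      have h1 : Real.exp (1 + (1 - ε / 768) * ℓ) = Real.exp 1 * (x / y ^ 4) := by
        rw [Real.exp_add, hypow, ← hexpℓ, ← Real.exp_sub]
        congr 2
        push_cast
        ring
      rw [h1, mul_assoc]
      refine mul_le_mul_of_nonneg_left ?_ (Real.exp_pos 1).le
      have h2 : (n : ℝ) = x / y ^ 4 * (y ^ 4 / p) := by
        rw [hx]
        field_simp
      calc (n : ℝ) = x / y ^ 4 * (y ^ 4 / p) := h2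
        _ ≤ x / y ^ 4 * t := by gcongr)
    (by
      push_cast
      have h1 : (s₀ : ℝ) + 2 * (r * j₀) ≤ (1 + 4 * r) * (ℓ / p) := by
        have h2 : (1 + 4 * (r : ℝ)) * L ≤ (1 + 4 * r) * (ℓ / p) :=
          mul_le_mul_of_nonneg_left hLp (by positivity)
        linarith
      have h3 : ((s₀ : ℝ) + 2 * (r * j₀)) * Real.log n ≤ (1 + 4 * r) * (ℓ / p) * y :=
        mul_le_mul h1 hlogn (by linarith) (by positivity)
      have h4 : (1 + 4 * (r : ℝ)) * (ℓ / p) * y = ((2 + 8 * r) * ℓ) * y / p / 2 := by ring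
      have h5 : ((2 + 8 * r) * ℓ) * y ≤ y ^ 4 := by
        calc ((2 + 8 * r) * ℓ) * y ≤ y * y := by gcongr
          _ = y ^ 2 := by ring
          _ ≤ y ^ 4 := pow_le_pow_right₀ hy1 (by norm_num)
      have h6 : ((2 + 8 * r) * ℓ) * y / p ≤ y ^ 4 / p := div_le_div_of_nonneg_right h5 hp0.le
      linarith)
    (by
      have : 0 ≤ (r : ℝ) * ℓ := by positivity
      linarith)))
  have hμn : 2 * ((μ : ℝ) + 1) ≤ n := by
    have h1 : 64 / ε * (x * Real.log n / y ^ 8) ≤ x / 8 := by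
      have h2 : Real.log n / y ^ 8 ≤ 1 / y := by
        rw [div_le_div_iff₀ (by positivity) hy0, one_mul]
        calc Real.log n * y ≤ y * y := by gcongr
          _ = y ^ 2 := by ring
          _ ≤ y ^ 8 := pow_le_pow_right₀ hy1 (by norm_num)
      have h3 : 64 / ε * (1 / y) ≤ 1 / 8 := by
        rw [div_mul_div_comm, div_le_div_iff₀ (by positivity) (by norm_num)]
        rw [div_le_iff₀ (by positivity)] at hyε
        have h9 : ε * (ε * y) ≤ 1 * (ε * y) :=
          mul_le_mul_of_nonneg_right hε1.le (by positivity)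
        have h10 : y * ε ^ 2 = ε * (ε * y) := by ring
        linarith
      calc 64 / ε * (x * Real.log n / y ^ 8) = x * (64 / ε * (Real.log n / y ^ 8)) := by ring
        _ ≤ x * (64 / ε * (1 / y)) := by gcongr
        _ ≤ x * (1 / 8) := mul_le_mul_of_nonneg_left h3 hx0.le
        _ = x / 8 := by ring
    have h4 : 16 ≤ x := by
      refine le_trans ?_ hxε
      rw [le_div_iff₀ hε]
      linarith
    linarith
  have hf4 := hbad4.trans (exceptional_numerics hp0 hn0 hx hy0 hε hlg1 hℓn (Nat.cast_nonneg μ)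
    hμlow hμn rfl)
  rw [hexpx] at hf1 hf2 hf3 hf4
  have hfinal : (P.finalSize : ℝ) ≤ (1 + ε / 8) * L := by
    have h1 : (P.finalSize : ℝ) = s₀ + 2 * h + 2 * j₀ + 5 := by
      simp [BreakerParams.finalSize, P]
    have h2 : ξ * L = ε / 16 * L := by rw [hξ]
    rw [h1]
    linarith
  have hsize : s₀ + 2 * h + 6 ≤ s₁ := by
    have h1 : ((s₀ + 2 * h + 6 : ℕ) : ℝ) ≤ s₁ := by
      push_cast
      linarith
    exact_mod_cast h1
  refine (graphMean_indicator_mono hp0.le hp1.le (B := _ ∪ (_ ∪ (_ ∪ _))) ?_).trans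
    ((graphMean_indicator_union_le hp0.le hp1.le _ _).trans (add_le_add hf1
      ((graphMean_indicator_union_le hp0.le hp1.le _ _).trans (add_le_add hf2
        ((graphMean_indicator_union_le hp0.le hp1.le _ _).trans (add_le_add hf3 hf4))))))
    |>.trans ?_
  · rintro G ⟨k, hk, hwin⟩
    by_contra hcon
    simp only [Set.mem_union, Set.mem_ofPred_eq, not_or, not_not] at hcon
    obtain ⟨c1, c2, c3, c4⟩ := hcon
    have hG : BreakerConditions G P :=
      { j₀_pos := hj₀pos
        size := hsize
        κ_le := hκ1
        h_spec := fun j hj => by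
          change j ≤ h
          rw [hh]
          exact le_ceil_log_div_of_one_le hκ0 hκ1 hj
        few_indep := c2
        spoil := c3 }
    refine not_makerHasWinningStrategy hG hs₀pos c4 (α₀ := α₀)
      (fun I hI => Nat.lt_succ_iff.1 (c1 I hI)) ?_ hwin
    rw [Fintype.card_fin]
    have h1 := count_numerics (k := (k : ℝ)) (F := P.finalSize) (μ := (μ : ℝ)) (α₀ := (α₀ : ℝ))
      (u₀ := (u₀ : ℝ)) hp0 hn0' hx hε hε1 hL0 (Nat.cast_nonneg k) hk.le hfinal hμup
      (Nat.cast_nonneg α₀) hα₀up hu₀up hlg1 hlogn hyε hyx (hxε.trans hxn)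
    exact_mod_cast h1
  · have : 4 / x = 1 / x + (1 / x + (1 / x + 1 / x)) := by ring
    rw [this]

/-! ### Convergence of the probabilities -/

/-- The edge density hypothesis in the form in which the estimates use it. -/
theorem eventually_density {c δ η : ℝ} (hc : 0 < c) (hδ : 0 ≤ δ) (hcδ : 1 ≤ c * δ)
    {p : ℕ → unitInterval} (hp : ∀ᶠ n : ℕ in atTop, (p n : ℝ) ≤ 1 - η)
    (hlog : ∀ᶠ n : ℕ in atTop, Real.log n ^ c / n ≤ (p n : ℝ)) (X₀ : ℝ) :
    ∀ᶠ n : ℕ in atTop, 0 < (p n : ℝ) ∧ (p n : ℝ) ≤ 1 - η ∧ X₀ ≤ n * (p n : ℝ) ∧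
      Real.log n ≤ (n * (p n : ℝ)) ^ δ := by
  have hlogtop : Tendsto (fun n : ℕ => Real.log n) atTop atTop :=
    Real.tendsto_log_atTop.comp tendsto_natCast_atTop_atTop
  filter_upwards [hp, hlog, hlogtop.eventually_ge_atTop 1, eventually_gt_atTop 0,
    ((tendsto_rpow_atTop hc).comp hlogtop).eventually_ge_atTop X₀] with n hpn hn h1 hn0 hX
  have hn0' : (0 : ℝ) < n := by exact_mod_cast hn0
  have hpow : 0 < Real.log n ^ c := Real.rpow_pos_of_pos (by linarith) c
  have hx : Real.log n ^ c ≤ n * (p n : ℝ) := by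
    rwa [div_le_iff₀ hn0', mul_comm] at hn
  refine ⟨lt_of_lt_of_le (by positivity) hn, hpn, hX.trans hx, ?_⟩
  calc Real.log n = Real.log n ^ (1 : ℝ) := (Real.rpow_one _).symm
    _ ≤ Real.log n ^ (c * δ) := Real.rpow_le_rpow_of_exponent_le h1 hcδ
    _ = (Real.log n ^ c) ^ δ := Real.rpow_mul (by linarith) c δ
    _ ≤ (n * (p n : ℝ)) ^ δ := Real.rpow_le_rpow hpow.le hx hδ

/-- An event has probability tending to `1` once its complement lies in an event of probability
`O(1 / x)` with `x → ∞`. -/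
theorem tendsto_binomialRandom_one {p : ℕ → unitInterval} {A B : ∀ n, Set (SimpleGraph (Fin n))}
    {x : ℕ → ℝ} {C : ℝ} (hx : Tendsto x atTop atTop)
    (hAB : ∀ᶠ n in atTop, (A n)ᶜ ⊆ B n ∧
      graphMean (p n : ℝ) (Set.indicator (B n) 1) ≤ C / x n) :
    Tendsto (fun n => SimpleGraph.binomialRandom (Fin n) (p n) (A n)) atTop (𝓝 1) := by
  have hlim : Tendsto (fun n => ENNReal.ofReal (1 - C / x n)) atTop (𝓝 1) := by
    have h1 : Tendsto (fun n => 1 - C / x n) atTop (𝓝 (1 - 0)) :=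
      tendsto_const_nhds.sub (hx.const_div_atTop C)
    simpa using ENNReal.tendsto_ofReal h1
  refine tendsto_of_tendsto_of_tendsto_of_le_of_le' hlim tendsto_const_nhds ?_
    (Eventually.of_forall fun n => MeasureTheory.prob_le_one)
  filter_upwards [hAB] with n hn
  rw [← binomialRandom_real_eq_graphMean] at hn
  refine ENNReal.ofReal_le_of_le_toReal ?_
  rw [← MeasureTheory.measureReal_def]
  have h1 : (SimpleGraph.binomialRandom (Fin n) (p n)).real (A n ∪ B n) = 1 := by
    have : A n ∪ B n = Set.univ := by
      rw [← Set.compl_subset_iff_union]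
      exact hn.1
    rw [this, MeasureTheory.probReal_univ]
  have h2 := MeasureTheory.measureReal_union_le (μ := SimpleGraph.binomialRandom (Fin n) (p n))
    (A n) (B n)
  linarith [hn.2]

end ColoringGame

theorem theorem1 :
    (∃ K : ℝ, 0 < K ∧ ∀ η : ℝ, 0 < η → ∀ ε : ℝ, 0 < ε → ∀ p : ℕ → unitInterval,
      (∀ᶠ n : ℕ in atTop, (p n : ℝ) ≤ 1 - η) →
      (∀ᶠ n : ℕ in atTop, Real.log n ^ (K * ε ^ (-3 : ℤ)) / n ≤ (p n : ℝ)) →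
      Tendsto (fun n : ℕ => SimpleGraph.binomialRandom (Fin n) (p n)
          {G : SimpleGraph (Fin n) |
            (1 - ε) * (n / Real.logb (1 / (1 - (p n : ℝ))) (n * (p n : ℝ)))
              ≤ (ColoringGame.gameChromaticNumber G : ℝ)})
        atTop (𝓝 1)) ∧
    (∀ η : ℝ, 0 < η → ∀ α : ℝ, 2 < α → ∀ p : ℕ → unitInterval,
      (∀ᶠ n : ℕ in atTop, (p n : ℝ) ≤ 1 - η) →
      (∀ᶠ n : ℕ in atTop,
        Real.log n ^ (max (2 * α / (α - 1)) (α / (α - 2))) / n ≤ (p n : ℝ)) →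
      Tendsto (fun n : ℕ => SimpleGraph.binomialRandom (Fin n) (p n)
          {G : SimpleGraph (Fin n) |
            (ColoringGame.gameChromaticNumber G : ℝ)
              ≤ α * (n / Real.logb (1 / (1 - (p n : ℝ))) (n * (p n : ℝ)))})
        atTop (𝓝 1)) := by
  refine ⟨⟨3072, by norm_num, fun η hη ε hε p hp hlog => ?_⟩, fun η hη α hα p hp hlog => ?_⟩
  · have hc : 0 < 3072 * ε ^ (-3 : ℤ) := by positivity
    have htop : Tendsto (fun n : ℕ => n * (p n : ℝ)) atTop atTop :=
      tendsto_atTop.2 fun X => (ColoringGame.eventually_density hc (one_div_pos.2 hc).le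
        (mul_one_div_cancel hc.ne').ge hp hlog X).mono fun n hn => hn.2.2.1
    rcases lt_or_ge ε 1 with hε1 | hε1
    · -- The exponent `ε / 3072` in `exists_threshold_breaker` needs only `K ε⁻³ ε ≥ 3072`.
      have hcδ : 1 ≤ 3072 * ε ^ (-3 : ℤ) * (ε / 3072) := by
        have h : 3072 * ε ^ (-3 : ℤ) * (ε / 3072) = 1 / ε ^ 2 := by
          rw [zpow_neg]
          field_simp
        rw [h, le_div_iff₀ (by positivity), one_mul]
        exact pow_le_one₀ hε.le hε1.le
      obtain ⟨X₀, hX₀⟩ := ColoringGame.exists_threshold_breaker hε hε1 hη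
      refine ColoringGame.tendsto_binomialRandom_one htop
        ((ColoringGame.eventually_density hc (by positivity) hcδ hp hlog X₀).mono
          fun n ⟨h0, h1, h2, h3⟩ => ⟨fun G hG => ?_, hX₀ n (p n) h0 h1 h2 h3⟩)
      exact ⟨ColoringGame.gameChromaticNumber G, lt_of_not_ge hG,
        Nat.sInf_mem (ColoringGame.exists_makerHasWinningStrategy G)⟩
    · -- For `1 ≤ ε` the lower bound is not positive, because `log_b x` is nonnegative.
      refine ColoringGame.tendsto_binomialRandom_one (B := fun _ => ∅) (C := 0) htop ?_
      filter_upwards [ColoringGame.eventually_density hc (one_div_pos.2 hc).le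
        (mul_one_div_cancel hc.ne').ge hp hlog 1] with n ⟨h0, h1, h2, _⟩
      refine ⟨fun G hG => hG (le_trans (b := (0 : ℝ)) ?_ (Nat.cast_nonneg _)),
        by simp [ColoringGame.graphMean]⟩
      refine mul_nonpos_of_nonpos_of_nonneg (by linarith) (div_nonneg (Nat.cast_nonneg n) ?_)
      have hp1 : 0 < 1 - (p n : ℝ) := by linarith
      refine Real.logb_nonneg ?_ h2
      rw [one_lt_div hp1]
      linarith
  · have hK : 2 ≤ max (2 * α / (α - 1)) (α / (α - 2)) := by
      refine le_trans ?_ (le_max_left _ _)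
      rw [le_div_iff₀ (by linarith)]
      linarith
    obtain ⟨X₀, hX₀⟩ := ColoringGame.exists_threshold_maker hα hη
    have hd := fun X => ColoringGame.eventually_density (δ := 1 / 2) (by linarith) (by norm_num)
      (by linarith) hp hlog X
    refine ColoringGame.tendsto_binomialRandom_one
      (tendsto_atTop.2 fun X => (hd X).mono fun n hn => hn.2.2.1) ((hd (max X₀ 1)).mono
      fun n ⟨h0, h1, h2, h3⟩ => ⟨?_, hX₀ n (p n) h0 h1 ((le_max_left _ _).trans h2) h3⟩)
    intro G hG hwin
    refine hG ?_
    have hp1 : 0 < 1 - (p n : ℝ) := by linarith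
    have hk : ColoringGame.gameChromaticNumber G
        ≤ ⌊α * (n / Real.logb (1 / (1 - (p n : ℝ))) (n * (p n : ℝ)))⌋₊ := Nat.sInf_le hwin
    refine (Nat.cast_le.2 hk).trans (Nat.floor_le ?_)
    refine mul_nonneg (by linarith) (div_nonneg (Nat.cast_nonneg n) ?_)
    refine Real.logb_nonneg ?_ ((le_max_right _ _).trans h2)
    rw [one_lt_div hp1]
    linarith
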